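/- **Setting.** There are $k\ge 1$ arms and $T\ge 2k$ rounds. In round $t$ the environment chooses $\ell_t\in[-1,1]^k$, possibly at random and depending on the arms $A_1,\dots,A_{t-1}$ chosen so far; simultaneously the learner chooses $A_t\in[k]$ and then observes only $\ell_{tA_t}$. Let $\mathsf{Reg}_T=\max_{i\in[k]}\mathbb E\big[\sum_{t=1}^T(\ell_{tA_t}-\ell_{ti})\big]$ and $L_2=\mathbb E\big[\sum_{t=1}^T\|\ell_t\|^2\big]$. **Algorithm.** Let $H(p)=\sum_i p_i\log(1/p_i)$, $\beta_1=15k$, $c_1=\sqrt{2\log(1+T/\beta_1)}$. In round $t$ let $$q_t=\operatorname*{arg\,min}_{q}\Big\langle\sum_{s<t}\hat y_s,q\Big\rangle+\beta_t\sum_i q_i\log q_i+4\sum_i\log\frac1{q_i}$$ over the probability vectors $q$ with positive entries, where $\hat y_{si}=\ell_{si}\mathbf 1[A_s=i]/p_{si}$, draw $A_t$ from $p_t=(1-\frac kT)q_t+\frac1T\mathbf 1$, and let $\beta_{t+1}$ satisfy $$\beta_{t+1}=\beta_t+\frac{c_1\nu_t}{\sqrt{81c_1^2+\sum_{s=1}^{t}\nu_sh_{s+1}}},\qquad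 \nu_t=\frac{\ell_{tA_t}^2}{p_{tA_t}}\min\Big\{1,\frac{p_{tA_t}\beta_t}{2}\Big\},\qquad h_t=\frac{H(p_t)}{1-k/T}$$ (an implicit equation, since $h_{t+1}$ depends on $\beta_{t+1}$). The algorithm uses $k$ and $T$ only. **Theorem.** There is an absolute constant $K$ such that for all $k\ge1$ and $T\ge2k$ this algorithm exists, and every algorithm of this form has the following properties. 1. *Adversarial regime.* For every environment, $$\mathsf{Reg}_T\le4\sqrt{L_2\log(k)\log(1+T)}+K\,k\log T .$$ 2. *Adversarial regime with a $(\Delta,C,T)$ self-bounding constraint.* Let $\Delta\in[0,2]^k$, $C\ge0$, and suppose that every algorithm has $\mathsf{Reg}_T\ge\mathbb E[\sum_{t=1}^T\Delta_{A_t}-C]$ in the environment, that almost surely every $\ell_t$ has at most $s$ non-zero entries, and that $\Delta_{\min}=\min_{a\ne a^*}\Delta_a>0$ for an arm $a^*$. Then $$\mathsf{Reg}_T\le K\left(\frac{s\log(T)\log(kT)}{\Delta_{\min}}+\sqrt{\frac{C\,s\log(T)\log(kT)}{\Delta_{\min}}}+k\log T\right).$$ 3. *Stochastic regime.* Let $\ell_1,\ell_2,\dots$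 be i.i.d. with law $\nu^*$, independent of the chosen arms, and suppose that $\Delta_{\min}=\min_{a\ne a^*}\mathbb E_{\ell\sim\nu^*}[\ell_a-\ell_{a^*}]>0$ for an arm $a^*$. Then $$\mathsf{Reg}_T\le K\left(\frac{\mathbb E_{\ell\sim\nu^*}\big[\sum_{i=1}^k\ell_i^2\big]\log(T)\log(kT)}{\Delta_{\min}}+k\log T+(\log T)^2\right).$$ -/

import Mathlib

open MeasureTheory ProbabilityTheory

universe u

noncomputable section

namespace SparseBandit

/-- What the learner has seen before a round preceded by `t` rounds: the arms that were chosen and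
the losses of these arms. Rounds are numbered from `0`. -/
abbrev Hist (k t : ℕ) : Type := Fin t → Fin k × ℝ

/-- A (randomized) bandit algorithm: `prob t h i` is the probability of choosing arm `i` in round `t`
after the observations `h`. -/
structure Policy (k : ℕ) where
  prob : (t : ℕ) → Hist k t → Fin k → ℝ
  nonneg : ∀ t h i, 0 ≤ prob t h i
  sum_eq_one : ∀ t h, ∑ i, prob t h i = 1
  measurable_prob : ∀ t i, Measurable fun h : Hist k t => prob t h i

/-- An environment with losses in `[-1, 1]`. Its own randomness is a point `ω` of a probability space;
the loss vector of round `t` is a function of `ω` and of the arms chosen in the earlier rounds. -/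
structure Environment (k : ℕ) where
  Ω : Type u
  mΩ : MeasurableSpace Ω
  μ : Measure Ω
  isProb : IsProbabilityMeasure μ
  loss : (t : ℕ) → Ω → (Fin t → Fin k) → Fin k → ℝ
  measurable_loss : ∀ t a i, Measurable fun ω => loss t ω a i
  abs_loss_le_one : ∀ t ω a i, |loss t ω a i| ≤ 1

attribute [instance] Environment.mΩ Environment.isProb

namespace Environment

variable {k : ℕ} (E : Environment.{u} k) (T : ℕ)

/-- The loss vector of round `t` when the arms `a` are played. -/
def lossAt {T : ℕ} (ω : E.Ω) (a : Fin T → Fin k) (t : Fin T) : Fin k → ℝ :=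
  E.loss t ω (Fin.take t t.isLt.le a)

/-- The observations before round `t` when the arms `a` are played. -/
def observed {T : ℕ} (ω : E.Ω) (a : Fin T → Fin k) (t : Fin T) : Hist k t :=
  Fin.take t t.isLt.le fun s => (a s, E.lossAt ω a s (a s))

/-- The probability, given `ω`, that the policy plays the arms `a` in the first `T` rounds. -/
def playProb {T : ℕ} (π : Policy k) (ω : E.Ω) (a : Fin T → Fin k) : ℝ :=
  ∏ t : Fin T, π.prob t (E.observed ω a t) (a t)

/-- Expectation of `f`, a function of `ω` and of the arms `A` chosen in `T` rounds, over the randomness of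
the environment and of the algorithm. -/
def expect (π : Policy k) (f : E.Ω → (Fin T → Fin k) → ℝ) : ℝ :=
  ∫ ω, ∑ a : Fin T → Fin k, E.playProb π ω a * f ω a ∂E.μ

/-- Regret against the fixed arm `i`. -/
def regretAgainst (π : Policy k) (i : Fin k) : ℝ :=
  E.expect T π fun ω a => ∑ t : Fin T, (E.lossAt ω a t (a t) - E.lossAt ω a t i)

/-- Regret against the arm of least expected cumulative loss. -/
def regret (π : Policy k) : ℝ := ⨆ i : Fin k, E.regretAgainst T π i

/-- Expectation of `L₂ = ∑ₜ ‖ℓₜ‖²`. -/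
def L2 (π : Policy k) : ℝ :=
  E.expect T π fun ω a => ∑ t : Fin T, ∑ i, E.lossAt ω a t i ^ 2

/-- In each of the first `T` rounds at most `s` arms have a non-zero loss. -/
def IsSparse (s : ℕ) : Prop :=
  ∀ᵐ ω ∂E.μ, ∀ (a : Fin T → Fin k) (t : Fin T), {i | E.lossAt ω a t i ≠ 0}.ncard ≤ s

/-- The adversarial regime with a `(Δ, C, T)` self-bounding constraint. -/
structure IsSelfBounding (Δ : Fin k → ℝ) (C : ℝ) : Prop where
  gap_mem : ∀ i, Δ i ∈ Set.Icc (0 : ℝ) 2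
  C_nonneg : 0 ≤ C
  le_regret : ∀ π : Policy k,
    E.expect T π (fun _ a => (∑ t : Fin T, Δ (a t)) - C) ≤ E.regret T π

/-- The stochastic regime: the loss vectors do not depend on the chosen arms and are independent with
the common law `ν`. -/
def IsStochastic (ν : Measure (Fin k → ℝ)) : Prop :=
  ∃ X : ℕ → E.Ω → Fin k → ℝ, (∀ t ω a, E.loss t ω a = X t ω) ∧
    iIndepFun X E.μ ∧ ∀ t, E.μ.map (X t) = ν

end Environment

/-- `min_{a ≠ a⋆} Δ a`. -/
def gapMin {k : ℕ} (Δ : Fin k → ℝ) (aStar : Fin k) : ℝ := ⨅ a : {a : Fin k // a ≠ aStar}, Δ a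

/-- The gaps `E[ℓ a - ℓ a⋆]` of a law of loss vectors. -/
def gap {k : ℕ} (ν : Measure (Fin k → ℝ)) (aStar a : Fin k) : ℝ := ∫ x, (x a - x aStar) ∂ν

/-! ### The algorithm -/

/-- The probability vectors with positive entries: the domain of the log-barrier. -/
def posSimplex (k : ℕ) : Set (Fin k → ℝ) := {q | (∀ i, 0 < q i) ∧ ∑ i, q i = 1}

/-- Shannon entropy. -/
def entropy {k : ℕ} (p : Fin k → ℝ) : ℝ := ∑ i, Real.negMulLog (p i)

/-- The hybrid regularizer `β ∑ qᵢ log qᵢ + 4 ∑ log (1 / qᵢ)`, where `β = 1 / η`. -/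
def regularizer {k : ℕ} (β : ℝ) (q : Fin k → ℝ) : ℝ :=
  β * ∑ i, q i * Real.log (q i) + 4 * ∑ i, Real.log (1 / q i)

/-- `∑ₛ ŷₛ` for the inverse weighted estimators `ŷₛᵢ = ℓₛᵢ 1[Aₛ = i] / pₛᵢ` of the rounds in `h`. -/
def cumEstimate {k : ℕ} (p : (t : ℕ) → Hist k t → Fin k → ℝ) {t : ℕ} (h : Hist k t) (i : Fin k) : ℝ :=
  ∑ s : Fin t, if (h s).1 = i then (h s).2 / p s (Fin.take s s.isLt.le h) i else 0

/-- `νₛ = (ℓ² / p) min {1, p / (2 η)}` with `ℓ`, `p` the loss and the probability of the arm chosen in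
round `s`, and `1 / η = β`. -/
def stab {k : ℕ} (p : (t : ℕ) → Hist k t → Fin k → ℝ) (β : (t : ℕ) → Hist k t → ℝ) {t : ℕ}
    (h : Hist k t) (s : Fin t) : ℝ :=
  (h s).2 ^ 2 / p s (Fin.take s s.isLt.le h) (h s).1 *
    min 1 (p s (Fin.take s s.isLt.le h) (h s).1 * β s (Fin.take s s.isLt.le h) / 2)

/-- `H(p) / (1 - k / T)`. -/
def penalty {k : ℕ} (T : ℕ) (p : Fin k → ℝ) : ℝ := 1 / (1 - (k : ℝ) / T) * entropy p

/-- `c₁ = √(2 log (1 + T / β₁))` with `β₁ = 15 k`. -/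
def c1 (k T : ℕ) : ℝ := √(2 * Real.log (1 + (T : ℝ) / (15 * k)))

/-- `π` is follow-the-regularized-leader with the hybrid regularizer, uniform exploration `k / T` and the
stability-penalty-adaptive learning rate `1 / β`. The equation for `β (t + 1) h` is implicit: its right-hand
side contains `π.prob (t + 1) h`, which depends on `β (t + 1) h`. -/
def IsSPAFTRL {k : ℕ} (T : ℕ) (π : Policy k) : Prop :=
  ∃ (q : (t : ℕ) → Hist k t → Fin k → ℝ) (β : (t : ℕ) → Hist k t → ℝ),
    (∀ t, Measurable (β t)) ∧
    (∀ t h, q t h ∈ posSimplex k ∧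
      IsMinOn (fun x => (∑ i, cumEstimate π.prob h i * x i) + regularizer (β t h) x)
        (posSimplex k) (q t h)) ∧
    (∀ t h i, π.prob t h i = (1 - (k : ℝ) / T) * q t h i + (k : ℝ) / T / k) ∧
    (∀ h, β 0 h = 15 * k) ∧
    (∀ t (h : Hist k (t + 1)),
      β (t + 1) h = β t (Fin.take t t.le_succ h) +
        c1 k T * stab π.prob β h (Fin.last t) /
          √(81 * c1 k T ^ 2 + ∑ s : Fin (t + 1), stab π.prob β h s *
            penalty T (π.prob (s + 1) (Fin.take (s + 1) s.isLt h))))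

end SparseBandit

end

/-! The core is pathwise. Along one run, the regularized leader pays in each round a stability term
of at most `3/4 * ν_t / β_t` and a penalty term `(β_{t+1} - β_t) * h_{t+1}`, plus `O(k log T)` once
(`ftrl_bound`). The log-barrier bounds stability by a multiple of `ℓ²` however small `p` is, the
entropy by a multiple of `ℓ² / (p β)`; together they give `ν / β` (`stability_le`).

The rule for `β` makes both sums depend on `S = ∑ ν_t h_{t+1}` alone. The penalties telescope to `2
c₁ √S`. The stability terms are at most `√(81 c₁² + S) / c₁` times the relative increments of `β`,
which add up to about `log (β_T / β_0)`. Exploration bounds the entropy from below, so `β` grows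
only polynomially and this logarithm is at most `c₁²` (`log_beta_sub_le`). Hence the estimated
regret is `O(c₁ √S + k log T)` (`sum_est_le`).

Given the randomness of the environment, the estimators are unbiased and the conditional mean of
`ν_t` is at most `‖ℓ_t‖²`. With `h ≤ log k / (1 - k/T)` this is the adversarial bound. The other
regimes use that the entropy is at most about `log (kT)` times the probability of missing `a*`.
Since `h_{t+1}` depends on `A_t`, it must first be replaced by `4 h_t`: leaders of consecutive
rounds are comparable unless `β` jumps (`next_leader_le`, `pen_succ_le`), and a jump is only
possible while `S ≤ 2 log³ T` (`prodSum_le`). The expected number of pulls off `a*`, times the gap,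
is at most regret plus `C`, so the regret is bounded by the square root of an affine function of
itself (`le_of_self_bounding`). In the stochastic regime `ℓ_t` is independent of the arm
probabilities of round `t`, so the second moment factors out.

For existence, the leader is continuous in the cumulative estimates and in `β`; the right-hand side
of the implicit equation is then continuous and bounded in the unknown, and its least fixed point is
measurable. -/

noncomputable section

namespace SparseBandit

/-! ### Entropy -/

/-- Gibbs inequality. -/
lemma entropy_le_cross {k : ℕ} {p r : Fin k → ℝ} (hp : ∀ i, 0 ≤ p i) (hr : ∀ i, 0 < r i)
    (hp1 : ∑ i, p i = 1) (hr1 : ∑ i, r i ≤ 1) : entropy p ≤ ∑ i, p i * Real.log (1 / r i) := by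
  have key : ∀ i, Real.negMulLog (p i) ≤ p i * Real.log (1 / r i) + (r i - p i) := by
    intro i
    rcases (hp i).eq_or_lt with h0 | h0
    · rw [← h0]; simpa [Real.negMulLog] using (hr i).le
    · have h1 := Real.log_le_sub_one_of_pos (div_pos (hr i) h0)
      rw [Real.log_div (hr i).ne' h0.ne'] at h1
      have h2 := mul_le_mul_of_nonneg_left h1 h0.le
      have h3 : p i * (r i / p i - 1) = r i - p i := by field_simp
      rw [h3] at h2
      rw [one_div, Real.log_inv, Real.negMulLog]
      nlinarith
  calc entropy p ≤ ∑ i, (p i * Real.log (1 / r i) + (r i - p i)) := Finset.sum_le_sum fun i _ => key i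
    _ ≤ ∑ i, p i * Real.log (1 / r i) := by
      rw [Finset.sum_add_distrib, Finset.sum_sub_distrib, hp1]; linarith

lemma le_one_of_sum_eq_one {k : ℕ} {p : Fin k → ℝ} (hp : ∀ i, 0 ≤ p i) (hp1 : ∑ i, p i = 1)
    (i : Fin k) : p i ≤ 1 :=
  hp1 ▸ Finset.single_le_sum (f := p) (fun j _ => hp j) (Finset.mem_univ i)

lemma entropy_nonneg {k : ℕ} {p : Fin k → ℝ} (hp : ∀ i, 0 ≤ p i) (hp1 : ∑ i, p i = 1) :
    0 ≤ entropy p :=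
  Finset.sum_nonneg fun i _ => Real.negMulLog_nonneg (hp i) (le_one_of_sum_eq_one hp hp1 i)

/-- The terms of the cross entropy with `r` are nonnegative, so pointwise domination passes to it.
With `c = 4` this compares the penalties of consecutive rounds. -/
lemma entropy_le_mul {k : ℕ} {p r : Fin k → ℝ} {c : ℝ} (hp : ∀ i, 0 ≤ p i) (hr : ∀ i, 0 < r i)
    (hp1 : ∑ i, p i = 1) (hr1 : ∑ i, r i = 1) (h : ∀ i, p i ≤ c * r i) :
    entropy p ≤ c * entropy r := by
  refine (entropy_le_cross hp hr hp1 hr1.le).trans ?_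
  rw [entropy, Finset.mul_sum]
  refine Finset.sum_le_sum fun i _ => ?_
  have h1 : 0 ≤ Real.log (1 / r i) :=
    Real.log_nonneg (by
      rw [le_div_iff₀ (hr i)]; linarith [le_one_of_sum_eq_one (fun j => (hr j).le) hr1 i])
  calc _ ≤ c * r i * Real.log (1 / r i) := mul_le_mul_of_nonneg_right (h i) h1
    _ = _ := by rw [one_div, Real.log_inv, Real.negMulLog]; ring

lemma entropy_le_log_card {k : ℕ} {p : Fin k → ℝ} (hk : 1 ≤ k) (hp : ∀ i, 0 ≤ p i)
    (hp1 : ∑ i, p i = 1) : entropy p ≤ Real.log k := by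
  have hk' : (0 : ℝ) < k := by exact_mod_cast hk
  refine (entropy_le_cross (r := fun _ => 1 / (k : ℝ)) hp (fun _ => by positivity) hp1
    (by simp [hk'.ne'])).trans ?_
  rw [← Finset.sum_mul, hp1]; simp

/-- Gibbs against a law with mass `1 - 1/T` at `a` and `1/(kT)` elsewhere. Arm `a` then costs at
most `2/T`, which `ha` turns into a multiple of `1 - p a`. -/
lemma entropy_le_one_sub_mul {k T : ℕ} {p : Fin k → ℝ} (hk : 1 ≤ k) (hT : 2 ≤ T) (hp : ∀ i, 0 ≤ p i)
    (hp1 : ∑ i, p i = 1) (a : Fin k) (ha : 1 / (T : ℝ) ≤ 1 - p a) :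
    entropy p ≤ (Real.log (k * T) + 2) * (1 - p a) := by
  have hk' : (0 : ℝ) < k := by exact_mod_cast hk
  have hT' : (2 : ℝ) ≤ T := by exact_mod_cast hT
  have hinv : 1 / (T : ℝ) ≤ 1 / 2 := one_div_le_one_div_of_le (by norm_num) hT'
  have hipos : 0 < 1 / (T : ℝ) := by positivity
  set r : Fin k → ℝ := fun i => if i = a then 1 - 1 / (T : ℝ) else 1 / (k * T) with hr
  have hrsum : ∑ i, r i ≤ 1 := by
    have h1 : ∀ i, r i ≤ (if i = a then 1 - 1 / (T : ℝ) else 0) + 1 / (k * T) := by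
      intro i; simp only [hr]; split_ifs
      · have : (0 : ℝ) ≤ 1 / (k * T) := by positivity
        linarith
      · linarith
    refine (Finset.sum_le_sum fun i _ => h1 i).trans ?_
    rw [Finset.sum_add_distrib]; simp
    field_simp; simp
  have hrpos : ∀ i, 0 < r i := by
    intro i; simp only [hr]; split_ifs
    · linarith
    · positivity
  refine (entropy_le_cross hp hrpos hp1 hrsum).trans ?_
  rw [← Finset.add_sum_erase _ _ (Finset.mem_univ a)]
  have h2 : ∑ i ∈ Finset.univ.erase a, p i * Real.log (1 / r i) = (1 - p a) * Real.log (k * T) := by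
    have h3 : 1 - p a = ∑ i ∈ Finset.univ.erase a, p i := by
      have := Finset.add_sum_erase _ p (Finset.mem_univ a)
      linarith
    rw [h3, Finset.sum_mul]
    refine Finset.sum_congr rfl fun i hi => ?_
    simp only [hr, Finset.ne_of_mem_erase hi, if_false, one_div_one_div]
  rw [h2]
  have h3 : Real.log (1 / r a) ≤ 2 * (1 / (T : ℝ)) := by
    have h4 := Real.log_le_sub_one_of_pos (x := 1 / r a) (by have := hrpos a; positivity)
    refine h4.trans ?_
    simp only [hr, if_true]
    rw [sub_le_iff_le_add, div_le_iff₀ (by linarith)]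
    nlinarith
  have h5 : p a * Real.log (1 / r a) ≤ 2 * (1 - p a) := by
    have h6 := le_one_of_sum_eq_one hp hp1 a
    have h7 : 0 ≤ Real.log (1 / r a) :=
      Real.log_nonneg (by rw [le_div_iff₀ (hrpos a)]; simp only [hr, if_true]; linarith)
    nlinarith [hp a]
  linarith

/-- At most one coordinate exceeds 1/2, and each of the other `k - 1 ≥ k/2` contributes at least
`log 2 / T`. This floor on the penalty limits the growth of `β`. -/
lemma le_entropy {k T : ℕ} {p : Fin k → ℝ} (hk : 2 ≤ k) (hp : ∀ i, 1 / (T : ℝ) ≤ p i) (hT : 1 ≤ T)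
    (hp1 : ∑ i, p i = 1) : k / T * (Real.log 2 / 2) ≤ entropy p := by
  have hT' : (0 : ℝ) < T := by exact_mod_cast hT
  have hk' : (2 : ℝ) ≤ k := by exact_mod_cast hk
  have hpos : ∀ i, 0 < p i := fun i => lt_of_lt_of_le (by positivity) (hp i)
  have hle := le_one_of_sum_eq_one (fun i => (hpos i).le) hp1
  have hlog2 : 0 < Real.log 2 := Real.log_pos (by norm_num)
  obtain ⟨a, ha⟩ : ∃ a : Fin k, ∀ i, i ≠ a → p i ≤ 1 / 2 := by
    by_cases h : ∃ a, 1 / 2 < p a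
    · obtain ⟨a, ha⟩ := h
      refine ⟨a, fun i hi => ?_⟩
      have h1 : p a + p i ≤ ∑ j, p j := by
        rw [← Finset.sum_pair (f := p) hi.symm]
        exact Finset.sum_le_sum_of_subset_of_nonneg (Finset.subset_univ _) fun j _ _ => (hpos j).le
      linarith
    · push Not at h
      exact ⟨⟨0, by omega⟩, fun i _ => h i⟩
  have key : ∀ i ∈ Finset.univ.erase a, 1 / (T : ℝ) * Real.log 2 ≤ Real.negMulLog (p i) := by
    intro i hi
    have h1 := ha i (Finset.ne_of_mem_erase hi)
    have h2 : Real.log 2 ≤ - Real.log (p i) := by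
      rw [← Real.log_inv]
      refine Real.log_le_log (by norm_num) ?_
      rw [le_inv_comm₀ (by norm_num) (hpos i)]; linarith
    rw [Real.negMulLog]
    calc _ ≤ p i * (- Real.log (p i)) :=
          mul_le_mul (hp i) h2 hlog2.le (hpos i).le
      _ = _ := by ring
  rw [entropy, ← Finset.add_sum_erase _ _ (Finset.mem_univ a)]
  have h3 := Finset.sum_le_sum key
  rw [Finset.sum_const, Finset.card_erase_of_mem (Finset.mem_univ a), Finset.card_univ,
    Fintype.card_fin, nsmul_eq_mul, Nat.cast_sub (by omega)] at h3
  have h4 := Real.negMulLog_nonneg (hpos a).le (hle a)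
  have h5 : (k : ℝ) / T * (Real.log 2 / 2) ≤ ((k : ℝ) - (1 : ℕ)) * (1 / T * Real.log 2) := by
    have : (k : ℝ) / 2 ≤ k - 1 := by linarith
    calc _ = (k : ℝ) / 2 * (1 / T * Real.log 2) := by ring
      _ ≤ (k - 1 : ℝ) * (1 / T * Real.log 2) := mul_le_mul_of_nonneg_right this (by positivity)
      _ = _ := by simp
  linarith

/-- Concavity of `-x log x`. This is the reason for the factor `1 / (1 - k/T)` in `penalty`, which
then dominates the entropy of the leader itself. -/
lemma mul_entropy_le_entropy_mix {k : ℕ} {q : Fin k → ℝ} {γ : ℝ} (hk : 1 ≤ k) (hq : ∀ i, 0 ≤ q i)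
    (h0 : 0 ≤ γ) (h1 : γ ≤ 1) :
    (1 - γ) * entropy q ≤ entropy fun i => (1 - γ) * q i + γ / k := by
  have hk' : (1 : ℝ) ≤ k := by exact_mod_cast hk
  rw [entropy, entropy, Finset.mul_sum]
  refine Finset.sum_le_sum fun i _ => ?_
  have h2 := Real.concaveOn_negMulLog.2 (x := q i) (y := 1 / k) (hq i)
    (by simp) (sub_nonneg.2 h1) h0 (by ring)
  have h3 : 0 ≤ Real.negMulLog (1 / k) :=
    Real.negMulLog_nonneg (by positivity) (by rw [div_le_one (by linarith)]; exact hk')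
  simp only [smul_eq_mul] at h2
  have h4 : γ * (1 / (k : ℝ)) = γ / k := by ring
  rw [h4] at h2
  nlinarith

/-! ### The regularized leader -/

/-- The Bregman divergence of one coordinate of the regularizer. -/
def breg (β x q : ℝ) : ℝ := β * (x * Real.log (x / q) - x + q) + 4 * (x / q - 1 - Real.log (x / q))

lemma entropy_breg_nonneg {x q : ℝ} (hx : 0 < x) (hq : 0 < q) : 0 ≤ x * Real.log (x / q) - x + q := by
  have h := Real.log_le_sub_one_of_pos (div_pos hq hx)
  have h2 : Real.log (x / q) = - Real.log (q / x) := by rw [← Real.log_inv, inv_div]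
  have h3 : x * (q / x - 1) = q - x := by field_simp
  rw [h2]
  nlinarith [mul_le_mul_of_nonneg_left h hx.le]

lemma log_breg_nonneg {x q : ℝ} (hx : 0 < x) (hq : 0 < q) : 0 ≤ x / q - 1 - Real.log (x / q) := by
  linarith [Real.log_le_sub_one_of_pos (div_pos hx hq)]

lemma breg_nonneg {β x q : ℝ} (hβ : 0 ≤ β) (hx : 0 < x) (hq : 0 < q) : 0 ≤ breg β x q := by
  have h1 := entropy_breg_nonneg hx hq
  have h2 := log_breg_nonneg hx hq
  unfold breg; positivity

/-- The objective of the regularized leader. -/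
def objective {k : ℕ} (L : Fin k → ℝ) (β : ℝ) (x : Fin k → ℝ) : ℝ :=
  (∑ i, L i * x i) + regularizer β x

/-- The gradient of the objective. -/
def grad {k : ℕ} (L : Fin k → ℝ) (β : ℝ) (q : Fin k → ℝ) (i : Fin k) : ℝ :=
  L i + β * (Real.log (q i) + 1) - 4 / q i

/-- The domain is open within its hyperplane, so the minimizer is interior and can be perturbed both
ways along `v`. -/
lemma sum_grad_mul_eq_zero {k : ℕ} {L q : Fin k → ℝ} {β : ℝ} (hq : q ∈ posSimplex k)
    (hmin : IsMinOn (objective L β) (posSimplex k) q) {v : Fin k → ℝ} (hv : ∑ i, v i = 0) :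
    ∑ i, grad L β q i * v i = 0 := by
  have hline : ∀ i, HasDerivAt (fun s : ℝ => q i + s * v i) (v i) 0 := fun i => by
    simpa using ((hasDerivAt_id (0 : ℝ)).mul_const (v i)).const_add (q i)
  have hne : ∀ i, q i + 0 * v i ≠ 0 := fun i => by simpa using (hq.1 i).ne'
  have hderiv : HasDerivAt (fun s : ℝ => objective L β fun i => q i + s * v i)
      (∑ i, grad L β q i * v i) 0 := by
    have h1 : ∀ i, HasDerivAt (fun s : ℝ => L i * (q i + s * v i) +
        (β * ((q i + s * v i) * Real.log (q i + s * v i)) - 4 * Real.log (q i + s * v i)))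
        (grad L β q i * v i) 0 := fun i => by
      have hl := (hline i).log (hne i)
      have := ((hline i).const_mul (L i)).add
        ((((hline i).mul hl).const_mul β).sub (hl.const_mul 4))
      refine this.congr_deriv ?_
      have := (hq.1 i).ne'
      simp only [zero_mul, add_zero, grad]
      field_simp
      ring
    have h2 := HasDerivAt.fun_sum (u := Finset.univ) fun i _ => h1 i
    refine h2.congr_of_eventuallyEq (Filter.Eventually.of_forall fun s => ?_)
    simp only [Finset.sum_add_distrib, Finset.sum_sub_distrib]
    simp only [objective, regularizer, one_div, Real.log_inv, Finset.mul_sum, mul_neg,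
      Finset.sum_neg_distrib]
    rw [sub_eq_add_neg]
  refine IsLocalMin.hasDerivAt_eq_zero ?_ hderiv
  have hpos : ∀ᶠ s in nhds (0 : ℝ), ∀ i, 0 < q i + s * v i := by
    rw [Filter.eventually_all]
    intro i
    exact (hline i).continuousAt.eventually_const_lt (by simpa using hq.1 i)
  filter_upwards [hpos] with s hs
  have := hmin (a := fun i => q i + s * v i)
    ⟨hs, by rw [Finset.sum_add_distrib, hq.2, ← Finset.mul_sum, hv]; ring⟩
  simpa using this

lemma grad_eq_grad {k : ℕ} {L q : Fin k → ℝ} {β : ℝ} (hq : q ∈ posSimplex k)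
    (hmin : IsMinOn (objective L β) (posSimplex k) q) (i j : Fin k) :
    grad L β q i = grad L β q j := by
  have := sum_grad_mul_eq_zero hq hmin (v := Pi.single i 1 - Pi.single j 1) (by simp)
  simp [mul_sub, Finset.sum_sub_distrib, Pi.single_apply] at this
  linarith

/-- An equality, not just an inequality: the first-order term vanishes along the hyperplane, and the
linear part has no Bregman divergence. -/
lemma objective_sub_eq {k : ℕ} {L q x : Fin k → ℝ} {β : ℝ} (hq : q ∈ posSimplex k)
    (hmin : IsMinOn (objective L β) (posSimplex k) q) (hx : x ∈ posSimplex k) :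
    objective L β x - objective L β q = ∑ i, breg β (x i) (q i) := by
  have h := sum_grad_mul_eq_zero hq hmin (v := fun i => x i - q i)
    (by rw [Finset.sum_sub_distrib, hx.2, hq.2, sub_self])
  have key : ∀ i, breg β (x i) (q i) = (L i * x i + (β * (x i * Real.log (x i)) +
      4 * Real.log (1 / x i))) - (L i * q i + (β * (q i * Real.log (q i)) + 4 * Real.log (1 / q i)))
      - grad L β q i * (x i - q i) := by
    intro i
    have h1 := hq.1 i
    have h2 := hx.1 i
    rw [breg, grad, Real.log_div h2.ne' h1.ne', one_div, one_div, Real.log_inv, Real.log_inv]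
    field_simp
    ring
  rw [Finset.sum_congr rfl fun i _ => key i, Finset.sum_sub_distrib, h, Finset.sum_sub_distrib,
    Finset.sum_add_distrib, Finset.sum_add_distrib, Finset.sum_add_distrib, Finset.sum_add_distrib]
  simp only [objective, regularizer, Finset.mul_sum]
  ring

/-! ### One-dimensional estimates -/

/-- The cubic Taylor remainder `2/9 |z|³` is at most `z²/9`, and `1/2 + 1/9 = 11/18`. -/
lemma exp_le_quadratic {z : ℝ} (hz : |z| ≤ 1 / 2) : Real.exp z ≤ 1 + z + 11 / 18 * z ^ 2 := by
  have h := Real.exp_bound (x := z) (by linarith) (n := 3) (by norm_num)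
  simp only [Finset.sum_range_succ, Finset.sum_range_zero, Nat.factorial, pow_zero, pow_one] at h
  norm_num at h
  have h1 := (abs_le.1 h).2
  have h2 : |z| ^ 3 ≤ 1 / 2 * z ^ 2 := by
    rw [pow_succ, sq_abs, mul_comm]; exact mul_le_mul_of_nonneg_right hz (sq_nonneg z)
  linarith

lemma sub_log_one_add_le_sq {a : ℝ} (ha : |a| ≤ 26 / 100) : a - Real.log (1 + a) ≤ a ^ 2 := by
  obtain ⟨h1, h2⟩ := abs_le.1 ha
  have hz : |a - a ^ 2| ≤ 1 / 2 := abs_le.2 ⟨by nlinarith, by nlinarith⟩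
  have h3 : Real.exp (a - a ^ 2) ≤ 1 + a := by
    refine (exp_le_quadratic hz).trans ?_
    have : 11 / 18 * (1 - a) ^ 2 ≤ 1 := by nlinarith
    nlinarith [mul_le_mul_of_nonneg_left this (sq_nonneg a)]
  have := (Real.le_log_iff_exp_le (by linarith)).2 h3
  linarith

lemma le_log_one_add {u : ℝ} (h0 : 0 ≤ u) (h1 : u ≤ 1 / 18) : u ≤ 37 / 36 * Real.log (1 + u) := by
  have h := Real.le_log_one_add_of_nonneg h0
  have h2 : 2 * u / (u + 2) = u * (2 / (u + 2)) := by ring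
  have h3 : 36 / 37 ≤ 2 / (u + 2) := by rw [div_le_div_iff₀ (by norm_num) (by linarith)]; linarith
  nlinarith [mul_le_mul_of_nonneg_left h3 h0]

lemma div_sqrt_le_sqrt_sub {x d : ℝ} (hx : 0 < x) (hd : 0 ≤ d) :
    d / √(x + d) ≤ 2 * (√(x + d) - √x) := by
  have h1 : 0 < √(x + d) := Real.sqrt_pos.2 (by linarith)
  have h2 := Real.sq_sqrt (show 0 ≤ x + d by linarith)
  have h3 := Real.sq_sqrt hx.le
  rw [div_le_iff₀ h1]
  nlinarith [sq_nonneg (√(x + d) - √x)]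

lemma sqrt_add_le_add_sqrt {x y : ℝ} (hx : 0 ≤ x) (hy : 0 ≤ y) : √(x + y) ≤ √x + √y := by
  rw [Real.sqrt_le_left (by positivity)]
  nlinarith [Real.sq_sqrt hx, Real.sq_sqrt hy, mul_nonneg (Real.sqrt_nonneg x) (Real.sqrt_nonneg y)]

/-- The stability of one step of the regularized leader. -/
lemma stability_le {p q x β l : ℝ} (hq : 0 < q) (hx : 0 < x) (hp : 0 < p)
    (hβ : 0 < β) (hl : |l| ≤ 1) (hqp : q ≤ 100 / 99 * p) :
    l / p * (q - x) - breg β x q ≤ 3 / 4 * (l ^ 2 / p * min 1 (p * β / 2) / β) := by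
  have hl2 : |l| / p * q ≤ 100 / 99 * |l| := by
    rw [div_mul_eq_mul_div, div_le_iff₀ hp]; nlinarith [abs_nonneg l]
  -- The barrier alone. With `w = x/q`, the inequality `log ((1+a)w) ≤ (1+a)w - 1` leaves `4 (a -
  -- log (1+a)) ≤ 4 a²`; the barrier weight 4 makes `|a| ≤ 25/99`.
  have hbound1 : l / p * (q - x) - breg β x q ≤ 3 / 4 * (l ^ 2 / 2) := by
    set a := l / p * q / 4 with ha
    set w := x / q with hw
    have hwpos : 0 < w := div_pos hx hq
    have hxw : x = w * q := by rw [hw]; field_simp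
    have habs : |a| ≤ 25 / 99 * |l| := by
      rw [ha, abs_div, abs_mul, abs_div, abs_of_pos hp, abs_of_pos hq]; norm_num; linarith
    have habs' : |a| ≤ 26 / 100 := by linarith
    have h1 := sub_log_one_add_le_sq habs'
    have h1a : 0 < 1 + a := by linarith [(abs_le.1 habs').1]
    have h2 := Real.log_le_sub_one_of_pos (mul_pos h1a hwpos)
    rw [Real.log_mul h1a.ne' hwpos.ne'] at h2
    have h3 : a ^ 2 ≤ 1 / 4 * (3 / 4 * (l ^ 2 / 2)) := by
      rw [← sq_abs a, ← sq_abs l]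
      nlinarith [abs_nonneg a, abs_nonneg l]
    have h4 := mul_nonneg hβ.le (entropy_breg_nonneg hx hq)
    have h5 : l / p * (q - x) = 4 * a * (1 - w) := by rw [ha, hxw]; ring
    rw [h5, breg, ← hw]
    rw [← hw] at h4
    linarith
  rcases le_total 2 (p * β) with h | h
  · rw [min_eq_left (by linarith), mul_one]
    -- The entropy alone. The supremum over `w` of `y(1-w) - (w log w - w + 1)` is `e^{-y} - 1 + y`,
    -- and `pβ ≥ 2` gives `|y| ≤ 1/2`. Finally `100/99 * 11/18 ≤ 3/4`.
    set y := l / (p * β) with hy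
    set w := x / q with hw
    have hwpos : 0 < w := div_pos hx hq
    have hxw : x = w * q := by rw [hw]; field_simp
    have habs : |y| ≤ 1 / 2 := by
      rw [hy, abs_div, abs_of_pos (mul_pos hp hβ)]
      exact div_le_div₀ (by norm_num) hl (by norm_num) h
    have h1 := exp_le_quadratic (z := -y) (by rwa [abs_neg])
    have h2 := Real.add_one_le_exp (-y - Real.log w)
    rw [Real.exp_sub, Real.exp_log hwpos, le_div_iff₀ hwpos] at h2
    have h3 := log_breg_nonneg hx hq
    have h5 : l / p * (q - x) = β * q * (y * (1 - w)) := by rw [hy, hxw]; field_simp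
    have h6 : l / p * (q - x) - breg β x q ≤ β * q * (11 / 18 * y ^ 2) := by
      rw [h5, breg, ← hw]
      rw [← hw] at h3
      have h7 : β * (x * Real.log w - x + q) = β * q * (w * Real.log w - w + 1) := by rw [hxw]; ring
      rw [h7]
      have h8 : y * (1 - w) - (w * Real.log w - w + 1) ≤ 11 / 18 * y ^ 2 := by nlinarith
      have h9 := mul_le_mul_of_nonneg_left h8 (mul_pos hβ hq).le
      linarith
    refine h6.trans ?_
    have h7 : β * q * (11 / 18 * y ^ 2) = q * (11 / 18 * (l ^ 2 / (p ^ 2 * β))) := by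
      rw [hy]; field_simp
    have h8 : 3 / 4 * (l ^ 2 / p / β) = 3 / 4 * p * (l ^ 2 / (p ^ 2 * β)) := by field_simp
    rw [h7, h8]
    have : 0 ≤ l ^ 2 / (p ^ 2 * β) := by positivity
    nlinarith
  · rw [min_eq_right (by linarith)]
    refine hbound1.trans (le_of_eq ?_)
    field_simp

/-! ### Trajectories of the algorithm -/

/-- The data of one run: the leaders `q`, the inverse learning rates `β`, the arms `A` and the
observed losses. -/
structure Trajectory (k T : ℕ) where
  q : ℕ → Fin k → ℝ
  β : ℕ → ℝ
  A : ℕ → Fin k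
  loss : ℕ → ℝ

namespace Trajectory

variable {k T : ℕ} (τ : Trajectory k T)

/-- The sampling distribution of round `t`. -/
def p (t : ℕ) (i : Fin k) : ℝ := (1 - (k : ℝ) / T) * τ.q t i + (k : ℝ) / T / k

/-- The inverse weighted estimator of round `t`. -/
def est (t : ℕ) (i : Fin k) : ℝ := if τ.A t = i then τ.loss t / τ.p t i else 0

/-- The sum of the estimators before round `t`. -/
def cum (t : ℕ) (i : Fin k) : ℝ := ∑ s ∈ Finset.range t, τ.est s i

/-- The stability term of round `t`. -/
def nu (t : ℕ) : ℝ := τ.loss t ^ 2 / τ.p t (τ.A t) * min 1 (τ.p t (τ.A t) * τ.β t / 2)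

/-- The penalty term of round `t`. -/
def pen (t : ℕ) : ℝ := penalty T (τ.p t)

/-- The sum of the products of stability and penalty before round `t`. -/
def prodSum (t : ℕ) : ℝ := ∑ s ∈ Finset.range t, τ.nu s * τ.pen (s + 1)

/-- The trajectory follows the algorithm, with losses in `[-1, 1]`. -/
structure IsRun : Prop where
  abs_loss_le_one : ∀ t, |τ.loss t| ≤ 1
  mem_posSimplex : ∀ t, τ.q t ∈ posSimplex k
  isMinOn : ∀ t, IsMinOn (objective (τ.cum t) (τ.β t)) (posSimplex k) (τ.q t)
  beta_zero : τ.β 0 = 15 * k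
  beta_succ : ∀ t, τ.β (t + 1) = τ.β t + c1 k T * τ.nu t / √(81 * c1 k T ^ 2 + τ.prodSum (t + 1))

lemma mul_q_le_p (t : ℕ) (i : Fin k) : (1 - (k : ℝ) / T) * τ.q t i ≤ τ.p t i := by
  have : (0 : ℝ) ≤ (k : ℝ) / T / k := by positivity
  rw [Trajectory.p]; linarith

end Trajectory

lemma c1_sq {k T : ℕ} : c1 k T ^ 2 = 2 * Real.log (1 + (T : ℝ) / (15 * k)) := by
  rw [c1, Real.sq_sqrt]
  have : 0 ≤ Real.log (1 + (T : ℝ) / (15 * k)) :=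
    Real.log_nonneg (by have : (0 : ℝ) ≤ T / (15 * k) := by positivity
                        linarith)
  linarith

lemma c1_pos {k T : ℕ} (hk : 1 ≤ k) (hT : 2 * k ≤ T) : 0 < c1 k T := by
  have hk' : (0 : ℝ) < k := by exact_mod_cast hk
  have hT' : (0 : ℝ) < T := by exact_mod_cast (by omega : 0 < T)
  refine Real.sqrt_pos.2 ?_
  have : (0 : ℝ) < T / (15 * k) := by positivity
  have := Real.log_pos (show 1 < 1 + (T : ℝ) / (15 * k) by linarith)
  linarith

lemma c1_sq_le {k T : ℕ} (hk : 1 ≤ k) (hT : 2 * k ≤ T) : c1 k T ^ 2 ≤ 2 * Real.log T := by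
  have hk' : (1 : ℝ) ≤ k := by exact_mod_cast hk
  have hT' : (2 : ℝ) ≤ T := by exact_mod_cast (by omega : 2 ≤ T)
  rw [c1_sq]
  have h1 : (T : ℝ) / (15 * k) ≤ T / 2 :=
    div_le_div_of_nonneg_left (by linarith) (by norm_num) (by linarith)
  have := Real.log_le_log (by positivity) (show 1 + (T : ℝ) / (15 * k) ≤ T by linarith)
  linarith

/-- The mixture of a probability vector with uniform exploration. -/
lemma mix_bounds {k T : ℕ} {q : Fin k → ℝ} (hk : 1 ≤ k) (hT : 2 * k ≤ T) (hq : q ∈ posSimplex k) :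
    (∀ i, (1 - (k : ℝ) / T) * q i + 1 / T = (1 - (k : ℝ) / T) * q i + (k : ℝ) / T / k) ∧
    (∀ i, 1 / (T : ℝ) ≤ (1 - (k : ℝ) / T) * q i + (k : ℝ) / T / k) ∧
    ∑ i, ((1 - (k : ℝ) / T) * q i + (k : ℝ) / T / k) = 1 ∧ 0 ≤ (k : ℝ) / T ∧ (k : ℝ) / T ≤ 1 / 2 := by
  have hk' : (0 : ℝ) < k := by exact_mod_cast hk
  have hT' : 2 * (k : ℝ) ≤ T := by exact_mod_cast hT
  have hTpos : (0 : ℝ) < T := by linarith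
  have h0 : (k : ℝ) / T / k = 1 / T := by field_simp
  have h1 : (k : ℝ) / T ≤ 1 / 2 := by rw [div_le_div_iff₀ hTpos (by norm_num)]; linarith
  refine ⟨fun i => by rw [h0], fun i => ?_, ?_, by positivity, h1⟩
  · rw [h0]
    have := mul_nonneg (show 0 ≤ 1 - (k : ℝ) / T by linarith) (hq.1 i).le
    linarith
  · rw [Finset.sum_add_distrib, ← Finset.mul_sum, hq.2]
    simp
    field_simp
    ring

/-! ### Pathwise regret of a single run. -/

namespace Trajectory.IsRun

variable {k T : ℕ} {τ : Trajectory k T}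

lemma inv_le_p (hτ : τ.IsRun) (hk : 1 ≤ k) (hT : 2 * k ≤ T)
    (t : ℕ) (i : Fin k) : 1 / (T : ℝ) ≤ τ.p t i :=
  (mix_bounds hk hT (hτ.mem_posSimplex t)).2.1 i

lemma p_pos (hτ : τ.IsRun) (hk : 1 ≤ k) (hT : 2 * k ≤ T) (t : ℕ) (i : Fin k) : 0 < τ.p t i := by
  have : (0 : ℝ) < T := by exact_mod_cast (by omega : 0 < T)
  exact lt_of_lt_of_le (by positivity) (hτ.inv_le_p hk hT t i)

lemma sum_p (hτ : τ.IsRun) (hk : 1 ≤ k) (hT : 2 * k ≤ T)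
    (t : ℕ) : ∑ i, τ.p t i = 1 := (mix_bounds hk hT (hτ.mem_posSimplex t)).2.2.1

lemma entropy_p_nonneg (hτ : τ.IsRun) (hk : 1 ≤ k) (hT : 2 * k ≤ T) (t : ℕ) : 0 ≤ entropy (τ.p t) :=
  entropy_nonneg (fun i => (hτ.p_pos hk hT t i).le) (hτ.sum_p hk hT t)

lemma entropy_le_pen (hτ : τ.IsRun) (hk : 1 ≤ k) (hT : 2 * k ≤ T)
    (t : ℕ) : entropy (τ.p t) ≤ τ.pen t := by
  obtain ⟨-, -, -, h1, h2⟩ := mix_bounds hk hT (hτ.mem_posSimplex t)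
  rw [Trajectory.pen, penalty]
  have : 1 ≤ 1 / (1 - (k : ℝ) / T) := by rw [le_div_iff₀ (by linarith)]; linarith
  nlinarith [hτ.entropy_p_nonneg hk hT t]

lemma pen_nonneg (hτ : τ.IsRun) (hk : 1 ≤ k) (hT : 2 * k ≤ T) (t : ℕ) : 0 ≤ τ.pen t :=
  (hτ.entropy_p_nonneg hk hT t).trans (hτ.entropy_le_pen hk hT t)

lemma entropy_q_le_pen (hτ : τ.IsRun) (hk : 1 ≤ k) (hT : 2 * k ≤ T)
    (t : ℕ) : entropy (τ.q t) ≤ τ.pen t := by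
  obtain ⟨-, -, -, h1, h2⟩ := mix_bounds hk hT (hτ.mem_posSimplex t)
  have := mul_entropy_le_entropy_mix hk (fun i => ((hτ.mem_posSimplex t).1 i).le) h1 (by linarith)
  rw [Trajectory.pen, penalty, div_mul_eq_mul_div, one_mul, le_div_iff₀ (by linarith), mul_comm]
  exact this

/-- One bound per branch of the minimum: `β/2` keeps the relative increments of `β` small, and
`ℓ²/p` has conditional mean `‖ℓ‖²`. -/
lemma nu_bounds (hτ : τ.IsRun) (hk : 1 ≤ k) (hT : 2 * k ≤ T) (t : ℕ) (hβ : 0 < τ.β t) :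
    0 ≤ τ.nu t ∧ τ.nu t ≤ τ.β t / 2 ∧ τ.nu t ≤ τ.loss t ^ 2 / τ.p t (τ.A t) := by
  have hp := hτ.p_pos hk hT t (τ.A t)
  have hl : τ.loss t ^ 2 ≤ 1 := by rw [sq_le_one_iff_abs_le_one]; exact hτ.abs_loss_le_one t
  have h1 : 0 ≤ τ.loss t ^ 2 / τ.p t (τ.A t) := by positivity
  refine ⟨by unfold Trajectory.nu; positivity, ?_, ?_⟩
  · calc τ.nu t ≤ τ.loss t ^ 2 / τ.p t (τ.A t) * (τ.p t (τ.A t) * τ.β t / 2) :=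
        mul_le_mul_of_nonneg_left (min_le_right _ _) h1
      _ = τ.loss t ^ 2 * (τ.β t / 2) := by field_simp
      _ ≤ τ.β t / 2 := by nlinarith
  · calc τ.nu t ≤ τ.loss t ^ 2 / τ.p t (τ.A t) * 1 :=
        mul_le_mul_of_nonneg_left (min_le_left _ _) h1
      _ = _ := mul_one _

lemma beta_ge_and_prodSum_nonneg (hτ : τ.IsRun) (hk : 1 ≤ k) (hT : 2 * k ≤ T)
    (t : ℕ) : 15 * (k : ℝ) ≤ τ.β t ∧ 0 ≤ τ.prodSum t := by
  have hk' : (0 : ℝ) < k := by exact_mod_cast hk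
  induction t with
  | zero => exact ⟨hτ.beta_zero.ge, by simp [Trajectory.prodSum]⟩
  | succ t ih =>
    have hν := (hτ.nu_bounds hk hT t (by linarith [ih.1])).1
    refine ⟨?_, ?_⟩
    · rw [hτ.beta_succ]
      have := c1_pos hk hT
      have : 0 ≤ c1 k T * τ.nu t / √(81 * c1 k T ^ 2 + τ.prodSum (t + 1)) := by positivity
      linarith [ih.1]
    · rw [Trajectory.prodSum, Finset.sum_range_succ]
      exact add_nonneg ih.2 (mul_nonneg hν (hτ.pen_nonneg hk hT _))

lemma beta_ge (hτ : τ.IsRun) (hk : 1 ≤ k) (hT : 2 * k ≤ T)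
    (t : ℕ) : 15 * (k : ℝ) ≤ τ.β t := (hτ.beta_ge_and_prodSum_nonneg hk hT t).1

lemma prodSum_nonneg (hτ : τ.IsRun) (hk : 1 ≤ k) (hT : 2 * k ≤ T)
    (t : ℕ) : 0 ≤ τ.prodSum t := (hτ.beta_ge_and_prodSum_nonneg hk hT t).2

lemma beta_pos (hτ : τ.IsRun) (hk : 1 ≤ k) (hT : 2 * k ≤ T) (t : ℕ) : 0 < τ.β t := by
  have hk' : (0 : ℝ) < k := by exact_mod_cast hk
  linarith [hτ.beta_ge hk hT t]

lemma nu_nonneg (hτ : τ.IsRun) (hk : 1 ≤ k) (hT : 2 * k ≤ T)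
    (t : ℕ) : 0 ≤ τ.nu t := (hτ.nu_bounds hk hT t (hτ.beta_pos hk hT t)).1

lemma nu_le_half_beta (hτ : τ.IsRun) (hk : 1 ≤ k) (hT : 2 * k ≤ T) (t : ℕ) : τ.nu t ≤ τ.β t / 2 :=
  (hτ.nu_bounds hk hT t (hτ.beta_pos hk hT t)).2.1

lemma nu_le_sq_div (hτ : τ.IsRun) (hk : 1 ≤ k) (hT : 2 * k ≤ T)
    (t : ℕ) : τ.nu t ≤ τ.loss t ^ 2 / τ.p t (τ.A t) :=
  (hτ.nu_bounds hk hT t (hτ.beta_pos hk hT t)).2.2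

lemma nu_le (hτ : τ.IsRun) (hk : 1 ≤ k) (hT : 2 * k ≤ T) (t : ℕ) : τ.nu t ≤ T := by
  have hT' : (0 : ℝ) < T := by exact_mod_cast (by omega : 0 < T)
  have hl : τ.loss t ^ 2 ≤ 1 := by rw [sq_le_one_iff_abs_le_one]; exact hτ.abs_loss_le_one t
  have h := hτ.inv_le_p hk hT t (τ.A t)
  refine (hτ.nu_le_sq_div hk hT t).trans ?_
  rw [div_le_iff₀ (hτ.p_pos hk hT t _)]
  have := mul_le_mul_of_nonneg_left h hT'.le
  rw [mul_one_div_cancel hT'.ne'] at this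
  linarith

lemma prodSum_mono (hτ : τ.IsRun) (hk : 1 ≤ k) (hT : 2 * k ≤ T) : Monotone τ.prodSum := by
  refine monotone_nat_of_le_succ fun t => ?_
  rw [Trajectory.prodSum, Trajectory.prodSum, Finset.sum_range_succ]
  have := mul_nonneg (hτ.nu_nonneg hk hT t) (hτ.pen_nonneg hk hT (t + 1))
  linarith

lemma sqrt_pos (hτ : τ.IsRun) (hk : 1 ≤ k) (hT : 2 * k ≤ T)
    (t : ℕ) : 0 < √(81 * c1 k T ^ 2 + τ.prodSum t) := by
  have := c1_pos hk hT
  have := hτ.prodSum_nonneg hk hT t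
  exact Real.sqrt_pos.2 (by positivity)

lemma le_sqrt (hτ : τ.IsRun) (hk : 1 ≤ k) (hT : 2 * k ≤ T)
    (t : ℕ) : 9 * c1 k T ≤ √(81 * c1 k T ^ 2 + τ.prodSum t) := by
  have := c1_pos hk hT
  have := hτ.prodSum_nonneg hk hT t
  exact Real.le_sqrt_of_sq_le (by nlinarith)

lemma beta_le_succ (hτ : τ.IsRun) (hk : 1 ≤ k) (hT : 2 * k ≤ T) (t : ℕ) : τ.β t ≤ τ.β (t + 1) := by
  rw [hτ.beta_succ]
  have := c1_pos hk hT
  have := hτ.nu_nonneg hk hT t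
  have : 0 ≤ c1 k T * τ.nu t / √(81 * c1 k T ^ 2 + τ.prodSum (t + 1)) := by positivity
  linarith

/-- The constant `81 = 9²` under the root gives a factor 1/9, and `ν ≤ β/2` another 1/2. -/
lemma beta_succ_sub_le (hτ : τ.IsRun) (hk : 1 ≤ k) (hT : 2 * k ≤ T)
    (t : ℕ) : τ.β (t + 1) - τ.β t ≤ τ.β t / 18 := by
  rw [hτ.beta_succ, add_sub_cancel_left, div_le_iff₀ (hτ.sqrt_pos hk hT _)]
  have h1 := c1_pos hk hT
  have h2 := hτ.nu_le_half_beta hk hT t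
  have h3 := hτ.le_sqrt hk hT (t + 1)
  have h4 := mul_le_mul_of_nonneg_left h3 (hτ.beta_pos hk hT t).le
  nlinarith

/-- Only the chosen arm has a nonzero estimate; every other coordinate contributes minus a
nonnegative divergence. -/
lemma stability_term_le (hτ : τ.IsRun) (hk : 1 ≤ k) (hT : 2 * k ≤ T)
    (hγ : (k : ℝ) / T ≤ 1 / 100) (t : ℕ) :
    ∑ i, (τ.est t i * (τ.q t i - τ.q (t + 1) i) - breg (τ.β t) (τ.q (t + 1) i) (τ.q t i)) ≤
      3 / 4 * (τ.nu t / τ.β t) := by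
  have hq := (hτ.mem_posSimplex t).1
  have hq' := (hτ.mem_posSimplex (t + 1)).1
  have hβ := hτ.beta_pos hk hT t
  calc _ ≤ ∑ i, if τ.A t = i then 3 / 4 * (τ.nu t / τ.β t) else 0 := by
        refine Finset.sum_le_sum fun i _ => ?_
        rw [Trajectory.est]
        split_ifs with h
        · subst h
          have h1 := τ.mul_q_le_p t (τ.A t)
          refine stability_le (hq _) (hq' _) (hτ.p_pos hk hT t _) hβ (hτ.abs_loss_le_one t) ?_
          nlinarith [hq (τ.A t)]
        · have := breg_nonneg hβ.le (hq' i) (hq i)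
          linarith
    _ = _ := by simp

/-- The potential is the optimal value of the objective. Changing `β` at the fixed point `q (n+1)`
costs the increment times the entropy of the new leader, hence the penalty with index `t + 1`. -/
lemma ftrl_telescope (hτ : τ.IsRun) (hk : 1 ≤ k) (hT : 2 * k ≤ T)
    (hγ : (k : ℝ) / T ≤ 1 / 100) (n : ℕ) :
    ∑ t ∈ Finset.range n, ∑ i, τ.est t i * τ.q t i + objective (τ.cum 0) (τ.β 0) (τ.q 0) ≤
      ∑ t ∈ Finset.range n, (3 / 4 * (τ.nu t / τ.β t) + (τ.β (t + 1) - τ.β t) * τ.pen (t + 1)) +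
        objective (τ.cum n) (τ.β n) (τ.q n) := by
  induction n with
  | zero => simp
  | succ n ih =>
    rw [Finset.sum_range_succ, Finset.sum_range_succ]
    have h1 := hτ.stability_term_le hk hT hγ n
    have h2 := objective_sub_eq (hτ.mem_posSimplex n) (hτ.isMinOn n) (hτ.mem_posSimplex (n + 1))
    have h3 : objective (τ.cum (n + 1)) (τ.β (n + 1)) (τ.q (n + 1)) =
        objective (τ.cum n) (τ.β n) (τ.q (n + 1)) + ∑ i, τ.est n i * τ.q (n + 1) i -
          (τ.β (n + 1) - τ.β n) * entropy (τ.q (n + 1)) := by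
      simp only [objective, regularizer, entropy, Real.negMulLog, Trajectory.cum,
        Finset.sum_range_succ, add_mul, Finset.sum_add_distrib, neg_mul, Finset.sum_neg_distrib]
      ring
    have h4 := mul_le_mul_of_nonneg_left (hτ.entropy_q_le_pen hk hT (n + 1))
      (sub_nonneg.2 (hτ.beta_le_succ hk hT n))
    rw [Finset.sum_sub_distrib] at h1
    simp only [mul_sub, Finset.sum_sub_distrib] at h1
    linarith

/-- Here `19 = 4 + 15`: the barrier at `u`, whose entries are at least `1/T`, and the entropy of the
first leader with weight `15 k`. -/
lemma ftrl_bound (hτ : τ.IsRun) (hk : 1 ≤ k) (hT : 2 * k ≤ T)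
    (hγ : (k : ℝ) / T ≤ 1 / 100) {u : Fin k → ℝ} (hu : u ∈ posSimplex k)
    (huT : ∀ i, 1 / (T : ℝ) ≤ u i) (n : ℕ) :
    ∑ t ∈ Finset.range n, ∑ i, τ.est t i * (τ.q t i - u i) ≤
      ∑ t ∈ Finset.range n, (3 / 4 * (τ.nu t / τ.β t) + (τ.β (t + 1) - τ.β t) * τ.pen (t + 1)) +
        19 * (k * Real.log T) := by
  have hT' : (0 : ℝ) < T := by exact_mod_cast (by omega : 0 < T)
  have hk' : (0 : ℝ) < k := by exact_mod_cast hk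
  have h1 := hτ.ftrl_telescope hk hT hγ n
  have h2 : objective (τ.cum n) (τ.β n) (τ.q n) ≤ objective (τ.cum n) (τ.β n) u := hτ.isMinOn n hu
  have h3 : regularizer (τ.β n) u ≤ 4 * (k * Real.log T) := by
    have h4 : ∑ i, u i * Real.log (u i) ≤ 0 := Finset.sum_nonpos fun i _ =>
      mul_nonpos_of_nonneg_of_nonpos (hu.1 i).le (Real.log_nonpos (hu.1 i).le
        (le_one_of_sum_eq_one (fun j => (hu.1 j).le) hu.2 i))
    have h5 : ∑ i, Real.log (1 / u i) ≤ ∑ _i : Fin k, Real.log T := Finset.sum_le_sum fun i _ => by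
      refine Real.log_le_log (one_div_pos.2 (hu.1 i)) ?_
      rw [div_le_comm₀ (hu.1 i) hT']; exact huT i
    rw [Finset.sum_const, Finset.card_univ, Fintype.card_fin, nsmul_eq_mul] at h5
    rw [regularizer]
    nlinarith [hτ.beta_pos hk hT n]
  have h6 : - objective (τ.cum 0) (τ.β 0) (τ.q 0) ≤ 15 * (k * Real.log T) := by
    have hq := hτ.mem_posSimplex 0
    have h7 : 0 ≤ ∑ i, Real.log (1 / τ.q 0 i) := Finset.sum_nonneg fun i _ => Real.log_nonneg (by
      rw [le_div_iff₀ (hq.1 i)]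
      linarith [le_one_of_sum_eq_one (fun j => (hq.1 j).le) hq.2 i])
    have h8 := entropy_le_log_card hk (fun i => (hq.1 i).le) hq.2
    have h9 : Real.log k ≤ Real.log T := Real.log_le_log hk' (by exact_mod_cast (by omega : k ≤ T))
    have h10 : ∑ i, τ.q 0 i * Real.log (τ.q 0 i) = - entropy (τ.q 0) := by
      simp [entropy, Real.negMulLog]
    simp only [objective, regularizer, Trajectory.cum, Finset.range_zero, Finset.sum_empty, zero_mul,
      Finset.sum_const_zero, zero_add, h10, hτ.beta_zero]
    nlinarith
  have h11 : ∑ i, τ.cum n i * u i = ∑ t ∈ Finset.range n, ∑ i, τ.est t i * u i := by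
    simp only [Trajectory.cum, Finset.sum_mul]
    rw [Finset.sum_comm]
  simp only [mul_sub, Finset.sum_sub_distrib]
  have h12 : objective (τ.cum n) (τ.β n) u =
      ∑ t ∈ Finset.range n, ∑ i, τ.est t i * u i + regularizer (τ.β n) u := by rw [objective, h11]
  linarith

/-- Each summand is `c₁ d / √(x + d)` with `d = ν h` the increment of `prodSum`, so the sum
telescopes. -/
lemma sum_penalty_le (hτ : τ.IsRun) (hk : 1 ≤ k) (hT : 2 * k ≤ T) (n : ℕ) :
    ∑ t ∈ Finset.range n, (τ.β (t + 1) - τ.β t) * τ.pen (t + 1) ≤ 2 * c1 k T * √(τ.prodSum n) := by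
  have hc := c1_pos hk hT
  have key : ∑ t ∈ Finset.range n, (τ.β (t + 1) - τ.β t) * τ.pen (t + 1) ≤
      2 * c1 k T * (√(81 * c1 k T ^ 2 + τ.prodSum n) - √(81 * c1 k T ^ 2)) := by
    induction n with
    | zero => simp [Trajectory.prodSum]
    | succ n ih =>
      rw [Finset.sum_range_succ]
      have h1 := div_sqrt_le_sqrt_sub (x := 81 * c1 k T ^ 2 + τ.prodSum n)
        (d := τ.nu n * τ.pen (n + 1)) (by have := hτ.prodSum_nonneg hk hT n; positivity)
        (mul_nonneg (hτ.nu_nonneg hk hT n) (hτ.pen_nonneg hk hT _))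
      have h2 : 81 * c1 k T ^ 2 + τ.prodSum n + τ.nu n * τ.pen (n + 1) =
          81 * c1 k T ^ 2 + τ.prodSum (n + 1) := by
        rw [Trajectory.prodSum, Trajectory.prodSum, Finset.sum_range_succ]; ring
      rw [h2] at h1
      have h3 : (τ.β (n + 1) - τ.β n) * τ.pen (n + 1) =
          c1 k T * (τ.nu n * τ.pen (n + 1) / √(81 * c1 k T ^ 2 + τ.prodSum (n + 1))) := by
        rw [hτ.beta_succ]; ring
      rw [h3]
      nlinarith [mul_le_mul_of_nonneg_left h1 hc.le]
  refine key.trans (mul_le_mul_of_nonneg_left ?_ (by positivity))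
  have := sqrt_add_le_add_sqrt (x := 81 * c1 k T ^ 2) (by positivity) (hτ.prodSum_nonneg hk hT n)
  linarith

/-- By the rule for `β`, `ν / β` is `√(...) / c₁` times the relative increment `r ≤ 1/18` of `β`.
Then `r ≤ 37/36 log (1 + r)`, and the logarithms telescope. The horizon `m` is kept apart from `n`
so that the largest root stays fixed in the induction. -/
lemma sum_stability_le (hτ : τ.IsRun) (hk : 1 ≤ k) (hT : 2 * k ≤ T) {n m : ℕ} (hn : n ≤ m) :
    ∑ t ∈ Finset.range n, τ.nu t / τ.β t ≤ 37 / 36 *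
      (√(81 * c1 k T ^ 2 + τ.prodSum m) / c1 k T) * (Real.log (τ.β n) - Real.log (15 * k)) := by
  have hc := c1_pos hk hT
  induction n with
  | zero => simp [hτ.beta_zero]
  | succ n ih =>
    rw [Finset.sum_range_succ]
    have ih := ih (by omega)
    set W := √(81 * c1 k T ^ 2 + τ.prodSum m) with hW
    have hβ := hτ.beta_pos hk hT n
    have hβ' := hτ.beta_pos hk hT (n + 1)
    have hs := hτ.sqrt_pos hk hT (n + 1)
    set r := (τ.β (n + 1) - τ.β n) / τ.β n with hr
    have hr0 : 0 ≤ r := div_nonneg (sub_nonneg.2 (hτ.beta_le_succ hk hT n)) hβ.le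
    have hr1 : r ≤ 1 / 18 := by
      rw [hr, div_le_iff₀ hβ]; linarith [hτ.beta_succ_sub_le hk hT n]
    have h1 := le_log_one_add hr0 hr1
    have h2 : 1 + r = τ.β (n + 1) / τ.β n := by rw [hr]; field_simp; ring
    rw [h2, Real.log_div hβ'.ne' hβ.ne'] at h1
    have h3 : τ.nu n / τ.β n = √(81 * c1 k T ^ 2 + τ.prodSum (n + 1)) / c1 k T * r := by
      rw [hr, hτ.beta_succ]; field_simp; ring
    have h4 : √(81 * c1 k T ^ 2 + τ.prodSum (n + 1)) ≤ W :=
      Real.sqrt_le_sqrt (by linarith [hτ.prodSum_mono hk hT hn])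
    have h5 : τ.nu n / τ.β n ≤ W / c1 k T * r := by
      rw [h3]; gcongr
    have h6 := mul_le_mul_of_nonneg_left h1 (show 0 ≤ W / c1 k T by positivity)
    nlinarith

end Trajectory.IsRun

/-- The coordinates of the leader grow at most by a constant factor in one round if the learning
rate changes slowly. -/
lemma next_leader_le {k T : ℕ} {L L' q q' : Fin k → ℝ} {β d y : ℝ} {A : Fin k}
    (hq : q ∈ posSimplex k) (hmin : IsMinOn (objective L β) (posSimplex k) q)
    (hq' : q' ∈ posSimplex k) (hmin' : IsMinOn (objective L' (β + d)) (posSimplex k) q')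
    (hL : ∀ i, L' i = L i + if A = i then y else 0) (hy : |y| ≤ 2 / q A) (hβ : 15 * (k : ℝ) ≤ β)
    (hd : 0 ≤ d) (hdT : d * Real.log T ≤ β / 2) (hT : 1 ≤ T) (i : Fin k) :
    q' i ≤ max (4 * q i) (1 / T) := by
  have hk' : (0 : ℝ) < k := by exact_mod_cast i.pos
  have hT' : (0 : ℝ) < T := by exact_mod_cast hT
  have hβ0 : 0 < β := by linarith
  have hlog2 := Real.log_two_gt_d9
  by_contra! hcon
  obtain ⟨hi4, hiT⟩ := max_lt_iff.1 hcon
  -- Difference of the two stationarity conditions. Both gradients are constant in `j`; the summand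
  -- `d` from the derivative of the entropy is absorbed in `δ`.
  obtain ⟨δ, hδ⟩ : ∃ δ : ℝ, ∀ j, (if A = j then y else 0) + β * (Real.log (q' j) - Real.log (q j)) +
      d * Real.log (q' j) + (4 / q j - 4 / q' j) = δ := by
    refine ⟨grad L' (β + d) q' i - grad L β q i - d, fun j => ?_⟩
    rw [grad_eq_grad hq hmin i j, grad_eq_grad hq' hmin' i j, grad, grad, hL]
    ring
  have hlog_nonpos : ∀ j, d * Real.log (q' j) ≤ 0 := fun j =>
    mul_nonpos_of_nonneg_of_nonpos hd (Real.log_nonpos (hq'.1 j).le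
      (le_one_of_sum_eq_one (fun j => (hq'.1 j).le) hq'.2 j))
  have hdec : ∀ j, q' j ≤ q j → β * (Real.log (q' j) - Real.log (q j)) ≤ 0 ∧
      4 / q j - 4 / q' j ≤ 0 := fun j hj => by
    have h1 := Real.log_le_log (hq'.1 j) hj
    have h2 := div_le_div_of_nonneg_left (by norm_num : (0 : ℝ) ≤ 4) (hq'.1 j) hj
    exact ⟨by nlinarith, by linarith⟩
  have hi1 : β * (2 * Real.log 2) ≤ β * (Real.log (q' i) - Real.log (q i)) := by
    refine mul_le_mul_of_nonneg_left ?_ hβ0.le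
    have h1 := Real.log_le_log (mul_pos (by norm_num : (0 : ℝ) < 4) (hq.1 i)) hi4.le
    rw [Real.log_mul (by norm_num) (hq.1 i).ne', show (4 : ℝ) = 2 ^ 2 by norm_num, Real.log_pow] at h1
    push_cast at h1
    linarith
  have hi2 : - (β / 2) ≤ d * Real.log (q' i) := by
    have h1 := Real.log_le_log (by positivity) hiT.le
    rw [one_div, Real.log_inv] at h1
    nlinarith
  have hi3 : 3 / q i ≤ 4 / q i - 4 / q' i := by
    have h1 : 4 / q' i ≤ 4 / (4 * q i) :=
      div_le_div_of_nonneg_left (by norm_num) (mul_pos (by norm_num) (hq.1 i)) hi4.le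
    have h2 : 4 / (4 * q i) = 1 / q i := by have := (hq.1 i).ne'; field_simp
    have h3 : 4 / q i = 3 / q i + 1 / q i := by ring
    linarith
  have hqi : 0 < 1 / q i := one_div_pos.2 (hq.1 i)
  have e3 : 3 / q i = 3 * (1 / q i) := by ring
  have hδi := hδ i
  have hδ0 : 0 < δ := by
    have h1 : - (2 / q i) ≤ if A = i then y else 0 := by
      split_ifs with h
      · subst h; exact (abs_le.1 hy).1
      · have : 2 / q i = 2 * (1 / q i) := by ring
        linarith
    have h2 : 2 / q i = 2 * (1 / q i) := by ring
    nlinarith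
  -- If `q'` is large at `i`, some other coordinate loses mass. There every term except `y` is
  -- nonpositive while `δ > 0`, so only the played arm `A` can lose mass, and `δ ≤ y`.
  obtain ⟨j, hj⟩ : ∃ j, q' j < q j := by
    by_contra! h
    have : ∑ j, q j < ∑ j, q' j :=
      Finset.sum_lt_sum (fun j _ => h j) ⟨i, Finset.mem_univ i, by linarith [hq.1 i]⟩
    rw [hq.2, hq'.2] at this
    exact lt_irrefl _ this
  have honly : ∀ j, q' j ≤ q j → A = j ∧ δ ≤ y := fun j hj => by
    have h1 := hδ j
    have h2 := hdec j hj
    have h3 := hlog_nonpos j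
    by_cases h : A = j
    · rw [if_pos h] at h1; exact ⟨h, by linarith⟩
    · rw [if_neg h] at h1; linarith
  obtain ⟨rfl, hδy⟩ := honly j hj.le
  have hiA : A ≠ i := by rintro rfl; linarith [hq.1 A]
  rw [if_neg hiA] at hδi
  have hδlow : β * (2 * Real.log 2 - 1 / 2) + 3 / q i ≤ δ := by linarith
  have hδup : δ ≤ 2 / q A := hδy.trans ((le_abs_self y).trans hy)
  -- The largest coordinate contradicts the lower bound on `δ`. If it is `A`, then `q A ≥ 1/k` and
  -- `δ ≤ 2k`, too small since `β ≥ 15k`. Otherwise it gains at most the mass lost by `A`, so it at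
  -- most doubles, and `log 2 < 2 log 2 - 1/2`.
  obtain ⟨m, -, hm⟩ := Finset.exists_max_image Finset.univ q ⟨A, Finset.mem_univ A⟩
  by_cases hAm : m = A
  · subst hAm
    have h1 : 1 ≤ k * q m := by
      have := Finset.sum_le_card_nsmul Finset.univ q (q m) hm
      rwa [hq.2, Finset.card_univ, Fintype.card_fin, nsmul_eq_mul] at this
    have h2 : 2 / q m ≤ 2 * k := by rw [div_le_iff₀ (hq.1 m)]; linarith
    nlinarith
  · have hqm : q' m ≤ 2 * q m := by
      have h1 : q' m - q m ≤ q A := by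
        have h2 : ∑ j ∈ {m, A}, (q' j - q j) ≤ ∑ j, (q' j - q j) :=
          Finset.sum_le_sum_of_subset_of_nonneg (Finset.subset_univ _) fun j _ hjn => by
            by_contra! h
            exact hjn (by simp [(honly j (by linarith)).1])
        rw [Finset.sum_pair hAm, Finset.sum_sub_distrib, hq.2, hq'.2] at h2
        linarith [hq'.1 A]
      linarith [hm A (Finset.mem_univ A)]
    have h1 := hδ m
    rw [if_neg (Ne.symm hAm)] at h1
    have h2 : Real.log (q' m) - Real.log (q m) ≤ Real.log 2 := by
      have := Real.log_le_log (hq'.1 m) hqm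
      rw [Real.log_mul (by norm_num) (hq.1 m).ne'] at this
      linarith
    have h3 : 4 / q m - 4 / q' m ≤ 2 / q m := by
      have h4 : 4 / (2 * q m) ≤ 4 / q' m := div_le_div_of_nonneg_left (by norm_num) (hq'.1 m) hqm
      have h5 : 4 / (2 * q m) = 2 / q m := by have := (hq.1 m).ne'; field_simp; norm_num
      have h6 : 4 / q m = 2 / q m + 2 / q m := by ring
      linarith
    have h4 : 2 / q m ≤ 2 / q i :=
      div_le_div_of_nonneg_left (by norm_num) (hq.1 i) (hm i (Finset.mem_univ i))
    have h5 : 2 / q i = 2 * (1 / q i) := by ring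
    have h6 := hlog_nonpos m
    nlinarith [mul_le_mul_of_nonneg_left h2 hβ0.le]

/-! ### The sum of products of stability and penalty, and the growth of `β`. -/

namespace Trajectory.IsRun

variable {k T : ℕ} {τ : Trajectory k T}

/-- The penalty of round `t` does not depend on the arm played in round `t`, so it can be taken out
of a conditional expectation. The exploration mass `1/T` in `p` absorbs the alternative `1/T` of
`next_leader_le`. -/
lemma pen_succ_le (hτ : τ.IsRun) (hk : 1 ≤ k) (hT : 2 * k ≤ T) (t : ℕ)
    (h : (τ.β (t + 1) - τ.β t) * Real.log T ≤ τ.β t / 2) : τ.pen (t + 1) ≤ 4 * τ.pen t := by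
  obtain ⟨hmix, -, -, hγ0, hγ⟩ := mix_bounds hk hT (hτ.mem_posSimplex t)
  obtain ⟨hmix', -, -, -, -⟩ := mix_bounds hk hT (hτ.mem_posSimplex (t + 1))
  have hT' : (0 : ℝ) < T := by exact_mod_cast (by omega : 0 < T)
  have hq := hτ.mem_posSimplex t
  have hmin' := hτ.isMinOn (t + 1)
  rw [show τ.β (t + 1) = τ.β t + (τ.β (t + 1) - τ.β t) by ring] at hmin'
  have hp := hτ.p_pos hk hT t (τ.A t)
  have key : ∀ i, τ.p (t + 1) i ≤ 4 * τ.p t i := fun i => by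
    have h1 := next_leader_le (T := T) (A := τ.A t) (y := τ.loss t / τ.p t (τ.A t)) hq (hτ.isMinOn t)
      (hτ.mem_posSimplex (t + 1)) hmin' (fun j => by
        rw [Trajectory.cum, Finset.sum_range_succ, Trajectory.est]
        split_ifs with hj
        · rw [← hj]; rfl
        · rfl) (by
        rw [abs_div, abs_of_pos hp, div_le_div_iff₀ hp (hq.1 _)]
        have h2 := τ.mul_q_le_p t (τ.A t)
        have h3 := hτ.abs_loss_le_one t
        have h4 := hq.1 (τ.A t)
        nlinarith) (hτ.beta_ge hk hT t) (sub_nonneg.2 (hτ.beta_le_succ hk hT t)) h (by omega) i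
    have h2 : τ.q (t + 1) i ≤ 4 * τ.q t i + 1 / T :=
      h1.trans (max_le_add_of_nonneg (by linarith [hq.1 i]) (by positivity))
    rw [Trajectory.p, Trajectory.p, ← hmix, ← hmix']
    have h3 : 0 < 1 / (T : ℝ) := by positivity
    nlinarith
  have h1 := entropy_le_mul (fun i => (hτ.p_pos hk hT (t + 1) i).le) (hτ.p_pos hk hT t)
    (hτ.sum_p hk hT _) (hτ.sum_p hk hT t) key
  have h2 : 0 ≤ 1 / (1 - (k : ℝ) / T) := div_nonneg zero_le_one (by linarith)
  rw [Trajectory.pen, Trajectory.pen, penalty, penalty]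
  nlinarith [mul_le_mul_of_nonneg_left h1 h2]

/-- If `β` jumps too fast for `pen_succ_le`, then `ν ≤ β/2` forces the root in the update to be at
most `c₁ log T`. So the whole sum, including the current term, is still at most `2 log³ T`. -/
lemma prodSum_le (hτ : τ.IsRun) (hk : 1 ≤ k) (hT : 2 * k ≤ T) (n : ℕ) :
    τ.prodSum n ≤ 2 * Real.log T ^ 3 + 4 * ∑ t ∈ Finset.range n, τ.nu t * τ.pen t := by
  have hlog : 0 ≤ Real.log T := Real.log_natCast_nonneg T
  induction n with
  | zero => simp [Trajectory.prodSum]; positivity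
  | succ n ih =>
    have hν := hτ.nu_nonneg hk hT n
    rw [Finset.sum_range_succ]
    by_cases h : (τ.β (n + 1) - τ.β n) * Real.log T ≤ τ.β n / 2
    · have h1 := mul_le_mul_of_nonneg_left (hτ.pen_succ_le hk hT n h) hν
      rw [Trajectory.prodSum, Finset.sum_range_succ, ← Trajectory.prodSum]
      linarith
    · push Not at h
      have hc := c1_pos hk hT
      have hs := hτ.sqrt_pos hk hT (n + 1)
      rw [hτ.beta_succ, add_sub_cancel_left, div_mul_eq_mul_div, lt_div_iff₀ hs] at h
      have h1 := mul_le_mul_of_nonneg_left (hτ.nu_le_half_beta hk hT n) (mul_nonneg hc.le hlog)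
      have h2 : √(81 * c1 k T ^ 2 + τ.prodSum (n + 1)) ≤ c1 k T * Real.log T := by
        have hβ := hτ.beta_pos hk hT n
        by_contra! h3
        nlinarith [mul_lt_mul_of_pos_left h3 hβ]
      rw [Real.sqrt_le_left (by positivity)] at h2
      have h3 := mul_le_mul_of_nonneg_right (c1_sq_le hk hT) (sq_nonneg (Real.log T))
      have h4 : 0 ≤ ∑ t ∈ Finset.range n, τ.nu t * τ.pen t := Finset.sum_nonneg fun t _ =>
        mul_nonneg (hτ.nu_nonneg hk hT t) (hτ.pen_nonneg hk hT t)
      have h5 := mul_nonneg hν (hτ.pen_nonneg hk hT n)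
      nlinarith

lemma prodSum_le_log_mul (hτ : τ.IsRun) (hk : 1 ≤ k) (hT : 2 * k ≤ T) (n : ℕ) :
    τ.prodSum n ≤ 1 / (1 - (k : ℝ) / T) * Real.log k * ∑ t ∈ Finset.range n, τ.nu t := by
  obtain ⟨-, -, -, hγ0, hγ⟩ := mix_bounds hk hT (hτ.mem_posSimplex 0)
  rw [Trajectory.prodSum, Finset.mul_sum]
  refine Finset.sum_le_sum fun t _ => ?_
  rw [mul_comm]
  refine mul_le_mul_of_nonneg_right ?_ (hτ.nu_nonneg hk hT t)
  exact mul_le_mul_of_nonneg_left (entropy_le_log_card hk (fun i => (hτ.p_pos hk hT _ i).le)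
    (hτ.sum_p hk hT _)) (div_nonneg zero_le_one (by linarith))

/-- A floor on the penalties makes `prodSum` at least `η ∑ ν`; the increments of `β` are then
dominated by a telescoping sum of square roots. -/
lemma beta_le_of_le_pen (hτ : τ.IsRun) (hk : 1 ≤ k) (hT : 2 * k ≤ T) {η : ℝ} (hη : 0 < η)
    (hpen : ∀ t, η ≤ τ.pen t) (n : ℕ) :
    τ.β n ≤ 15 * k + 2 * c1 k T * √((∑ t ∈ Finset.range n, τ.nu t) / η) := by
  have hc := c1_pos hk hT
  have hν := hτ.nu_nonneg hk hT
  set N : ℕ → ℝ := fun n => ∑ t ∈ Finset.range n, τ.nu t with hN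
  have hN0 : ∀ n, 0 ≤ N n := fun n => Finset.sum_nonneg fun t _ => hν t
  have hNs : ∀ n, N (n + 1) = N n + τ.nu n := fun n => Finset.sum_range_succ _ _
  have key : τ.β n ≤ 15 * k + 2 * c1 k T / η * (√(81 * c1 k T ^ 2 + η * N n) - √(81 * c1 k T ^ 2)) := by
    induction n with
    | zero => simp [hτ.beta_zero, hN]
    | succ n ih =>
      have h1 := div_sqrt_le_sqrt_sub (x := 81 * c1 k T ^ 2 + η * N n) (d := η * τ.nu n)
        (by have := hN0 n; positivity) (mul_nonneg hη.le (hν n))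
      rw [show 81 * c1 k T ^ 2 + η * N n + η * τ.nu n = 81 * c1 k T ^ 2 + η * N (n + 1) by
        rw [hNs]; ring] at h1
      have h2 : η * N (n + 1) ≤ τ.prodSum (n + 1) := by
        rw [hN, Trajectory.prodSum, Finset.mul_sum]
        refine Finset.sum_le_sum fun t _ => ?_
        rw [mul_comm]
        exact mul_le_mul_of_nonneg_left (hpen _) (hν t)
      have hpos : 0 < √(81 * c1 k T ^ 2 + η * N (n + 1)) :=
        Real.sqrt_pos.2 (by have := hN0 (n + 1); positivity)
      have h3 : c1 k T * τ.nu n / √(81 * c1 k T ^ 2 + τ.prodSum (n + 1)) ≤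
          c1 k T * τ.nu n / √(81 * c1 k T ^ 2 + η * N (n + 1)) :=
        div_le_div_of_nonneg_left (mul_nonneg hc.le (hν n)) hpos (Real.sqrt_le_sqrt (by linarith))
      have h4 : c1 k T * τ.nu n / √(81 * c1 k T ^ 2 + η * N (n + 1)) =
          c1 k T / η * (η * τ.nu n / √(81 * c1 k T ^ 2 + η * N (n + 1))) := by field_simp
      have h5 := mul_le_mul_of_nonneg_left h1 (show 0 ≤ c1 k T / η by positivity)
      rw [hτ.beta_succ]
      have e : 2 * c1 k T / η = 2 * (c1 k T / η) := by ring
      rw [e] at ih ⊢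
      linarith
  refine key.trans (add_le_add_right ?_ _)
  have h1 := sqrt_add_le_add_sqrt (x := 81 * c1 k T ^ 2) (by positivity)
    (mul_nonneg hη.le (hN0 n))
  calc _ ≤ 2 * c1 k T / η * √(η * N n) := mul_le_mul_of_nonneg_left (by linarith) (by positivity)
    _ = 2 * c1 k T * √(N n / η) := by
      rw [show η * N n = η ^ 2 * (N n / η) by field_simp, Real.sqrt_mul (sq_nonneg η),
        Real.sqrt_sq hη.le]
      field_simp

/-- The ratio `β_T / β_0` is at most `(1 + T/(15k))²`, whose logarithm is exactly `c₁²`. This bound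
justifies the choice of `c1`. -/
lemma log_beta_sub_le (hτ : τ.IsRun) (hk : 2 ≤ k) (hT : 200000000 * k ≤ T) :
    Real.log (τ.β T) - Real.log (15 * k) ≤ c1 k T ^ 2 := by
  have hk1 : 1 ≤ k := by omega
  have hT2 : 2 * k ≤ T := by omega
  have hk' : (0 : ℝ) < k := by exact_mod_cast hk1
  have hT' : (0 : ℝ) < T := by exact_mod_cast (by omega : 0 < T)
  have hTk : 200000000 * (k : ℝ) ≤ T := by exact_mod_cast hT
  have hlog2 := Real.log_two_gt_d9
  set R : ℝ := T / k with hR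
  have hRM : 200000000 ≤ R := by rw [hR, le_div_iff₀ hk']; exact hTk
  have hTR : (T : ℝ) = k * R := by rw [hR]; field_simp
  have hc := c1_pos hk1 hT2
  have hη : ∀ t, 1 / (3 * R) ≤ τ.pen t := fun t => by
    refine le_trans ?_ ((le_entropy hk (hτ.inv_le_p hk1 hT2 t) (by omega)
      (hτ.sum_p hk1 hT2 t)).trans (hτ.entropy_le_pen hk1 hT2 t))
    rw [hTR, div_le_iff₀ (by positivity)]
    field_simp
    linarith
  have h1 := hτ.beta_le_of_le_pen hk1 hT2 (by positivity) hη T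
  have h2 : ∑ t ∈ Finset.range T, τ.nu t ≤ T * T := by
    have := Finset.sum_le_card_nsmul (Finset.range T) τ.nu T fun t _ => hτ.nu_le hk1 hT2 t
    rwa [Finset.card_range, nsmul_eq_mul] at this
  have h3 : √((∑ t ∈ Finset.range T, τ.nu t) / (1 / (3 * R))) ≤ T * √(3 * R) := by
    rw [div_div_eq_mul_div, div_one, Real.sqrt_le_left (by positivity), mul_pow,
      Real.sq_sqrt (by positivity)]
    nlinarith
  have hc2 : c1 k T ^ 2 ≤ 4 * √R := by
    rw [c1_sq]
    have h4 : 1 + (T : ℝ) / (15 * k) ≤ R := by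
      have : (T : ℝ) / (15 * k) = R / 15 := by rw [hR]; field_simp
      rw [this]; linarith
    have h5 := Real.log_le_log (by positivity) h4
    have h6 : Real.log R = 2 * Real.log √R := by rw [Real.log_sqrt (by positivity)]; ring
    have h7 := Real.log_le_sub_one_of_pos (Real.sqrt_pos.2 (show 0 < R by positivity))
    linarith
  -- Here `10800 = 30² * 3 * 4`, and `10800² < 200000000`: this is where the horizon threshold is
  -- needed.
  have hsq : 10800 * √R ≤ R := by
    have h4 : 10800 ≤ √R := Real.le_sqrt_of_sq_le (by linarith)
    nlinarith [Real.sq_sqrt (show 0 ≤ R by positivity)]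
  have hcR : 30 * (c1 k T * √(3 * R)) ≤ R := by
    have h4 : (30 * (c1 k T * √(3 * R))) ^ 2 ≤ R ^ 2 := by
      have : (30 * (c1 k T * √(3 * R))) ^ 2 = 2700 * R * c1 k T ^ 2 := by
        rw [mul_pow, mul_pow, Real.sq_sqrt (by positivity)]; ring
      rw [this]
      nlinarith
    exact abs_le_of_sq_le_sq' h4 (by positivity) |>.2
  have h5 : τ.β T ≤ 15 * k * (1 + (T : ℝ) / (15 * k)) ^ 2 := by
    have e : (T : ℝ) / (15 * k) = R / 15 := by rw [hR]; field_simp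
    rw [e]
    have h6 : 2 * c1 k T * √((∑ t ∈ Finset.range T, τ.nu t) / (1 / (3 * R))) ≤ k * R * (R / 15) := by
      calc _ ≤ 2 * c1 k T * (T * √(3 * R)) := mul_le_mul_of_nonneg_left h3 (by positivity)
        _ = k * R * (2 * (c1 k T * √(3 * R))) := by rw [hTR]; ring
        _ ≤ _ := mul_le_mul_of_nonneg_left (by linarith) (by positivity)
    have : 0 ≤ k * R := by positivity
    nlinarith
  have h6 := Real.log_le_log (hτ.beta_pos hk1 hT2 T) h5
  rw [Real.log_mul (by positivity) (by positivity), Real.log_pow] at h6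
  rw [c1_sq]
  push_cast at h6
  linarith

/-- The regret of one run with respect to the estimated losses. -/
theorem sum_est_le (hτ : τ.IsRun) (hk : 2 ≤ k) (hT : 200000000 * k ≤ T) {u : Fin k → ℝ}
    (hu : u ∈ posSimplex k) (huT : ∀ i, 1 / (T : ℝ) ≤ u i) :
    ∑ t ∈ Finset.range T, ∑ i, τ.est t i * (τ.q t i - u i) ≤
      133 / 48 * c1 k T * √(τ.prodSum T) + 33 * (k * Real.log T) := by
  have hk1 : 1 ≤ k := by omega
  have hT2 : 2 * k ≤ T := by omega
  have hk' : (1 : ℝ) ≤ k := by exact_mod_cast hk1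
  have hT' : (0 : ℝ) < T := by exact_mod_cast (by omega : 0 < T)
  have hTk : 200000000 * (k : ℝ) ≤ T := by exact_mod_cast hT
  have hγ : (k : ℝ) / T ≤ 1 / 100 := by rw [div_le_div_iff₀ hT' (by norm_num)]; linarith
  have hc := c1_pos hk1 hT2
  have h1 := hτ.ftrl_bound hk1 hT2 hγ hu huT T
  have h2 := hτ.sum_penalty_le hk1 hT2 T
  have h3 := hτ.sum_stability_le hk1 hT2 (le_refl T)
  have h4 := hτ.log_beta_sub_le hk hT
  rw [Finset.sum_add_distrib, ← Finset.mul_sum] at h1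
  set W := √(81 * c1 k T ^ 2 + τ.prodSum T)
  -- The final constants: `133/48 = 2 + 3/4 * 37/36`, and the part `9 c₁` of `W` costs at most `14
  -- log T`, so `19 + 14 = 33`.
  have h5 : W ≤ 9 * c1 k T + √(τ.prodSum T) := by
    have h6 := sqrt_add_le_add_sqrt (x := 81 * c1 k T ^ 2) (by positivity)
      (hτ.prodSum_nonneg hk1 hT2 T)
    rwa [show 81 * c1 k T ^ 2 = (9 * c1 k T) ^ 2 by ring, Real.sqrt_sq (by positivity),
      show (9 * c1 k T) ^ 2 = 81 * c1 k T ^ 2 by ring] at h6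
  have h6 : ∑ t ∈ Finset.range T, τ.nu t / τ.β t ≤ 37 / 36 * (c1 k T * W) := by
    refine h3.trans ?_
    calc _ ≤ 37 / 36 * (W / c1 k T) * c1 k T ^ 2 := mul_le_mul_of_nonneg_left h4 (by positivity)
      _ = _ := by field_simp
  have h7 := mul_le_mul_of_nonneg_left h5 hc.le
  have h8 := c1_sq_le hk1 hT2
  have h9 : Real.log T ≤ k * Real.log T := by nlinarith [Real.log_natCast_nonneg T]
  nlinarith

end Trajectory.IsRun

/-! ### Existence of the algorithm -/

lemma continuousOn_objective {k : ℕ} (L : Fin k → ℝ) (β : ℝ) :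
    ContinuousOn (objective L β) {x | ∀ i, 0 < x i} := by
  unfold objective regularizer
  have h : ∀ i, ContinuousOn (fun x : Fin k → ℝ => x i) {x | ∀ i, 0 < x i} :=
    fun i => (continuous_apply i).continuousOn
  refine ContinuousOn.add (continuousOn_finsetSum _ fun i _ => continuousOn_const.mul (h i))
    (ContinuousOn.add (continuousOn_const.mul (continuousOn_finsetSum _ fun i _ =>
      (h i).mul ((h i).log fun x hx => (hx i).ne'))) (continuousOn_const.mul
      (continuousOn_finsetSum _ fun i _ => ?_)))
  exact (continuousOn_const.div (h i) fun x hx => (hx i).ne').log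
    fun x hx => (one_div_pos.2 (hx i)).ne'

lemma objective_ge {k : ℕ} (hk : 1 ≤ k) (L : Fin k → ℝ) {β : ℝ} (hβ : 0 ≤ β) {x : Fin k → ℝ}
    (hx : x ∈ posSimplex k) (i : Fin k) :
    4 * Real.log (1 / x i) - (∑ j, |L j| + β * Real.log k) ≤ objective L β x := by
  have hle := le_one_of_sum_eq_one (fun j => (hx.1 j).le) hx.2
  have h1 : - ∑ j, |L j| ≤ ∑ j, L j * x j := by
    rw [← Finset.sum_neg_distrib]
    refine Finset.sum_le_sum fun j _ => ?_
    have := neg_abs_le (L j)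
    nlinarith [hle j, hx.1 j, abs_nonneg (L j)]
  have h2 := mul_le_mul_of_nonneg_left (entropy_le_log_card hk (fun j => (hx.1 j).le) hx.2) hβ
  have h3 : Real.log (1 / x i) ≤ ∑ j, Real.log (1 / x j) :=
    Finset.single_le_sum (f := fun j => Real.log (1 / x j)) (fun j _ => Real.log_nonneg (by
      rw [le_div_iff₀ (hx.1 j)]; linarith [hle j])) (Finset.mem_univ i)
  have h4 : ∑ j, x j * Real.log (x j) = - entropy x := by simp [entropy, Real.negMulLog]
  rw [objective, regularizer, h4]
  linarith

lemma exists_leader {k : ℕ} (hk : 1 ≤ k) (L : Fin k → ℝ) {β : ℝ} (hβ : 0 ≤ β) :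
    ∃ q ∈ posSimplex k, IsMinOn (objective L β) (posSimplex k) q := by
  have hk' : (0 : ℝ) < k := by exact_mod_cast hk
  set u : Fin k → ℝ := fun _ => 1 / k with hu
  have hu1 : ∑ i, u i = 1 := by simp [hu, hk'.ne']
  set D := ∑ j, |L j| + β * Real.log k with hD
  -- A coordinate below the second bound makes the barrier exceed the objective at the uniform law
  -- `u`, so minimizers stay in the compact set `K`; the bound `1/k` keeps `u` in `K`.
  set ε : ℝ := min (1 / k) (Real.exp (-((objective L β u + D) / 4))) with hε
  have hεpos : 0 < ε := lt_min (by positivity) (Real.exp_pos _)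
  set K : Set (Fin k → ℝ) := {x | (∀ i, ε ≤ x i) ∧ ∑ i, x i = 1} with hK
  have hKclosed : IsClosed K := by
    have : K = (⋂ i, {x | ε ≤ x i}) ∩ {x | ∑ i, x i = 1} := by ext x; simp [hK]
    rw [this]
    exact (isClosed_iInter fun i => isClosed_le continuous_const (continuous_apply i)).inter
      (isClosed_eq (continuous_finsetSum _ fun i _ => continuous_apply i) continuous_const)
  have hKsub : K ⊆ Set.Icc 0 1 := fun x hx =>
    ⟨fun i => hεpos.le.trans (hx.1 i),
      le_one_of_sum_eq_one (fun i => hεpos.le.trans (hx.1 i)) hx.2⟩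
  have hKcompact : IsCompact K := isCompact_Icc.of_isClosed_subset hKclosed hKsub
  have huK : u ∈ K := ⟨fun i => min_le_left _ _, hu1⟩
  obtain ⟨q, hqK, hq⟩ := hKcompact.exists_isMinOn ⟨u, huK⟩
    ((continuousOn_objective L β).mono fun x hx i => hεpos.trans_le (hx.1 i))
  refine ⟨q, ⟨fun i => hεpos.trans_le (hqK.1 i), hqK.2⟩, fun x hx => ?_⟩
  by_cases hxK : ∀ i, ε ≤ x i
  · exact hq (show x ∈ K from ⟨hxK, hx.2⟩)
  · push Not at hxK
    obtain ⟨i, hi⟩ := hxK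
    have h1 := objective_ge hk L hβ hx i
    have h2 : objective L β q ≤ objective L β u := hq huK
    have h3 : (objective L β u + D) / 4 ≤ Real.log (1 / x i) := by
      rw [one_div, Real.log_inv, le_neg, Real.log_le_iff_le_exp (hx.1 i)]
      exact hi.le.trans (min_le_right _ _)
    change objective L β q ≤ objective L β x
    linarith

/-- The regularized leader for the cumulative losses `z.1` and the inverse learning rate `|z.2|`. -/
def leader {k : ℕ} (hk : 1 ≤ k) (z : (Fin k → ℝ) × ℝ) : Fin k → ℝ :=
  -- The absolute value makes the leader defined and continuous for all real rates; on actual runs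
  -- the rate is positive.
  (exists_leader hk z.1 (abs_nonneg z.2)).choose

lemma leader_mem {k : ℕ} (hk : 1 ≤ k) (z : (Fin k → ℝ) × ℝ) : leader hk z ∈ posSimplex k :=
  (exists_leader hk z.1 (abs_nonneg z.2)).choose_spec.1

lemma leader_isMinOn {k : ℕ} (hk : 1 ≤ k) (z : (Fin k → ℝ) × ℝ) :
    IsMinOn (objective z.1 |z.2|) (posSimplex k) (leader hk z) :=
  (exists_leader hk z.1 (abs_nonneg z.2)).choose_spec.2

/-- Strong monotonicity of the barrier gradient: `(1/r - 1/q)(q - r) = (q - r)²/(qr) ≥ (q - r)²`.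
Pairing both stationarity conditions with `q - r` gives continuity of the leader in `L` and `β`. -/
lemma four_mul_sq_sub_le {k : ℕ} {L L' q r : Fin k → ℝ} {β β' : ℝ} (hβ : 0 ≤ β)
    (hq : q ∈ posSimplex k) (hmin : IsMinOn (objective L β) (posSimplex k) q)
    (hr : r ∈ posSimplex k) (hmin' : IsMinOn (objective L' β') (posSimplex k) r) (i : Fin k) :
    4 * (q i - r i) ^ 2 ≤ ∑ j, |L j - L' j + (β - β') * (Real.log (r j) + 1)| := by
  have hv : ∑ j, (q j - r j) = 0 := by rw [Finset.sum_sub_distrib, hq.2, hr.2, sub_self]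
  have h1 := sum_grad_mul_eq_zero hq hmin hv
  have h2 := sum_grad_mul_eq_zero hr hmin' hv
  have hqle := le_one_of_sum_eq_one (fun j => (hq.1 j).le) hq.2
  have hrle := le_one_of_sum_eq_one (fun j => (hr.1 j).le) hr.2
  have key : ∀ j, 4 * (q j - r j) ^ 2 - |L j - L' j + (β - β') * (Real.log (r j) + 1)| ≤
      grad L β q j * (q j - r j) - grad L' β' r j * (q j - r j) := by
    intro j
    have hqj := hq.1 j
    have hrj := hr.1 j
    have h3 : 0 ≤ (Real.log (q j) - Real.log (r j)) * (q j - r j) := by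
      rcases le_total (q j) (r j) with h | h
      · have := Real.log_le_log hqj h; nlinarith
      · have := Real.log_le_log hrj h; nlinarith
    have h4 : (q j - r j) ^ 2 ≤ (1 / r j - 1 / q j) * (q j - r j) := by
      have e : (1 / r j - 1 / q j) * (q j - r j) = (q j - r j) ^ 2 / (q j * r j) := by
        field_simp
      rw [e, le_div_iff₀ (mul_pos hqj hrj)]
      have : q j * r j ≤ 1 := by nlinarith [hqle j, hrle j]
      nlinarith [sq_nonneg (q j - r j)]
    set X := L j - L' j + (β - β') * (Real.log (r j) + 1) with hX
    have h5 : - |X| ≤ X * (q j - r j) := by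
      have h6 : |X * (q j - r j)| ≤ |X| * 1 := by
        rw [abs_mul]
        refine mul_le_mul_of_nonneg_left (abs_le.2 ⟨?_, ?_⟩) (abs_nonneg X) <;>
          linarith [hqle j, hrle j]
      linarith [neg_abs_le (X * (q j - r j))]
    have e : grad L β q j * (q j - r j) - grad L' β' r j * (q j - r j) =
        X * (q j - r j) + β * ((Real.log (q j) - Real.log (r j)) * (q j - r j)) +
          4 * ((1 / r j - 1 / q j) * (q j - r j)) := by rw [grad, grad, hX]; ring
    rw [e]
    nlinarith [mul_nonneg hβ h3]
  have h3 := Finset.sum_le_sum fun j (_ : j ∈ Finset.univ) => key j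
  rw [Finset.sum_sub_distrib, Finset.sum_sub_distrib, h1, h2] at h3
  have h4 := Finset.single_le_sum (f := fun j => 4 * (q j - r j) ^ 2) (fun j _ => by positivity)
    (Finset.mem_univ i)
  linarith

lemma continuous_leader {k : ℕ} (hk : 1 ≤ k) : Continuous (leader hk) := by
  rw [continuous_iff_continuousAt]
  intro z₀
  refine continuousAt_pi.2 fun i => ?_
  set g : (Fin k → ℝ) × ℝ → ℝ := fun z =>
    ∑ j, |z.1 j - z₀.1 j + (|z.2| - |z₀.2|) * (Real.log (leader hk z₀ j) + 1)| with hg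
  have hgc : Continuous g := by fun_prop
  have hg0 : g z₀ = 0 := by simp [hg]
  have hlim : Filter.Tendsto (fun z => √(g z)) (nhds z₀) (nhds 0) := by
    have := (hgc.sqrt).tendsto z₀
    rwa [hg0, Real.sqrt_zero] at this
  rw [ContinuousAt, tendsto_iff_norm_sub_tendsto_zero]
  refine squeeze_zero (fun _ => norm_nonneg _) (fun z => ?_) hlim
  rw [Real.norm_eq_abs]
  refine Real.le_sqrt_of_sq_le ?_
  rw [sq_abs]
  have := four_mul_sq_sub_le (abs_nonneg z.2) (leader_mem hk z) (leader_isMinOn hk z)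
    (leader_mem hk z₀) (leader_isMinOn hk z₀) i
  nlinarith [sq_nonneg (leader hk z i - leader hk z₀ i)]

/-- A bounded continuous function of a real variable that depends measurably on a parameter has a
fixed point that depends measurably on the parameter. -/
lemma exists_measurable_fixedPoint {Θ : Type*} [MeasurableSpace Θ] {G : Θ → ℝ → ℝ} {lo hi : Θ → ℝ}
    (hcont : ∀ θ, Continuous (G θ)) (hmeas : ∀ b, Measurable fun θ => G θ b)
    (hlo : ∀ θ b, lo θ ≤ G θ b) (hhi : ∀ θ b, G θ b ≤ hi θ) :
    ∃ f : Θ → ℝ, Measurable f ∧ ∀ θ, f θ = G θ (f θ) := by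
  -- The fixed point is the least `b` with `G b ≤ b`. A strict inequality there would persist
  -- slightly to the left.
  set V : Θ → Set ℝ := fun θ => {b | G θ b ≤ b} with hV
  have hne : ∀ θ, (V θ).Nonempty := fun θ => ⟨hi θ, hhi θ _⟩
  have hbdd : ∀ θ, BddBelow (V θ) := fun θ => ⟨lo θ, fun b hb => (hlo θ b).trans hb⟩
  have hclosed : ∀ θ, IsClosed (V θ) := fun θ => isClosed_le (hcont θ) continuous_id
  have hmem : ∀ θ, sInf (V θ) ∈ V θ := fun θ => (hclosed θ).csInf_mem (hne θ) (hbdd θ)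
  refine ⟨fun θ => sInf (V θ), ?_, fun θ => ?_⟩
  · refine measurable_of_Ioi fun c => ?_
    -- The infimum exceeds `c` iff `G b - b` has a positive lower bound over `b < c`: by compactness
    -- on `[lo - 1, c]`, trivially further left. By continuity rational `b` suffice, which makes the
    -- set measurable.
    have hset : (fun θ => sInf (V θ)) ⁻¹' Set.Ioi c =
        ⋃ n : ℕ, ⋂ b : ℚ, {θ | (b : ℝ) < c → 1 / ((n : ℝ) + 1) ≤ G θ b - b} := by
      ext θ
      simp only [Set.mem_preimage, Set.mem_Ioi, Set.mem_iUnion, Set.mem_iInter, Set.mem_ofPred_eq]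
      constructor
      · intro h
        have hpos : ∀ b ≤ c, 0 < G θ b - b := fun b hb => by
          by_contra! hcon
          have := csInf_le (hbdd θ) (show b ∈ V θ from sub_nonpos.1 hcon)
          linarith
        obtain ⟨m, hm0, hm⟩ : ∃ m, 0 < m ∧ ∀ b ∈ Set.Icc (lo θ - 1) c, m ≤ G θ b - b := by
          rcases (Set.Icc (lo θ - 1) c).eq_empty_or_nonempty with he | hn
          · exact ⟨1, one_pos, by simp [he]⟩
          · obtain ⟨b₀, hb₀, hmin⟩ := isCompact_Icc.exists_isMinOn hn
              ((hcont θ).sub continuous_id).continuousOn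
            exact ⟨_, hpos b₀ hb₀.2, fun b hb => hmin hb⟩
        obtain ⟨n, hn⟩ := exists_nat_one_div_lt hm0
        refine ⟨n, fun b hb => ?_⟩
        by_cases hbl : lo θ - 1 ≤ b
        · exact hn.le.trans (hm b ⟨hbl, hb.le⟩)
        · have h1 : 1 / ((n : ℝ) + 1) ≤ 1 := by
            rw [div_le_one (by positivity)]; linarith [n.cast_nonneg (α := ℝ)]
          linarith [hlo θ b]
      · rintro ⟨n, hn⟩
        by_contra! hcon
        set b := sInf (V θ)
        have hb := hmem θ
        have hclosure : b ∈ closure {x : ℝ | x ∈ Set.range ((↑) : ℚ → ℝ) ∧ x < c} := by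
          have hd : Dense (Set.range ((↑) : ℚ → ℝ)) := Rat.denseRange_cast
          have := hd.open_subset_closure_inter (isOpen_Iio (a := c))
          have h2 := closure_mono this
          rw [closure_closure, closure_Iio] at h2
          refine closure_mono ?_ (h2 hcon)
          rintro x ⟨hx1, hx2⟩
          exact ⟨hx2, hx1⟩
        have hcl : IsClosed {x | 1 / ((n : ℝ) + 1) ≤ G θ x - x} :=
          isClosed_le continuous_const ((hcont θ).sub continuous_id)
        have h3 : b ∈ {x | 1 / ((n : ℝ) + 1) ≤ G θ x - x} := by
          refine (hcl.closure_subset_iff.2 ?_) hclosure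
          rintro x ⟨⟨y, rfl⟩, hy⟩
          exact hn y hy
        have h4 : 0 < 1 / ((n : ℝ) + 1) := by positivity
        have h5 : G θ b ≤ b := hb
        have h6 : 1 / ((n : ℝ) + 1) ≤ G θ b - b := h3
        linarith
    rw [hset]
    refine MeasurableSet.iUnion fun n => MeasurableSet.iInter fun b => ?_
    by_cases hb : (b : ℝ) < c
    · simp only [hb, forall_true_left]
      exact measurableSet_le measurable_const ((hmeas b).sub measurable_const)
    · simp [hb]
  · refine le_antisymm ?_ (hmem θ)
    by_contra! hcon
    have h1 : ∀ᶠ b in nhds (sInf (V θ)), G θ b < b :=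
      (hcont θ).continuousAt.eventually_lt continuousAt_id hcon
    obtain ⟨b, hb, hlt⟩ := (h1.filter_mono nhdsWithin_le_nhds |>.and
      (self_mem_nhdsWithin (s := Set.Iio (sInf (V θ))))).exists
    exact absurd (csInf_le (hbdd θ) (show b ∈ V θ from hb.le)) (not_le.2 hlt)

/-- The sampling distribution that belongs to the leader. -/
def mixedLeader {k : ℕ} (hk : 1 ≤ k) (T : ℕ) (z : (Fin k → ℝ) × ℝ) (i : Fin k) : ℝ :=
  (1 - (k : ℝ) / T) * leader hk z i + (k : ℝ) / T / k

lemma continuous_mixedLeader {k : ℕ} (hk : 1 ≤ k) (T : ℕ) : Continuous (mixedLeader hk T) :=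
  continuous_pi fun i =>
    (continuous_const.mul ((continuous_apply i).comp (continuous_leader hk))).add continuous_const

lemma measurable_eval {α : Type*} [MeasurableSpace α] {k : ℕ} {f : α → Fin k → ℝ} {g : α → Fin k}
    (hf : Measurable f) (hg : Measurable g) : Measurable fun x => f x (g x) := by
  have : (fun x => f x (g x)) = fun x => ∑ i, if g x = i then f x i else 0 := by
    funext x; simp
  rw [this]
  refine Finset.measurable_sum _ fun i _ => ?_
  exact Measurable.ite (hg (measurableSet_singleton i)) ((measurable_pi_apply i).comp hf)
    measurable_const

/-- The memory of the learner: cumulative estimates, inverse learning rate, and the sum of the products of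
stability and penalty. -/
abbrev Memory (k : ℕ) : Type := ((Fin k → ℝ) × ℝ) × ℝ

/-- The memory after the observations `h`. -/
def memory {k : ℕ} (step : Memory k × (Fin k × ℝ) → Memory k) (m₀ : Memory k) :
    (t : ℕ) → Hist k t → Memory k
  | 0, _ => m₀
  | t + 1, h => step (memory step m₀ t (Fin.take t t.le_succ h), h (Fin.last t))

lemma measurable_memory {k : ℕ} {step : Memory k × (Fin k × ℝ) → Memory k} (hstep : Measurable step)
    (m₀ : Memory k) (t : ℕ) : Measurable (memory step m₀ t) := by
  induction t with
  | zero => exact measurable_const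
  | succ t ih =>
    refine hstep.comp ((ih.comp ?_).prodMk (measurable_pi_apply _))
    exact measurable_pi_lambda _ fun i => measurable_pi_apply _

/-- The cumulative estimates after one more observation. -/
def nextEstimate {k : ℕ} (hk : 1 ≤ k) (T : ℕ) (θ : Memory k × (Fin k × ℝ)) (i : Fin k) : ℝ :=
  θ.1.1.1 i + if θ.2.1 = i then θ.2.2 / mixedLeader hk T θ.1.1 i else 0

/-- The stability term of the last observation. -/
def lastStab {k : ℕ} (hk : 1 ≤ k) (T : ℕ) (θ : Memory k × (Fin k × ℝ)) : ℝ :=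
  θ.2.2 ^ 2 / mixedLeader hk T θ.1.1 θ.2.1 * min 1 (mixedLeader hk T θ.1.1 θ.2.1 * θ.1.1.2 / 2)

lemma measurable_nextEstimate {k : ℕ} (hk : 1 ≤ k) (T : ℕ) : Measurable (nextEstimate hk T) := by
  refine measurable_pi_lambda _ fun i => ?_
  have h1 : Measurable fun θ : Memory k × (Fin k × ℝ) => mixedLeader hk T θ.1.1 i :=
    (measurable_pi_apply i).comp
      ((continuous_mixedLeader hk T).measurable.comp (measurable_fst.comp measurable_fst))
  refine Measurable.add ?_ (Measurable.ite ?_ ?_ measurable_const)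
  · exact (measurable_pi_apply i).comp (measurable_fst.comp (measurable_fst.comp measurable_fst))
  · exact (measurable_fst.comp measurable_snd) (measurableSet_singleton i)
  · exact (measurable_snd.comp measurable_snd).div h1

lemma measurable_lastStab {k : ℕ} (hk : 1 ≤ k) (T : ℕ) : Measurable (lastStab hk T) := by
  have h1 : Measurable fun θ : Memory k × (Fin k × ℝ) => mixedLeader hk T θ.1.1 θ.2.1 :=
    measurable_eval ((continuous_mixedLeader hk T).measurable.comp (measurable_fst.comp measurable_fst))
      (measurable_fst.comp measurable_snd)
  have h2 : Measurable fun θ : Memory k × (Fin k × ℝ) => θ.1.1.2 :=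
    measurable_snd.comp (measurable_fst.comp measurable_fst)
  have h3 : Measurable fun θ : Memory k × (Fin k × ℝ) => θ.2.2 := measurable_snd.comp measurable_snd
  exact ((h3.pow_const 2).div h1).mul (measurable_const.min ((h1.mul h2).div_const 2))

lemma continuous_penalty {k : ℕ} (T : ℕ) : Continuous (penalty (k := k) T) :=
  continuous_const.mul (continuous_finsetSum _ fun i _ =>
    Real.continuous_negMulLog.comp (continuous_apply i))

/-- The right-hand side of the implicit equation for the inverse learning rate. -/
def rateEquation {k : ℕ} (hk : 1 ≤ k) (T : ℕ) (θ : Memory k × (Fin k × ℝ)) (b : ℝ) : ℝ :=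
  -- The truncation at 0 keeps the root away from zero on all of `Memory`; it is inactive on
  -- reachable states.
  θ.1.1.2 + c1 k T * lastStab hk T θ / √(81 * c1 k T ^ 2 +
    max 0 (θ.1.2 + lastStab hk T θ * penalty T (mixedLeader hk T (nextEstimate hk T θ, b))))

lemma exists_rate {k T : ℕ} (hk : 1 ≤ k) (hT : 2 * k ≤ T) :
    ∃ f : Memory k × (Fin k × ℝ) → ℝ, Measurable f ∧ ∀ θ, f θ = rateEquation hk T θ (f θ) := by
  have hc := c1_pos hk hT
  have hs : ∀ x : ℝ, 9 * c1 k T ≤ √(81 * c1 k T ^ 2 + max 0 x) := fun x =>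
    Real.le_sqrt_of_sq_le (by nlinarith [le_max_left 0 x])
  have habs : ∀ θ b, |rateEquation hk T θ b - θ.1.1.2| ≤ |lastStab hk T θ| := fun θ b => by
    rw [rateEquation, add_sub_cancel_left, abs_div, abs_mul, abs_of_pos hc,
      abs_of_nonneg (Real.sqrt_nonneg _), div_le_iff₀ (by linarith [hs (θ.1.2 + lastStab hk T θ *
        penalty T (mixedLeader hk T (nextEstimate hk T θ, b)))])]
    nlinarith [hs (θ.1.2 + lastStab hk T θ *
        penalty T (mixedLeader hk T (nextEstimate hk T θ, b))), abs_nonneg (lastStab hk T θ)]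
  refine exists_measurable_fixedPoint (lo := fun θ => θ.1.1.2 - |lastStab hk T θ|)
    (hi := fun θ => θ.1.1.2 + |lastStab hk T θ|) (fun θ => ?_) (fun b => ?_) (fun θ b => ?_)
    fun θ b => ?_
  · have h1 : Continuous fun b => penalty T (mixedLeader hk T (nextEstimate hk T θ, b)) :=
      (continuous_penalty T).comp ((continuous_mixedLeader hk T).comp (by fun_prop))
    unfold rateEquation
    refine continuous_const.add (continuous_const.div (by fun_prop) fun b => ?_)
    have := hs (θ.1.2 + lastStab hk T θ * penalty T (mixedLeader hk T (nextEstimate hk T θ, b)))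
    exact (lt_of_lt_of_le (by positivity) this).ne'
  · have h1 : Measurable fun θ => penalty T (mixedLeader hk T (nextEstimate hk T θ, b)) :=
      ((continuous_penalty T).comp (continuous_mixedLeader hk T)).measurable.comp
        ((measurable_nextEstimate hk T).prodMk measurable_const)
    have h2 := measurable_lastStab hk T
    have h3 : Measurable fun θ : Memory k × (Fin k × ℝ) => θ.1.1.2 :=
      measurable_snd.comp (measurable_fst.comp measurable_fst)
    have h4 : Measurable fun θ : Memory k × (Fin k × ℝ) => θ.1.2 := measurable_snd.comp measurable_fst
    exact h3.add ((measurable_const.mul h2).div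
      (measurable_const.add (measurable_const.max (h4.add (h2.mul h1)))).sqrt)
  · linarith [(abs_le.1 (habs θ b)).1]
  · linarith [(abs_le.1 (habs θ b)).2]

theorem exists_isSPAFTRL {k T : ℕ} (hk : 1 ≤ k) (hT : 2 * k ≤ T) :
    ∃ π : Policy k, IsSPAFTRL T π := by
  have hk' : (0 : ℝ) < k := by exact_mod_cast hk
  obtain ⟨f, hf, hfix⟩ := exists_rate hk hT
  set step : Memory k × (Fin k × ℝ) → Memory k := fun θ =>
    ((nextEstimate hk T θ, f θ), θ.1.2 + lastStab hk T θ *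
      penalty T (mixedLeader hk T (nextEstimate hk T θ, f θ))) with hstep
  have hstepm : Measurable step := by
    have h0 := (measurable_nextEstimate hk T).prodMk hf
    refine h0.prodMk ((measurable_snd.comp measurable_fst).add ((measurable_lastStab hk T).mul ?_))
    exact ((continuous_penalty T).comp (continuous_mixedLeader hk T)).measurable.comp h0
  set m := memory step ((0, 15 * k), 0) with hm
  have hmm : ∀ t, Measurable (m t) := fun t => measurable_memory hstepm _ t
  set pr : (t : ℕ) → Hist k t → Fin k → ℝ := fun t h => mixedLeader hk T (m t h).1 with hpr
  set be : (t : ℕ) → Hist k t → ℝ := fun t h => (m t h).1.2 with hbe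
  have hprge : ∀ t h i, 1 / (T : ℝ) ≤ pr t h i := fun t h i =>
    (mix_bounds hk hT (leader_mem hk _)).2.1 i
  have hT' : (0 : ℝ) < T := by exact_mod_cast (by omega : 0 < T)
  have hprpos : ∀ t h i, 0 < pr t h i := fun t h i =>
    lt_of_lt_of_le (by positivity) (hprge t h i)
  have hprsum : ∀ t h, ∑ i, pr t h i = 1 := fun t h =>
    (mix_bounds hk hT (leader_mem hk _)).2.2.1
  have hpen : ∀ z, 0 ≤ penalty T (mixedLeader hk T z) := fun z => by
    obtain ⟨-, h1, h2, h3, h4⟩ := mix_bounds hk hT (leader_mem hk z)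
    refine mul_nonneg (div_nonneg zero_le_one (by linarith)) (entropy_nonneg (fun i => ?_) h2)
    exact le_trans (by positivity) (h1 i)
  -- The memory holds the sums from the definition of the algorithm. The positivity parts remove the
  -- absolute value in `leader` and the truncation in `rateEquation`.
  have hinv : ∀ t h, (m t h).1.1 = cumEstimate pr h ∧ 0 < be t h ∧ 0 ≤ (m t h).2 ∧
      (m t h).2 = ∑ s : Fin t, stab pr be h s *
        penalty T (pr (s + 1) (Fin.take (s + 1) s.isLt h)) := by
    intro t
    induction t with
    | zero =>
      intro h
      refine ⟨?_, ?_, ?_, ?_⟩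
      · funext i; simp [hm, memory, cumEstimate]
      · simpa [hbe, hm, memory] using Nat.pos_of_ne_zero (by omega)
      · simp [hm, memory]
      · simp [hm, memory]
    | succ t ih =>
      intro h
      obtain ⟨h1, h2, h3, h4⟩ := ih (Fin.take t t.le_succ h)
      set θ : Memory k × (Fin k × ℝ) := (m t (Fin.take t t.le_succ h), h (Fin.last t)) with hθ
      have hmt : m (t + 1) h = step θ := rfl
      have hst : lastStab hk T θ = stab pr be h (Fin.last t) := rfl
      have hst0 : 0 ≤ lastStab hk T θ := by
        have := hprpos t (Fin.take t t.le_succ h) (h (Fin.last t)).1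
        rw [hst]
        change 0 ≤ (h (Fin.last t)).2 ^ 2 / pr t (Fin.take t t.le_succ h) (h (Fin.last t)).1 *
          min 1 (pr t (Fin.take t t.le_succ h) (h (Fin.last t)).1 * be t (Fin.take t t.le_succ h) / 2)
        positivity
      refine ⟨?_, ?_, ?_, ?_⟩
      · funext i
        rw [cumEstimate, Fin.sum_univ_castSucc]
        have := congrFun h1 i
        rw [cumEstimate] at this
        change (m t (Fin.take t t.le_succ h)).1.1 i + _ = _
        rw [this]
        rfl
      · change 0 < f θ
        rw [hfix θ, rateEquation]
        have hc := c1_pos hk hT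
        have h5 : 0 < θ.1.1.2 := h2
        positivity
      · change 0 ≤ (m t (Fin.take t t.le_succ h)).2 + lastStab hk T θ * _
        exact add_nonneg h3 (mul_nonneg hst0 (hpen _))
      · rw [Fin.sum_univ_castSucc]
        change (m t (Fin.take t t.le_succ h)).2 + lastStab hk T θ * _ = _
        rw [h4]
        rfl
  refine ⟨⟨pr, fun t h i => (hprpos t h i).le, hprsum, fun t i => (measurable_pi_apply i).comp
    ((continuous_mixedLeader hk T).measurable.comp (measurable_fst.comp (hmm t)))⟩,
    fun t h => leader hk (m t h).1, be, fun t => measurable_snd.comp (measurable_fst.comp (hmm t)),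
    fun t h => ⟨leader_mem hk _, ?_⟩, fun t h i => rfl, fun h => rfl, fun t h => ?_⟩
  · have h1 := leader_isMinOn hk (m t h).1
    obtain ⟨h2, h3, -, -⟩ := hinv t h
    have h4 : |(m t h).1.2| = be t h := abs_of_pos h3
    rw [h4, h2] at h1
    exact h1
  · obtain ⟨-, -, h3, h4⟩ := hinv (t + 1) h
    set θ : Memory k × (Fin k × ℝ) := (m t (Fin.take t t.le_succ h), h (Fin.last t)) with hθ
    rw [← h4]
    change f θ = _
    have h5 := hfix θ
    rw [rateEquation] at h5
    have h6 : (m (t + 1) h).2 = θ.1.2 + lastStab hk T θ *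
      penalty T (mixedLeader hk T (nextEstimate hk T θ, f θ)) := rfl
    rw [← h6, max_eq_right h3] at h5
    exact h5

/-! ### Expectations over the arms -/

/-- The probability of the arms `a` if `w t b i` is the probability of arm `i` in round `t` after the
arms `b`. -/
def treeProb {k : ℕ} (w : (t : ℕ) → (Fin t → Fin k) → Fin k → ℝ) {n : ℕ} (a : Fin n → Fin k) : ℝ :=
  ∏ t : Fin n, w t (Fin.take t t.isLt.le a) (a t)

/-- The expectation over the arms of the first `n` rounds. -/
def treeExp {k : ℕ} (w : (t : ℕ) → (Fin t → Fin k) → Fin k → ℝ) {n : ℕ}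
    (f : (Fin n → Fin k) → ℝ) : ℝ := ∑ a, treeProb w a * f a

/-- The weights are probability vectors. -/
structure IsTree {k : ℕ} (w : (t : ℕ) → (Fin t → Fin k) → Fin k → ℝ) : Prop where
  nonneg : ∀ t b i, 0 ≤ w t b i
  sum_eq_one : ∀ t b, ∑ i, w t b i = 1

section tree

variable {k n : ℕ} {w : (t : ℕ) → (Fin t → Fin k) → Fin k → ℝ}

lemma treeProb_snoc (a : Fin n → Fin k) (i : Fin k) :
    treeProb w (Fin.snoc (α := fun _ => Fin k) a i) = treeProb w a * w n a i := by
  have h : ∀ (t : ℕ) (ht : t ≤ n), Fin.take t (ht.trans n.le_succ)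
      (Fin.snoc (α := fun _ => Fin k) a i : Fin (n + 1) → Fin k) = Fin.take t ht a := by
    intro t ht
    funext s
    have := Fin.snoc_castSucc (α := fun _ => Fin k) i a (Fin.castLE ht s)
    simpa using this
  rw [treeProb, Fin.prod_univ_castSucc, Fin.snoc_last]
  have h1 := h n le_rfl
  rw [Fin.take_eq_self] at h1
  congr 1
  · refine Finset.prod_congr rfl fun t _ => ?_
    rw [Fin.snoc_castSucc]
    exact congrArg (fun b => w t b (a t)) (h t t.isLt.le)
  · exact congrArg (fun b => w n b i) h1

lemma treeExp_succ (f : (Fin (n + 1) → Fin k) → ℝ) :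
    treeExp w f = treeExp w fun a => ∑ i, w n a i * f (Fin.snoc (α := fun _ => Fin k) a i) := by
  rw [treeExp, ← (Fin.snocEquiv fun _ => Fin k).sum_comp, Fintype.sum_prod_type_right, treeExp]
  refine Finset.sum_congr rfl fun a _ => ?_
  rw [Finset.mul_sum]
  refine Finset.sum_congr rfl fun i _ => ?_
  change treeProb w (Fin.snoc (α := fun _ => Fin k) a i) * _ = _
  rw [treeProb_snoc, mul_assoc]
  rfl

lemma treeExp_take (hw : IsTree w) {T : ℕ} (hn : n ≤ T) (g : (Fin n → Fin k) → ℝ) :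
    treeExp w (fun a : Fin T → Fin k => g (Fin.take n hn a)) = treeExp w g := by
  induction T, hn using Nat.le_induction with
  | base => simp only [Fin.take_eq_self]
  | succ T hT ih =>
    rw [treeExp_succ, ← ih]
    congr 1
    funext a
    have h : ∀ i, Fin.take n (hT.trans T.le_succ)
        (Fin.snoc (α := fun _ => Fin k) a i : Fin (T + 1) → Fin k) = Fin.take n hT a := by
      intro i
      funext s
      have := Fin.snoc_castSucc (α := fun _ => Fin k) i a (Fin.castLE hT s)
      simpa using this
    simp only [h]
    rw [← Finset.sum_mul, hw.sum_eq_one, one_mul]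

lemma treeExp_sum {ι : Type*} (s : Finset ι) (f : ι → (Fin n → Fin k) → ℝ) :
    treeExp w (fun a => ∑ j ∈ s, f j a) = ∑ j ∈ s, treeExp w (f j) := by
  simp only [treeExp, Finset.mul_sum]
  rw [Finset.sum_comm]

lemma treeExp_add (f g : (Fin n → Fin k) → ℝ) :
    treeExp w (fun a => f a + g a) = treeExp w f + treeExp w g := by
  simp only [treeExp, mul_add, Finset.sum_add_distrib]

lemma treeExp_const_mul (c : ℝ) (f : (Fin n → Fin k) → ℝ) :
    treeExp w (fun a => c * f a) = c * treeExp w f := by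
  simp only [treeExp, Finset.mul_sum]
  exact Finset.sum_congr rfl fun a _ => by ring

lemma treeExp_const (hw : IsTree w) (c : ℝ) : treeExp w (fun _ : Fin n → Fin k => c) = c := by
  have := treeExp_take hw n.zero_le fun _ => c
  rw [this]
  simp [treeExp, treeProb]

lemma treeProb_nonneg (hw : IsTree w) (a : Fin n → Fin k) : 0 ≤ treeProb w a :=
  Finset.prod_nonneg fun _ _ => hw.nonneg _ _ _

lemma treeExp_mono (hw : IsTree w) {f g : (Fin n → Fin k) → ℝ} (h : ∀ a, f a ≤ g a) :
    treeExp w f ≤ treeExp w g :=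
  Finset.sum_le_sum fun a _ => mul_le_mul_of_nonneg_left (h a) (treeProb_nonneg hw a)

lemma treeExp_eval (hw : IsTree w) {T : ℕ} (t : Fin T) (g : (Fin t → Fin k) → Fin k → ℝ) :
    treeExp w (fun a : Fin T → Fin k => g (Fin.take t t.isLt.le a) (a t)) =
      treeExp w fun b => ∑ i, w t b i * g b i := by
  have h1 := treeExp_take hw (show (t : ℕ) + 1 ≤ T from t.isLt)
    fun b => g (Fin.take t (Nat.le_succ _) b) (b (Fin.last t))
  have h2 : treeExp w (fun a : Fin T → Fin k => g (Fin.take t t.isLt.le a) (a t)) =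
      treeExp w (fun b : Fin (t + 1) → Fin k => g (Fin.take t (Nat.le_succ _) b) (b (Fin.last t))) := by
    rw [← h1]
    rfl
  rw [h2, treeExp_succ]
  congr 1
  funext b
  refine Finset.sum_congr rfl fun i _ => ?_
  rw [Fin.snoc_last, Fin.take_eq_init, Fin.init_snoc]

/-- The tower property. -/
lemma treeExp_sum_eval (hw : IsTree w) {T : ℕ} (g : (t : Fin T) → (Fin t → Fin k) → Fin k → ℝ) :
    treeExp w (fun a : Fin T → Fin k => ∑ t, g t (Fin.take t t.isLt.le a) (a t)) =
      treeExp w (fun a : Fin T → Fin k =>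
        ∑ t : Fin T, ∑ i, w t (Fin.take t t.isLt.le a) i * g t (Fin.take t t.isLt.le a) i) := by
  rw [treeExp_sum, treeExp_sum]
  refine Finset.sum_congr rfl fun t _ => ?_
  rw [treeExp_eval hw t, treeExp_take hw t.isLt.le fun b => ∑ i, w t b i * g t b i]

end tree

/-! ### The law of the arms given the randomness of the environment. -/

namespace Environment

variable {k : ℕ} (E : Environment.{u} k)

/-- The observations when the arms `a` are played. -/
def obs (ω : E.Ω) {t : ℕ} (a : Fin t → Fin k) : Hist k t :=
  fun s => (a s, E.loss s ω (Fin.take s s.isLt.le a) (a s))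

/-- The probabilities of the arms given the randomness of the environment. -/
def weights (π : Policy k) (ω : E.Ω) (t : ℕ) (a : Fin t → Fin k) (i : Fin k) : ℝ :=
  π.prob t (E.obs ω a) i

lemma isTree_weights (π : Policy k) (ω : E.Ω) : IsTree (E.weights π ω) :=
  ⟨fun _ _ _ => π.nonneg _ _ _, fun _ _ => π.sum_eq_one _ _⟩

lemma expect_eq_integral_treeExp (T : ℕ) (π : Policy k) (f : E.Ω → (Fin T → Fin k) → ℝ) :
    E.expect T π f = ∫ ω, treeExp (E.weights π ω) (f ω) ∂E.μ := rfl

end Environment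

/-- A sequence of arms that starts with `a`. -/
def extendArms {k T : ℕ} (i₀ : Fin k) (a : Fin T → Fin k) (t : ℕ) : Fin k :=
  -- Runs are indexed by all of `ℕ`. The default is harmless: even the leader of index `T`, which
  -- enters `prodSum T`, depends only on the first `T` arms.
  if h : t < T then a ⟨t, h⟩ else i₀

lemma extendArms_apply {k T : ℕ} (i₀ : Fin k) (a : Fin T → Fin k) (t : Fin T) :
    extendArms i₀ a t = a t := by simp [extendArms]

lemma extendArms_take {k T : ℕ} (i₀ : Fin k) (a : Fin T → Fin k) (t : Fin T) :
    (fun s : Fin t => extendArms i₀ a s) = Fin.take t t.isLt.le a := by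
  funext s
  exact extendArms_apply i₀ a (Fin.castLE t.isLt.le s)

/-- The run of the algorithm when the arms `A` are played. -/
def Environment.trajectory {k : ℕ} (E : Environment.{u} k) (ω : E.Ω) (T : ℕ)
    (q : (t : ℕ) → Hist k t → Fin k → ℝ) (β : (t : ℕ) → Hist k t → ℝ) (A : ℕ → Fin k) :
    Trajectory k T where
  q t := q t (E.obs ω fun s : Fin t => A s)
  β t := β t (E.obs ω fun s : Fin t => A s)
  A := A
  loss t := E.loss t ω (fun s : Fin t => A s) (A t)

lemma Environment.trajectory_isRun {k : ℕ} (E : Environment.{u} k) (ω : E.Ω) {T : ℕ} {π : Policy k}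
    {q : (t : ℕ) → Hist k t → Fin k → ℝ} {β : (t : ℕ) → Hist k t → ℝ}
    (hq : ∀ t h, q t h ∈ posSimplex k ∧
      IsMinOn (fun x => (∑ i, cumEstimate π.prob h i * x i) + regularizer (β t h) x)
        (posSimplex k) (q t h))
    (hp : ∀ t h i, π.prob t h i = (1 - (k : ℝ) / T) * q t h i + (k : ℝ) / T / k)
    (hβ0 : ∀ h, β 0 h = 15 * k)
    (hβ : ∀ t (h : Hist k (t + 1)),
      β (t + 1) h = β t (Fin.take t t.le_succ h) +
        c1 k T * stab π.prob β h (Fin.last t) /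
          √(81 * c1 k T ^ 2 + ∑ s : Fin (t + 1), stab π.prob β h s *
            penalty T (π.prob (s + 1) (Fin.take (s + 1) s.isLt h)))) (A : ℕ → Fin k) :
    (E.trajectory ω T q β A).IsRun := by
  set τ := E.trajectory ω T q β A with hτ
  have hpr : ∀ t, τ.p t = π.prob t (E.obs ω fun s : Fin t => A s) := fun t => by
    funext i; rw [hp]; rfl
  have hnu : ∀ (t : ℕ) (s : Fin t), τ.nu s = stab π.prob β (E.obs ω fun s : Fin t => A s) s := by
    intro t s
    rw [Trajectory.nu, hpr]
    rfl
  refine ⟨fun t => E.abs_loss_le_one _ _ _ _, fun t => (hq t _).1, fun t => ?_, hβ0 _, fun t => ?_⟩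
  · have h1 : τ.cum t = cumEstimate π.prob (E.obs ω fun s : Fin t => A s) := by
      funext i
      rw [Trajectory.cum, Finset.sum_range, cumEstimate]
      refine Finset.sum_congr rfl fun s _ => ?_
      rw [Trajectory.est, hpr]
      change (if A s = i then _ else _) = if A s = i then _ else _
      split_ifs with h
      · subst h; rfl
      · rfl
    rw [h1]
    exact (hq t _).2
  · have h1 := hβ t (E.obs ω fun s : Fin (t + 1) => A s)
    have h2 : τ.prodSum (t + 1) = ∑ s : Fin (t + 1), stab π.prob β (E.obs ω fun s : Fin (t + 1) => A s) s *
        penalty T (π.prob (s + 1) (Fin.take (s + 1) s.isLt (E.obs ω fun s : Fin (t + 1) => A s))) := by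
      rw [Trajectory.prodSum, Finset.sum_range]
      refine Finset.sum_congr rfl fun s _ => ?_
      rw [hnu, Trajectory.pen, hpr]
      rfl
    rw [← h2, ← hnu (t + 1) (Fin.last t)] at h1
    exact h1

/-- The cost of exploration: passing from `p` to `q` and from the vertex `i` to its mixture changes
coordinate `j` by at most `γ q_j + γ 1[j = i] + 2γ/k`, in total `4γ`. -/
lemma sum_mul_sub_le {k T : ℕ} (hk : 1 ≤ k) (hT : 2 * k ≤ T) {l q : Fin k → ℝ}
    (hl : ∀ j, |l j| ≤ 1) (hq : q ∈ posSimplex k) (i : Fin k) :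
    ∑ j, ((1 - (k : ℝ) / T) * q j + (k : ℝ) / T / k) * (l j - l i) ≤
      ∑ j, l j * (q j - ((1 - (k : ℝ) / T) * (Pi.single i 1 : Fin k → ℝ) j + (k : ℝ) / T / k)) +
        4 * (k / T) := by
  have hk' : (0 : ℝ) < k := by exact_mod_cast hk
  obtain ⟨-, -, hsum, h0, -⟩ := mix_bounds hk hT hq
  set γ := (k : ℝ) / T
  have hi : l i = ∑ j, l j * (Pi.single i 1 : Fin k → ℝ) j := by simp [Pi.single_apply]
  have h1 : ∑ j, ((1 - γ) * q j + γ / k) * (l j - l i) =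
      ∑ j, l j * ((1 - γ) * q j + γ / k) - ∑ j, l j * (Pi.single i 1 : Fin k → ℝ) j := by
    simp only [mul_sub, Finset.sum_sub_distrib]
    rw [← Finset.sum_mul, hsum, one_mul, ← hi]
    simp [mul_comm]
  rw [h1, ← Finset.sum_sub_distrib, ← sub_le_iff_le_add', ← Finset.sum_sub_distrib]
  have h2 : ∑ j, (2 * (γ / k) + γ * q j + γ * (Pi.single i 1 : Fin k → ℝ) j) = 4 * γ := by
    simp only [Finset.sum_add_distrib, ← Finset.mul_sum, hq.2]
    simp
    field_simp
    ring
  rw [← h2]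
  refine Finset.sum_le_sum fun j _ => ?_
  have e0 : (0 : ℝ) ≤ (Pi.single i 1 : Fin k → ℝ) j := by
    rw [Pi.single_apply]; split_ifs <;> norm_num
  have e1 : l j * ((1 - γ) * q j + γ / k) - l j * (Pi.single i 1 : Fin k → ℝ) j -
      l j * (q j - ((1 - γ) * (Pi.single i 1 : Fin k → ℝ) j + γ / k)) =
      l j * (2 * (γ / k)) - l j * (γ * q j) - l j * (γ * (Pi.single i 1 : Fin k → ℝ) j) := by ring
  rw [e1]
  obtain ⟨hl1, hl2⟩ := abs_le.1 (hl j)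
  have e2 : 0 ≤ γ / k := by positivity
  have e3 : 0 ≤ γ * q j := mul_nonneg h0 (hq.1 j).le
  have e4 := mul_nonneg h0 e0
  nlinarith

/-- The regret given the randomness of the environment, in terms of the sum `S` of the products of
stability and penalty. -/
theorem exists_conditional_bound {k T : ℕ} (hk : 2 ≤ k) (hT : 200000000 * k ≤ T) {π : Policy k}
    (hπ : IsSPAFTRL T π) (E : Environment.{u} k) (ω : E.Ω) :
    ∃ S : (Fin T → Fin k) → ℝ, (∀ a, 0 ≤ S a) ∧
      (∀ i, treeExp (E.weights π ω) (fun a : Fin T → Fin k =>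
          ∑ t, (E.lossAt ω a t (a t) - E.lossAt ω a t i)) ≤
        37 * (k * Real.log T) + 133 / 48 * c1 k T * treeExp (E.weights π ω) fun a => √(S a)) ∧
      treeExp (E.weights π ω) S ≤ 1 / (1 - (k : ℝ) / T) * Real.log k *
        treeExp (E.weights π ω) (fun a : Fin T → Fin k => ∑ t : Fin T, ∑ i, E.lossAt ω a t i ^ 2) ∧
      ∀ aStar, treeExp (E.weights π ω) S ≤ 2 * Real.log T ^ 3 + 8 * (Real.log (k * T) + 2) *
        treeExp (E.weights π ω) (fun a : Fin T → Fin k => ∑ t : Fin T,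
          (∑ i, E.lossAt ω a t i ^ 2) *
            (1 - E.weights π ω t (Fin.take t t.isLt.le a) aStar)) := by
  have hk1 : 1 ≤ k := by omega
  have hT2 : 2 * k ≤ T := by omega
  have hk' : (0 : ℝ) < k := by exact_mod_cast hk1
  have hT' : (0 : ℝ) < T := by exact_mod_cast (by omega : 0 < T)
  obtain ⟨q, β, -, hq, hp, hβ0, hβ⟩ := hπ
  set w := E.weights π ω with hwdef
  have hw : IsTree w := E.isTree_weights π ω
  set i₀ : Fin k := ⟨0, hk1⟩
  set τ : (Fin T → Fin k) → Trajectory k T := fun a => E.trajectory ω T q β (extendArms i₀ a) with hτ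
  have hrun : ∀ a, (τ a).IsRun := fun a => E.trajectory_isRun ω hq hp hβ0 hβ _
  have hobs : ∀ (a : Fin T → Fin k) (t : Fin T),
      (E.obs ω fun s : Fin t => extendArms i₀ a s) = E.obs ω (Fin.take t t.isLt.le a) :=
    fun a t => by rw [extendArms_take]
  have hτq : ∀ (a : Fin T → Fin k) (t : Fin T),
      (τ a).q t = q t (E.obs ω (Fin.take t t.isLt.le a)) := fun a t => by rw [← hobs]; rfl
  have hτA : ∀ (a : Fin T → Fin k) (t : Fin T), (τ a).A t = a t := extendArms_apply i₀
  have hτl : ∀ (a : Fin T → Fin k) (t : Fin T), (τ a).loss t = E.lossAt ω a t (a t) := fun a t => by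
    rw [Environment.lossAt, ← extendArms_take i₀, ← hτA a t]; rfl
  have hwq : ∀ (t : ℕ) (b : Fin t → Fin k) i,
      w t b i = (1 - (k : ℝ) / T) * q t (E.obs ω b) i + (k : ℝ) / T / k := fun t b i => hp t _ i
  have hτp : ∀ (a : Fin T → Fin k) (t : Fin T), (τ a).p t = w t (Fin.take t t.isLt.le a) :=
    fun a t => by funext i; rw [Trajectory.p, hτq, hwq]
  have hwge : ∀ (t : ℕ) (b : Fin t → Fin k) i, 1 / (T : ℝ) ≤ w t b i := fun t b i => by
    rw [hwq]; exact (mix_bounds hk1 hT2 (hq t _).1).2.1 i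
  have hwpos : ∀ (t : ℕ) (b : Fin t → Fin k) i, 0 < w t b i := fun t b i =>
    lt_of_lt_of_le (by positivity) (hwge t b i)
  -- Averaging `ℓ²/p` over the arm of round `t` gives `∑ ℓ_i²`. The weight `g` may only depend on
  -- the earlier arms.
  have hnu : ∀ g : (t : Fin T) → (Fin t → Fin k) → ℝ, (∀ t b, 0 ≤ g t b) →
      treeExp w (fun a : Fin T → Fin k => ∑ t : Fin T, (τ a).nu t * g t (Fin.take t t.isLt.le a)) ≤
        treeExp w (fun a : Fin T → Fin k =>
          ∑ t : Fin T, (∑ i, E.lossAt ω a t i ^ 2) * g t (Fin.take t t.isLt.le a)) := by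
    intro g hg
    have h1 := treeExp_sum_eval hw (T := T) fun t b i => E.loss t ω b i ^ 2 / w t b i * g t b
    refine le_trans (treeExp_mono hw fun a => Finset.sum_le_sum fun t _ => ?_) (h1.le.trans (le_of_eq ?_))
    · refine mul_le_mul_of_nonneg_right ?_ (hg _ _)
      have := (hrun a).nu_le_sq_div hk1 hT2 t
      rwa [hτp, hτA, hτl] at this
    · congr 1
      funext a
      refine Finset.sum_congr rfl fun t _ => ?_
      rw [Finset.sum_mul]
      refine Finset.sum_congr rfl fun i _ => ?_
      have := (hwpos t (Fin.take t t.isLt.le a) i).ne'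
      rw [Environment.lossAt]
      field_simp
  refine ⟨fun a => (τ a).prodSum T, fun a => (hrun a).prodSum_nonneg hk1 hT2 T, fun i => ?_, ?_,
    fun aStar => ?_⟩
  -- The vertex `i` is mixed with exploration to get entries at least `1/T`. Over `T` rounds this
  -- and the exploration of the learner cost `4k`, so `33 + 4 = 37`.
  · set u : Fin k → ℝ := fun j => (1 - (k : ℝ) / T) * (Pi.single i 1 : Fin k → ℝ) j + (k : ℝ) / T / k
      with hu
    have hγ1 : (k : ℝ) / T / k = 1 / T := by field_simp
    obtain ⟨-, -, -, hγ0, hγ⟩ := mix_bounds hk1 hT2 (hq 0 (fun s => s.elim0)).1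
    have huT : ∀ j, 1 / (T : ℝ) ≤ u j := fun j => by
      have : (0 : ℝ) ≤ (Pi.single i 1 : Fin k → ℝ) j := by
        rw [Pi.single_apply]; split_ifs <;> norm_num
      simp only [hu, hγ1]
      nlinarith
    have hupos : u ∈ posSimplex k := by
      refine ⟨fun j => lt_of_lt_of_le (by positivity) (huT j), ?_⟩
      simp only [hu, Finset.sum_add_distrib, ← Finset.mul_sum]
      simp
      field_simp
      ring
    have h1 := treeExp_sum_eval hw (T := T) fun t b j => E.loss t ω b j - E.loss t ω b i
    have h2 := treeExp_sum_eval hw (T := T)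
      fun t b j => E.loss t ω b j / w t b j * (q t (E.obs ω b) j - u j)
    have h3 : treeExp w (fun a : Fin T → Fin k =>
          ∑ t, (E.lossAt ω a t (a t) - E.lossAt ω a t i)) ≤
        treeExp w (fun a : Fin T → Fin k => (∑ t ∈ Finset.range T, ∑ j,
          (τ a).est t j * ((τ a).q t j - u j)) + 4 * k) := by
      have e : treeExp w (fun a : Fin T → Fin k => ∑ t ∈ Finset.range T, ∑ j,
          (τ a).est t j * ((τ a).q t j - u j)) = treeExp w (fun a : Fin T → Fin k => ∑ t : Fin T,
          E.loss t ω (Fin.take t t.isLt.le a) (a t) / w t (Fin.take t t.isLt.le a) (a t) *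
            (q t (E.obs ω (Fin.take t t.isLt.le a)) (a t) - u (a t))) := by
        congr 1
        funext a
        rw [Finset.sum_range]
        refine Finset.sum_congr rfl fun t _ => ?_
        simp only [Trajectory.est, hτA, hτq, hτl, hτp, ite_mul, zero_mul]
        rw [Finset.sum_ite_eq, if_pos (Finset.mem_univ _)]
        rfl
      rw [treeExp_add, e, h2, treeExp_const hw]
      refine h1.le.trans ?_
      rw [← treeExp_const hw (n := T) (4 * (k : ℝ)), ← treeExp_add]
      refine treeExp_mono hw fun a => ?_
      have e2 : (4 * (k : ℝ)) = ∑ _t : Fin T, 4 * ((k : ℝ) / T) := by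
        rw [Finset.sum_const, Finset.card_univ, Fintype.card_fin, nsmul_eq_mul]; field_simp
      rw [e2, ← Finset.sum_add_distrib]
      refine Finset.sum_le_sum fun t _ => ?_
      set b := Fin.take t t.isLt.le a
      have h4 := sum_mul_sub_le hk1 hT2 (fun j => E.abs_loss_le_one t ω b j) (hq t (E.obs ω b)).1 i
      have e3 : ∑ j, w t b j * (E.loss t ω b j / w t b j * (q t (E.obs ω b) j - u j)) =
          ∑ j, E.loss t ω b j * (q t (E.obs ω b) j - u j) := by
        refine Finset.sum_congr rfl fun j _ => ?_
        have := (hwpos t b j).ne'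
        field_simp
      rw [e3]
      simp only [hwq]
      exact h4
    refine h3.trans ?_
    rw [← treeExp_const_mul, ← treeExp_const hw (n := T) (37 * ((k : ℝ) * Real.log T)), ← treeExp_add]
    refine treeExp_mono hw fun a => ?_
    have h4 := (hrun a).sum_est_le hk hT hupos huT
    have h5 : 1 ≤ Real.log T := by
      rw [Real.le_log_iff_exp_le hT']
      have h6 : (3 : ℝ) ≤ T := by exact_mod_cast (by omega : 3 ≤ T)
      linarith [Real.exp_one_lt_d9]
    nlinarith
  · have h1 := hnu (fun _ _ => 1) fun _ _ => zero_le_one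
    simp only [mul_one] at h1
    have hγ := (mix_bounds hk1 hT2 (hq 0 (fun s => s.elim0)).1).2.2.2.2
    have h2 : 0 ≤ 1 / (1 - (k : ℝ) / T) * Real.log k :=
      mul_nonneg (div_nonneg zero_le_one (by linarith)) (Real.log_natCast_nonneg k)
    refine le_trans ?_ (mul_le_mul_of_nonneg_left h1 h2)
    rw [← treeExp_const_mul]
    refine treeExp_mono hw fun a => ?_
    rw [← Finset.sum_range fun t => (τ a).nu t]
    exact (hrun a).prodSum_le_log_mul hk1 hT2 T
  -- A second arm exists, and exploration gives it probability at least `1/T`.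
  · have hle : ∀ (t : ℕ) (b : Fin t → Fin k), 1 / (T : ℝ) ≤ 1 - w t b aStar := fun t b => by
      have : Nontrivial (Fin k) := Fin.nontrivial_iff_two_le.2 hk
      obtain ⟨j, hj⟩ := exists_ne aStar
      have h1 : w t b aStar + w t b j ≤ ∑ i, w t b i := by
        rw [← Finset.sum_pair hj.symm]
        exact Finset.sum_le_sum_of_subset_of_nonneg (Finset.subset_univ _)
          fun i _ _ => hw.nonneg t b i
      rw [hw.sum_eq_one] at h1
      linarith [hwge t b j]
    have hpos : ∀ (t : ℕ) (b : Fin t → Fin k), 0 ≤ 1 - w t b aStar := fun t b =>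
      le_trans (by positivity) (hle t b)
    have h1 := hnu (fun t b => 1 - w t b aStar) fun t b => hpos t b
    have hlog : 0 ≤ Real.log (k * T) := by
      have := Real.log_natCast_nonneg (k * T)
      rwa [Nat.cast_mul] at this
    have hpen : ∀ (a : Fin T → Fin k) (t : Fin T), (τ a).pen t ≤
        2 * (Real.log (k * T) + 2) * (1 - w t (Fin.take t t.isLt.le a) aStar) := fun a t => by
      have hγ := (mix_bounds hk1 hT2 (hq 0 (fun s => s.elim0)).1).2.2.2.2
      have h2 := entropy_le_one_sub_mul hk1 (by omega) (hw.nonneg t (Fin.take t t.isLt.le a))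
        (hw.sum_eq_one t _) aStar (hle t _)
      rw [Trajectory.pen, penalty, hτp, div_mul_eq_mul_div, one_mul, div_le_iff₀ (by linarith)]
      have h3 := mul_nonneg (show 0 ≤ Real.log (k * T) + 2 by linarith)
        (hpos t (Fin.take t t.isLt.le a))
      nlinarith
    have h2 := mul_le_mul_of_nonneg_left h1 (show 0 ≤ 8 * (Real.log (k * T) + 2) by linarith)
    rw [← treeExp_const_mul] at h2
    refine le_trans ?_ (add_le_add_right h2 _)
    rw [← treeExp_const hw (n := T) (2 * Real.log T ^ 3), ← treeExp_add]
    refine treeExp_mono hw fun a => ((hrun a).prodSum_le hk1 hT2 T).trans (add_le_add_right ?_ _)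
    rw [Finset.sum_range, Finset.mul_sum, Finset.mul_sum]
    refine Finset.sum_le_sum fun t _ => ?_
    have := mul_le_mul_of_nonneg_left (hpen a t) ((hrun a).nu_nonneg hk1 hT2 t)
    linarith

/-! ### Arithmetic of the regret bounds -/

/-- The root is the infimum over `m` of the AM-GM bounds, attained at `m = √y`; for `y = 0` one lets
`m` tend to 0. -/
lemma le_add_mul_sqrt {x A B y : ℝ} (hB : 0 ≤ B) (hy : 0 ≤ y)
    (h : ∀ m : ℝ, 0 < m → x ≤ A + B * ((y / m + m) / 2)) : x ≤ A + B * √y := by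
  rcases hy.eq_or_lt with rfl | hy
  · refine le_of_forall_pos_le_add fun ε hε => ?_
    have h1 := h (ε / (B + 1)) (by positivity)
    have h2 : B * (ε / (B + 1)) ≤ ε := by
      rw [← mul_div_assoc, div_le_iff₀ (by positivity)]; nlinarith
    simp only [zero_div, zero_add, Real.sqrt_zero, mul_zero, add_zero] at h1 ⊢
    linarith
  · have h1 := h (√y) (Real.sqrt_pos.2 hy)
    rw [Real.div_sqrt] at h1
    linarith

/-- The self-bounding argument. -/
lemma le_of_self_bounding {R B Λ LL c s N Δ C : ℝ} (hB : 0 ≤ B) (hΛ : 0 ≤ Λ) (hLL : 2 ≤ 3 * LL)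
    (hcΛ : c ^ 2 ≤ 2 * Λ) (hs : 0 ≤ s) (hN : 0 ≤ N) (hΔ : 0 < Δ) (hC : 0 ≤ C)
    (hR : R ≤ 37 * B + 133 / 48 * c * √(2 * Λ ^ 3 + 8 * (LL + 2) * (s * N)))
    (hNR : Δ * N ≤ R + C) :
    R ≤ 74 * B + 12 * Λ ^ 2 + 576 * (s * Λ * LL / Δ) + 48 * √(C * s * Λ * LL / Δ) := by
  have hLL0 : 0 ≤ LL := by linarith
  set V := s * Λ * LL / Δ with hV
  have hV0 : 0 ≤ V := by positivity
  rcases lt_or_ge R 0 with hneg | hpos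
  · have : 0 ≤ √(C * s * Λ * LL / Δ) := Real.sqrt_nonneg _
    nlinarith [sq_nonneg Λ]
  have hsN : 0 ≤ s * N := mul_nonneg hs hN
  -- Constants: `(133/48)² * 2 ≤ 18`; then `18 * 2 Λ⁴ = (6Λ²)²` and, by `LL + 2 ≤ 4 LL`, `18 * 32 =
  -- 24²`.
  have h1 : 133 / 48 * c * √(2 * Λ ^ 3 + 8 * (LL + 2) * (s * N)) ≤
      √((6 * Λ ^ 2) ^ 2 + 24 ^ 2 * (V * R + V * C)) := by
    refine Real.le_sqrt_of_sq_le ?_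
    rw [mul_pow, Real.sq_sqrt (by positivity)]
    have h2 : s * N * (Λ * LL) ≤ V * R + V * C := by
      have e : V * R + V * C = s * Λ * LL * ((R + C) / Δ) := by rw [hV]; ring
      have h3 : N ≤ (R + C) / Δ := by rw [le_div_iff₀ hΔ]; linarith
      rw [e]
      calc _ = s * Λ * LL * N := by ring
        _ ≤ _ := mul_le_mul_of_nonneg_left h3 (by positivity)
    set y := 2 * Λ ^ 3 + 8 * (LL + 2) * (s * N) with hy
    have hy0 : 0 ≤ y := by positivity
    have h3 : (133 / 48 * c) ^ 2 * y ≤ 18 * Λ * y := by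
      refine mul_le_mul_of_nonneg_right ?_ hy0
      nlinarith
    have h4 : Λ * (8 * (LL + 2) * (s * N)) ≤ 32 * (s * N * (Λ * LL)) := by
      have : LL + 2 ≤ 4 * LL := by linarith
      nlinarith [mul_nonneg hΛ hsN, mul_le_mul_of_nonneg_left this (mul_nonneg hΛ hsN)]
    have h5 : 18 * Λ * y = 36 * Λ ^ 4 + 18 * (Λ * (8 * (LL + 2) * (s * N))) := by rw [hy]; ring
    nlinarith
  have h2 : √((6 * Λ ^ 2) ^ 2 + 24 ^ 2 * (V * R + V * C)) ≤
      6 * Λ ^ 2 + 24 * (√(V * R) + √(V * C)) := by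
    have h3 := sqrt_add_le_add_sqrt (x := (6 * Λ ^ 2) ^ 2) (y := 24 ^ 2 * (V * R + V * C))
      (by positivity) (by positivity)
    rw [Real.sqrt_sq (by positivity), Real.sqrt_mul (by positivity), Real.sqrt_sq (by norm_num)] at h3
    have h4 := sqrt_add_le_add_sqrt (x := V * R) (y := V * C) (by positivity) (by positivity)
    linarith
  -- AM-GM balanced so that `24 * R/48 = R/2` moves to the left-hand side, which doubles the other
  -- terms.
  have h3 : √(V * R) ≤ 12 * V + R / 48 := by
    rw [Real.sqrt_le_left (by positivity)]
    nlinarith [sq_nonneg (12 * V - R / 48)]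
  have h4 : V * C = C * s * Λ * LL / Δ := by rw [hV]; ring
  have h5 : R ≤ 37 * B + (6 * Λ ^ 2 + 24 * (√(V * R) + √(V * C))) :=
    hR.trans (add_le_add_right (h1.trans h2) _)
  rw [← h4]
  clear_value V
  linarith

/-- The probability of the other arms. -/
lemma sum_mul_ite_eq {k : ℕ} {p : Fin k → ℝ} (hp : ∑ i, p i = 1) (a : Fin k) :
    ∑ i, p i * (if i = a then 0 else 1) = 1 - p a := by
  have h1 : ∀ i, p i * (if i = a then 0 else 1) = p i - if i = a then p i else 0 := fun i => by
    split_ifs <;> ring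
  simp only [h1, Finset.sum_sub_distrib, hp]
  simp

namespace Environment

variable {k : ℕ} (E : Environment.{u} k) {T : ℕ} {π : Policy k}

/-! ### Integrability -/

lemma measurable_obs {t : ℕ} (a : Fin t → Fin k) : Measurable fun ω => E.obs ω a :=
  measurable_pi_lambda _ fun _ => measurable_const.prodMk (E.measurable_loss _ _ _)

lemma measurable_weights (t : ℕ) (a : Fin t → Fin k) (i : Fin k) :
    Measurable fun ω => E.weights π ω t a i :=
  (π.measurable_prob t i).comp (E.measurable_obs a)

lemma measurable_treeExp {n : ℕ} {f : E.Ω → (Fin n → Fin k) → ℝ}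
    (hf : ∀ a, Measurable fun ω => f ω a) :
    Measurable fun ω => treeExp (E.weights π ω) (f ω) :=
  Finset.measurable_sum _ fun a _ =>
    (Finset.measurable_prod _ fun _ _ => E.measurable_weights _ _ _).mul (hf a)

lemma abs_treeExp_le {n : ℕ} {f : (Fin n → Fin k) → ℝ} {B : ℝ} (hB : ∀ a, |f a| ≤ B) (ω : E.Ω) :
    |treeExp (E.weights π ω) f| ≤ B := by
  have hw := E.isTree_weights π ω
  refine abs_le.2 ⟨?_, ?_⟩
  · rw [← treeExp_const hw (n := n) (-B)]
    exact treeExp_mono hw fun a => (abs_le.1 (hB a)).1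
  · rw [← treeExp_const hw (n := n) B]
    exact treeExp_mono hw fun a => (abs_le.1 (hB a)).2

lemma integrable_treeExp {n : ℕ} {f : E.Ω → (Fin n → Fin k) → ℝ}
    (hf : ∀ a, Measurable fun ω => f ω a) {B : ℝ} (hB : ∀ ω a, |f ω a| ≤ B) :
    Integrable (fun ω => treeExp (E.weights π ω) (f ω)) E.μ :=
  Integrable.of_bound (E.measurable_treeExp hf).aestronglyMeasurable B
    (Filter.Eventually.of_forall fun ω => E.abs_treeExp_le (hB ω) ω)

lemma measurable_lossAt (a : Fin T → Fin k) (t : Fin T) (i : Fin k) :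
    Measurable fun ω => E.lossAt ω a t i := E.measurable_loss _ _ _

lemma abs_lossAt_le (ω : E.Ω) (a : Fin T → Fin k) (t : Fin T) (i : Fin k) :
    |E.lossAt ω a t i| ≤ 1 := E.abs_loss_le_one _ _ _ _

lemma lossAt_sq_le (ω : E.Ω) (a : Fin T → Fin k) (t : Fin T) (i : Fin k) :
    E.lossAt ω a t i ^ 2 ≤ 1 := by
  rw [sq_le_one_iff_abs_le_one]; exact E.abs_lossAt_le ω a t i

lemma abs_sum_lossAt_sub_le (ω : E.Ω) (a : Fin T → Fin k) (i : Fin k) :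
    |∑ t, (E.lossAt ω a t (a t) - E.lossAt ω a t i)| ≤ 2 * T := by
  refine (Finset.abs_sum_le_sum_abs _ _).trans ?_
  have : ∀ t ∈ Finset.univ, |E.lossAt ω a t (a t) - E.lossAt ω a t i| ≤ 2 := fun t _ => by
    refine (abs_sub _ _).trans ?_
    linarith [E.abs_lossAt_le ω a t (a t), E.abs_lossAt_le ω a t i]
  have := Finset.sum_le_card_nsmul _ _ _ this
  rw [Finset.card_univ, Fintype.card_fin, nsmul_eq_mul] at this
  linarith

lemma integrable_regret (i : Fin k) :
    Integrable (fun ω => treeExp (E.weights π ω) fun a : Fin T → Fin k =>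
      ∑ t, (E.lossAt ω a t (a t) - E.lossAt ω a t i)) E.μ :=
  E.integrable_treeExp (fun a => Finset.measurable_sum _ fun t _ =>
    (E.measurable_lossAt a t _).sub (E.measurable_lossAt a t i)) fun ω a =>
    E.abs_sum_lossAt_sub_le ω a i

lemma abs_sum_sq_le (ω : E.Ω) (a : Fin T → Fin k) :
    |∑ t, ∑ i, E.lossAt ω a t i ^ 2| ≤ T * k := by
  rw [abs_of_nonneg (Finset.sum_nonneg fun t _ => Finset.sum_nonneg fun i _ => sq_nonneg _)]
  have h : ∀ t ∈ Finset.univ, ∑ i, E.lossAt ω a t i ^ 2 ≤ (k : ℝ) := fun t _ => by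
    have := Finset.sum_le_card_nsmul Finset.univ (fun i => E.lossAt ω a t i ^ 2) 1
      fun i _ => E.lossAt_sq_le ω a t i
    simpa using this
  have := Finset.sum_le_card_nsmul _ _ _ h
  simpa using this

/-! ### General regret bounds -/

lemma regretAgainst_le_regret (i : Fin k) : E.regretAgainst T π i ≤ E.regret T π :=
  le_ciSup (f := fun i => E.regretAgainst T π i) (Set.finite_range _).bddAbove i

lemma regret_le (hk : 1 ≤ k) {B : ℝ} (h : ∀ i, E.regretAgainst T π i ≤ B) : E.regret T π ≤ B := by
  have : Nonempty (Fin k) := ⟨⟨0, hk⟩⟩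
  exact ciSup_le h

lemma regret_le_two_mul (hk : 1 ≤ k) : E.regret T π ≤ 2 * T := by
  refine E.regret_le hk fun i => ?_
  have h := integral_mono (E.integrable_regret (π := π) (T := T) i) (integrable_const (2 * (T : ℝ)))
    fun ω => (abs_le.1 (E.abs_treeExp_le (E.abs_sum_lossAt_sub_le ω · i) ω)).2
  simpa [regretAgainst, expect_eq_integral_treeExp] using h

/-- The regret is at most of the order `k log T` if there is one arm or the horizon is short. -/
lemma regret_le_of_short (hk : 1 ≤ k) (hT : 2 * k ≤ T) (h : k = 1 ∨ T < 200000000 * k) :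
    E.regret T π ≤ 600000000 * (k * Real.log T) := by
  have hT' : (2 : ℝ) ≤ T := by exact_mod_cast (by omega : 2 ≤ T)
  have hk' : (0 : ℝ) < k := by exact_mod_cast hk
  have hlog : 0.6931471803 < Real.log T :=
    Real.log_two_gt_d9.trans_le (Real.log_le_log (by norm_num) hT')
  rcases h with rfl | h
  · refine (E.regret_le hk fun i => ?_).trans (by positivity : (0 : ℝ) ≤ _)
    have : ∀ (ω : E.Ω) (a : Fin T → Fin 1),
        ∑ t, (E.lossAt ω a t (a t) - E.lossAt ω a t i) = 0 := fun ω a =>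
      Finset.sum_eq_zero fun t _ => by rw [Subsingleton.elim (a t) i, sub_self]
    simp [regretAgainst, expect, this]
  · have h1 : (T : ℝ) ≤ 200000000 * k := by exact_mod_cast h.le
    have h2 := E.regret_le_two_mul (T := T) (π := π) hk
    nlinarith

/-- Jensen for the square root, through AM-GM with a free `m` that is optimized after integration.
Only `Y` must be integrable: `S` is chosen for each `ω` separately, with no measurability in `ω`. -/
lemma regretAgainst_le_of_conditional {Y : E.Ω → ℝ} (hY : Integrable Y E.μ) {i : Fin k} {A B : ℝ}
    (hB : 0 ≤ B)
    (h : ∀ᵐ ω ∂E.μ, ∃ S : (Fin T → Fin k) → ℝ, (∀ a, 0 ≤ S a) ∧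
      (treeExp (E.weights π ω) (fun a : Fin T → Fin k =>
          ∑ t, (E.lossAt ω a t (a t) - E.lossAt ω a t i)) ≤
        A + B * treeExp (E.weights π ω) fun a => √(S a)) ∧ treeExp (E.weights π ω) S ≤ Y ω) :
    E.regretAgainst T π i ≤ A + B * √(∫ ω, Y ω ∂E.μ) := by
  refine le_add_mul_sqrt hB ?_ fun m hm => ?_
  · refine integral_nonneg_of_ae ?_
    filter_upwards [h] with ω hω
    obtain ⟨S, hS, -, h2⟩ := hω
    refine le_trans ?_ h2
    exact (treeExp_const (E.isTree_weights π ω) (n := T) 0).symm.le.trans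
      (treeExp_mono (E.isTree_weights π ω) hS)
  · rw [regretAgainst, expect_eq_integral_treeExp]
    have hrw : (fun ω => A + B * ((Y ω / m + m) / 2)) =
        fun ω => B / (2 * m) * Y ω + (A + B * (m / 2)) := by
      funext ω; field_simp; ring
    have hint : Integrable (fun ω => A + B * ((Y ω / m + m) / 2)) E.μ := by
      rw [hrw]; exact (hY.const_mul _).add (integrable_const _)
    refine (integral_mono_ae (E.integrable_regret i) hint ?_).trans (le_of_eq ?_)
    · filter_upwards [h] with ω hω
      obtain ⟨S, hS, h1, h2⟩ := hω
      refine h1.trans (add_le_add_right (mul_le_mul_of_nonneg_left ?_ hB) _)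
      have hw := E.isTree_weights π ω
      have h3 : treeExp (E.weights π ω) (fun a => √(S a)) ≤
          treeExp (E.weights π ω) (fun a => 1 / (2 * m) * S a + m / 2) := by
        refine treeExp_mono hw fun a => ?_
        have h4 := Real.sq_sqrt (hS a)
        have e : 1 / (2 * m) * S a + m / 2 = (S a + m ^ 2) / (2 * m) := by field_simp
        rw [e, le_div_iff₀ (by positivity)]
        nlinarith [sq_nonneg (√(S a) - m)]
      rw [treeExp_add, treeExp_const_mul, treeExp_const hw] at h3
      have h4 : 1 / (2 * m) * treeExp (E.weights π ω) S ≤ 1 / (2 * m) * Y ω :=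
        mul_le_mul_of_nonneg_left h2 (by positivity)
      have e : (Y ω / m + m) / 2 = 1 / (2 * m) * Y ω + m / 2 := by field_simp
      rw [e]
      linarith
    · rw [hrw, integral_add (hY.const_mul _) (integrable_const _), integral_const_mul, integral_const,
        probReal_univ, one_smul]
      field_simp
      ring

/-! ### The adversarial regime -/

/-- The leading constant 4 comes from `(133/48)² * 2 * 100/99 < 16`. -/
lemma regret_le_adversarial (hk : 2 ≤ k) (hT : 200000000 * k ≤ T) (hπ : IsSPAFTRL T π) :
    E.regret T π ≤ 4 * √(E.L2 T π * Real.log k * Real.log (1 + T)) + 37 * (k * Real.log T) := by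
  have hk1 : 1 ≤ k := by omega
  have hk' : (1 : ℝ) ≤ k := by exact_mod_cast hk1
  have hT' : (0 : ℝ) < T := by exact_mod_cast (by omega : 0 < T)
  have hTk : 200000000 * (k : ℝ) ≤ T := by exact_mod_cast hT
  have hc := c1_pos hk1 (by omega : 2 * k ≤ T)
  refine E.regret_le hk1 fun i => ?_
  set D := 1 / (1 - (k : ℝ) / T) * Real.log k with hD
  have hint := E.integrable_treeExp (π := π) (n := T)
    (f := fun ω a => ∑ t : Fin T, ∑ i, E.lossAt ω a t i ^ 2)
    (fun a => Finset.measurable_sum _ fun t _ => Finset.measurable_sum _ fun i _ =>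
      (E.measurable_lossAt a t i).pow_const 2) fun ω a => E.abs_sum_sq_le ω a
  have h := E.regretAgainst_le_of_conditional (hint.const_mul D) (i := i) (π := π)
    (A := 37 * (k * Real.log T)) (B := 133 / 48 * c1 k T) (by positivity)
    (Filter.Eventually.of_forall fun ω => by
      obtain ⟨S, h0, h1, h2, -⟩ := exists_conditional_bound hk hT hπ E ω
      exact ⟨S, h0, h1 i, h2⟩)
  rw [integral_const_mul, ← expect_eq_integral_treeExp] at h
  change _ ≤ _ + _ * √(D * E.L2 T π) at h
  refine h.trans ?_
  rw [add_comm]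
  refine add_le_add_left ?_ _
  have hL2 : 0 ≤ E.L2 T π := integral_nonneg fun ω => Finset.sum_nonneg fun a _ =>
    mul_nonneg (treeProb_nonneg (E.isTree_weights π ω) a)
      (Finset.sum_nonneg fun t _ => Finset.sum_nonneg fun i _ => sq_nonneg _)
  have hlogk := Real.log_natCast_nonneg k
  have hγ : (k : ℝ) / T ≤ 1 / 100 := by rw [div_le_div_iff₀ hT' (by norm_num)]; linarith
  have hD1 : D ≤ 100 / 99 * Real.log k := by
    refine mul_le_mul_of_nonneg_right ?_ hlogk
    rw [div_le_iff₀ (by linarith)]; linarith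
  have hD0 : 0 ≤ D := mul_nonneg (div_nonneg zero_le_one (by linarith)) hlogk
  have hc2 : c1 k T ^ 2 ≤ 2 * Real.log (1 + T) := by
    rw [c1_sq]
    have h1 : (T : ℝ) / (15 * k) ≤ T := div_le_self hT'.le (by linarith)
    have := Real.log_le_log (by positivity) (show 1 + (T : ℝ) / (15 * k) ≤ 1 + T by linarith)
    linarith
  have hlogT : 0 ≤ Real.log (1 + T) := Real.log_nonneg (by linarith)
  have e : 4 * √(E.L2 T π * Real.log k * Real.log (1 + T)) =
      √(16 * (E.L2 T π * Real.log k * Real.log (1 + T))) := by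
    rw [Real.sqrt_mul (show (0 : ℝ) ≤ 16 by norm_num), show (16 : ℝ) = 4 ^ 2 by norm_num,
      Real.sqrt_sq (show (0 : ℝ) ≤ 4 by norm_num)]
  rw [e]
  refine Real.le_sqrt_of_sq_le ?_
  rw [mul_pow, Real.sq_sqrt (by positivity), mul_pow]
  calc (133 / 48) ^ 2 * c1 k T ^ 2 * (D * E.L2 T π)
      ≤ (133 / 48) ^ 2 * (2 * Real.log (1 + T)) * (100 / 99 * Real.log k * E.L2 T π) := by gcongr
    _ = ((133 / 48) ^ 2 * 2 * (100 / 99)) * (E.L2 T π * Real.log k * Real.log (1 + T)) := by ring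
    _ ≤ _ := mul_le_mul_of_nonneg_right (by norm_num) (by positivity)

lemma L2_eq_zero_of_isSparse_zero (h : E.IsSparse T 0) : E.L2 T π = 0 := by
  refine integral_eq_zero_of_ae ?_
  filter_upwards [h] with ω hω
  refine Finset.sum_eq_zero fun a _ => ?_
  have : ∑ t : Fin T, ∑ i, E.lossAt ω a t i ^ 2 = 0 := Finset.sum_eq_zero fun t _ =>
    Finset.sum_eq_zero fun i _ => by
      have h1 := hω a t
      rw [Nat.le_zero, Set.ncard_eq_zero] at h1
      have h2 : i ∉ {i | E.lossAt ω a t i ≠ 0} := by rw [h1]; exact Set.notMem_empty i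
      have h3 : E.lossAt ω a t i = 0 := by simpa using h2
      rw [h3]; norm_num
  simp [this]

/-! ### The self-bounding regime -/

lemma sum_sq_le_of_ncard_le {s : ℕ} {l : Fin k → ℝ} (hl : ∀ i, |l i| ≤ 1)
    (hs : {i | l i ≠ 0}.ncard ≤ s) : ∑ i, l i ^ 2 ≤ s := by
  classical
  have h1 : ∀ i, l i ^ 2 ≤ if l i ≠ 0 then 1 else 0 := fun i => by
    split_ifs with h
    · rw [sq_le_one_iff_abs_le_one]; exact hl i
    · rw [not_not.1 h]; norm_num
  refine (Finset.sum_le_sum fun i _ => h1 i).trans ?_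
  rw [Finset.sum_boole]
  have h2 : {i | l i ≠ 0}.ncard = (Finset.univ.filter fun i => l i ≠ 0).card := by
    rw [← Set.ncard_coe_finset]; simp
  rw [h2] at hs
  exact_mod_cast hs

lemma two_le_three_log (hk : 2 ≤ k) (hT : 2 * k ≤ T) : 2 ≤ 3 * Real.log (k * T) := by
  have h1 : (4 : ℝ) ≤ k * T := by
    have : 2 * 2 ≤ k * T := Nat.mul_le_mul hk (by omega)
    exact_mod_cast this
  have h2 := Real.log_le_log (by norm_num) h1
  rw [show (4 : ℝ) = 2 ^ 2 by norm_num, Real.log_pow] at h2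
  have := Real.log_two_gt_d9
  push_cast at h2
  linarith

lemma regret_le_selfBounding (hk : 2 ≤ k) (hT : 200000000 * k ≤ T) (hπ : IsSPAFTRL T π) {s : ℕ}
    {Δ : Fin k → ℝ} {C : ℝ} {aStar : Fin k} (hs : E.IsSparse T s) (hE : E.IsSelfBounding T Δ C)
    (hΔ : 0 < gapMin Δ aStar) :
    E.regret T π ≤ 74 * (k * Real.log T) + 12 * Real.log T ^ 2 +
      576 * (s * Real.log T * Real.log (k * T) / gapMin Δ aStar) +
      48 * √(C * s * Real.log T * Real.log (k * T) / gapMin Δ aStar) := by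
  classical
  have hk1 : 1 ≤ k := by omega
  have hT2 : 2 * k ≤ T := by omega
  have hk' : (1 : ℝ) ≤ k := by exact_mod_cast hk1
  have hlog := Real.log_natCast_nonneg T
  have hc := c1_pos hk1 hT2
  have hLL := two_le_three_log hk hT2
  set f : E.Ω → (Fin T → Fin k) → ℝ := fun _ a => ∑ t : Fin T, if a t = aStar then 0 else 1 with hf
  have hf0 : ∀ ω a, 0 ≤ f ω a := fun ω a => Finset.sum_nonneg fun t _ => by split_ifs <;> norm_num
  have hfT : ∀ ω a, |f ω a| ≤ T := fun ω a => by
    rw [abs_of_nonneg (hf0 ω a)]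
    have := Finset.sum_le_card_nsmul Finset.univ (fun t => if a t = aStar then (0 : ℝ) else 1) 1
      fun t _ => by split_ifs <;> norm_num
    simpa using this
  set N := E.expect T π f with hN
  have hint := E.integrable_treeExp (π := π) (f := f) (fun a => measurable_const) hfT
  have hN0 : 0 ≤ N := integral_nonneg fun ω => Finset.sum_nonneg fun a _ =>
    mul_nonneg (treeProb_nonneg (E.isTree_weights π ω) a) (hf0 ω a)
  have hreg : ∀ i, E.regretAgainst T π i ≤ 37 * (k * Real.log T) + 133 / 48 * c1 k T *
      √(2 * Real.log T ^ 3 + 8 * (Real.log (k * T) + 2) * (s * N)) := fun i => by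
    have h := E.regretAgainst_le_of_conditional (Y := fun ω => 2 * Real.log T ^ 3 +
        8 * (Real.log (k * T) + 2) * (s * treeExp (E.weights π ω) (f ω)))
      ((integrable_const _).add ((hint.const_mul _).const_mul _)) (i := i) (π := π)
      (A := 37 * (k * Real.log T)) (B := 133 / 48 * c1 k T) (by positivity) (by
        filter_upwards [hs] with ω hω
        obtain ⟨S, h0, h1, -, h3⟩ := exists_conditional_bound hk hT hπ E ω
        refine ⟨S, h0, h1 i, (h3 aStar).trans (add_le_add_right (mul_le_mul_of_nonneg_left ?_
          (by linarith)) _)⟩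
        have hw := E.isTree_weights π ω
        have h4 := treeExp_sum_eval hw (T := T) fun t b i => if i = aStar then 0 else 1
        have h5 : treeExp (E.weights π ω) (f ω) = treeExp (E.weights π ω)
            (fun a : Fin T → Fin k => ∑ t : Fin T, (1 - E.weights π ω t (Fin.take t t.isLt.le a) aStar)) := by
          refine h4.trans ?_
          congr 1
          funext a
          refine Finset.sum_congr rfl fun t _ => ?_
          exact sum_mul_ite_eq (hw.sum_eq_one t _) aStar
        rw [h5, ← treeExp_const_mul]
        refine treeExp_mono hw fun a => ?_
        rw [Finset.mul_sum]
        refine Finset.sum_le_sum fun t _ => mul_le_mul_of_nonneg_right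
          (sum_sq_le_of_ncard_le (E.abs_lossAt_le ω a t) (hω a t)) (sub_nonneg.2 ?_)
        exact le_one_of_sum_eq_one (hw.nonneg t _) (hw.sum_eq_one t _) aStar)
    rwa [integral_add (integrable_const _) ((hint.const_mul _).const_mul _), integral_const,
      probReal_univ, one_smul, integral_const_mul, integral_const_mul,
      ← expect_eq_integral_treeExp] at h
  -- The constraint is applied to `π` itself; every round off `aStar` counts at least the minimal
  -- gap.
  have hlow : gapMin Δ aStar * N ≤ E.regret T π + C := by
    have h1 := hE.le_regret π
    have h2 : gapMin Δ aStar * N - C ≤ E.expect T π (fun _ a => (∑ t : Fin T, Δ (a t)) - C) := by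
      rw [hN, expect_eq_integral_treeExp, expect_eq_integral_treeExp, ← integral_const_mul]
      have e : (∫ ω, gapMin Δ aStar * treeExp (E.weights π ω) (f ω) ∂E.μ) - C =
          ∫ ω, (gapMin Δ aStar * treeExp (E.weights π ω) (f ω) - C) ∂E.μ := by
        rw [integral_sub (hint.const_mul _) (integrable_const C)]; simp
      rw [e]
      refine integral_mono ((hint.const_mul _).sub (integrable_const C))
        (E.integrable_treeExp (fun a => measurable_const) (B := 2 * T + C) fun ω a => ?_) fun ω => ?_
      · have h3 : |∑ t : Fin T, Δ (a t)| ≤ 2 * T := by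
          rw [abs_of_nonneg (Finset.sum_nonneg fun t _ => (hE.gap_mem _).1)]
          have := Finset.sum_le_card_nsmul Finset.univ (fun t => Δ (a t)) 2
            fun t _ => (hE.gap_mem _).2
          rw [Finset.card_univ, Fintype.card_fin, nsmul_eq_mul] at this
          linarith
        refine (abs_sub _ _).trans ?_
        rw [abs_of_nonneg hE.C_nonneg]
        linarith
      · have hw := E.isTree_weights π ω
        simp only [sub_eq_add_neg]
        rw [treeExp_add, treeExp_const hw, ← treeExp_const_mul]
        refine add_le_add_left (treeExp_mono hw fun a => ?_) _
        rw [hf, Finset.mul_sum]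
        refine Finset.sum_le_sum fun t _ => ?_
        split_ifs with h
        · rw [mul_zero]; exact (hE.gap_mem _).1
        · rw [mul_one]
          exact ciInf_le (f := fun a : {a : Fin k // a ≠ aStar} => Δ a)
            (Set.finite_range _).bddBelow ⟨a t, h⟩
    linarith
  exact le_of_self_bounding (by positivity) hlog hLL (c1_sq_le hk1 hT2) (Nat.cast_nonneg s) hN0
    hΔ hE.C_nonneg (E.regret_le hk1 hreg) hlow

lemma gapMin_le_two (hk : 2 ≤ k) {Δ : Fin k → ℝ} (h : ∀ i, Δ i ≤ 2) (aStar : Fin k) :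
    gapMin Δ aStar ≤ 2 := by
  have : Nontrivial (Fin k) := Fin.nontrivial_iff_two_le.2 hk
  obtain ⟨j, hj⟩ := exists_ne aStar
  exact (ciInf_le (f := fun a : {a : Fin k // a ≠ aStar} => Δ a)
    (Set.finite_range _).bddBelow ⟨j, hj⟩).trans (h j)

end Environment

namespace Environment

variable {k : ℕ} (E : Environment.{u} k) {T : ℕ} {π : Policy k}

/-! ### The stochastic regime -/

/-- The probability, given the randomness of the environment, that arm `i` is chosen in round `t`. -/
def armProb (π : Policy k) (ω : E.Ω) (t : ℕ) (i : Fin k) : ℝ :=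
  treeExp (E.weights π ω) fun b : Fin t → Fin k => E.weights π ω t b i

lemma measurable_armProb (t : ℕ) (i : Fin k) : Measurable fun ω => E.armProb π ω t i :=
  E.measurable_treeExp fun b => E.measurable_weights t b i

lemma weights_le_one (ω : E.Ω) (t : ℕ) (b : Fin t → Fin k) (i : Fin k) : E.weights π ω t b i ≤ 1 :=
  le_one_of_sum_eq_one ((E.isTree_weights π ω).nonneg t b) ((E.isTree_weights π ω).sum_eq_one t b) i

lemma abs_armProb_le (ω : E.Ω) (t : ℕ) (i : Fin k) : |E.armProb π ω t i| ≤ 1 :=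
  E.abs_treeExp_le (fun b => by
    rw [abs_of_nonneg ((E.isTree_weights π ω).nonneg t b i)]; exact E.weights_le_one ω t b i) ω

lemma sum_armProb (ω : E.Ω) (t : ℕ) : ∑ i, E.armProb π ω t i = 1 := by
  have hw := E.isTree_weights π ω
  simp only [armProb]
  rw [← treeExp_sum]
  simp only [hw.sum_eq_one, treeExp_const hw]

lemma integrable_armProb_mul {f : E.Ω → ℝ} (hf : Measurable f) {B : ℝ} (hB : ∀ ω, |f ω| ≤ B) (t : ℕ)
    (i : Fin k) : Integrable (fun ω => E.armProb π ω t i * f ω) E.μ :=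
  Integrable.of_bound ((E.measurable_armProb t i).mul hf).aestronglyMeasurable B
    (Filter.Eventually.of_forall fun ω => by
      rw [Real.norm_eq_abs, abs_mul]
      have := E.abs_armProb_le (π := π) ω t i
      nlinarith [hB ω, abs_nonneg (f ω), abs_nonneg (E.armProb π ω t i)])

lemma measurable_of_loss_eq (hk : 1 ≤ k) {X : ℕ → E.Ω → Fin k → ℝ}
    (hX : ∀ t ω a, E.loss t ω a = X t ω) (t : ℕ) : Measurable (X t) := by
  refine measurable_pi_lambda _ fun i => ?_
  have := E.measurable_loss t (fun _ => ⟨0, hk⟩) i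
  simpa only [hX] using this

/-- The arms of a round are independent of its losses. -/
lemma integral_armProb_mul (hk : 1 ≤ k) {X : ℕ → E.Ω → Fin k → ℝ}
    (hX : ∀ t ω a, E.loss t ω a = X t ω) (hind : iIndepFun X E.μ) {ν : Measure (Fin k → ℝ)}
    (hν : ∀ t, E.μ.map (X t) = ν) {f : (Fin k → ℝ) → ℝ} (hf : Measurable f) (t : ℕ) (i : Fin k) :
    ∫ ω, E.armProb π ω t i * f (X t ω) ∂E.μ = (∫ ω, E.armProb π ω t i ∂E.μ) * ∫ x, f x ∂ν := by
  have hXm := E.measurable_of_loss_eq hk hX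
  -- The arm probabilities of round `t` are a function `φ` of the losses of earlier rounds, which
  -- are independent of `X t`. The value 0 of `ext` outside `S` is never read.
  set S := Finset.range t
  have hind' := hind.indepFun_finset S {t} (by simp [S]) hXm
  set ext : (S → Fin k → ℝ) → ℕ → Fin k → ℝ := fun x s => if h : s ∈ S then x ⟨s, h⟩ else 0 with hext
  set w : (S → Fin k → ℝ) → (s : ℕ) → (Fin s → Fin k) → Fin k → ℝ := fun x s b j =>
    π.prob s (fun r => (b r, ext x r (b r))) j with hw
  set φ : (S → Fin k → ℝ) → ℝ := fun x => treeExp (w x) fun b : Fin t → Fin k => w x t b i with hφ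
  have hextm : ∀ (s : ℕ) (j : Fin k), Measurable fun x => ext x s j := fun s j => by
    by_cases h : s ∈ S
    · simp only [hext, h, dif_pos]
      exact (measurable_pi_apply j).comp (measurable_pi_apply _)
    · simp only [hext, h, dif_neg, not_false_eq_true]
      exact measurable_const
  have hwm : ∀ (s : ℕ) (b : Fin s → Fin k) (j : Fin k), Measurable fun x => w x s b j := fun s b j =>
    (π.measurable_prob s j).comp
      (measurable_pi_lambda _ fun r => measurable_const.prodMk (hextm _ _))
  have hφm : Measurable φ := Finset.measurable_sum _ fun b _ =>
    (Finset.measurable_prod _ fun _ _ => hwm _ _ _).mul (hwm _ _ _)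
  have hweq : ∀ (ω : E.Ω) (s : ℕ), s ≤ t → ∀ (b : Fin s → Fin k) (j : Fin k),
      w (fun r : S => X r ω) s b j = E.weights π ω s b j := fun ω s hs b j => by
    simp only [hw, weights]
    congr 1
    funext r
    have : (r : ℕ) ∈ S := Finset.mem_range.2 (r.isLt.trans_le hs)
    simp only [hext, dif_pos this, obs, hX]
  have hφeq : ∀ ω, φ (fun r : S => X r ω) = E.armProb π ω t i := fun ω => by
    simp only [hφ, armProb, treeExp, treeProb]
    refine Finset.sum_congr rfl fun b _ => ?_
    rw [hweq ω t le_rfl]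
    congr 1
    exact Finset.prod_congr rfl fun s _ => hweq ω s s.isLt.le _ _
  have hind'' : IndepFun (fun ω => E.armProb π ω t i) (fun ω => f (X t ω)) E.μ := by
    have := hind'.comp hφm (hf.comp (measurable_pi_apply (⟨t, Finset.mem_singleton_self t⟩ :
      ({t} : Finset ℕ))))
    have e : (φ ∘ fun ω (r : S) => X r ω) = fun ω => E.armProb π ω t i := funext hφeq
    rw [e] at this
    exact this
  rw [hind''.integral_fun_mul_eq_mul_integral (E.measurable_armProb t i).aestronglyMeasurable
    (hf.comp (hXm t)).aestronglyMeasurable, ← hν t,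
    integral_map (hXm t).aemeasurable hf.aestronglyMeasurable]

lemma regret_le_stochastic (hk : 2 ≤ k) (hT : 200000000 * k ≤ T) (hπ : IsSPAFTRL T π)
    {ν : Measure (Fin k → ℝ)} {aStar : Fin k} (hE : E.IsStochastic ν)
    (hΔ : 0 < gapMin (gap ν aStar) aStar) :
    E.regret T π ≤ 74 * (k * Real.log T) + 12 * Real.log T ^ 2 +
      576 * ((∫ x, ∑ i, x i ^ 2 ∂ν) * Real.log T * Real.log (k * T) / gapMin (gap ν aStar) aStar) := by
  have hk1 : 1 ≤ k := by omega
  have hT2 : 2 * k ≤ T := by omega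
  have hk' : (1 : ℝ) ≤ k := by exact_mod_cast hk1
  have hlog := Real.log_natCast_nonneg T
  have hc := c1_pos hk1 hT2
  have hLL := two_le_three_log hk hT2
  obtain ⟨X, hX, hind, hν⟩ := hE
  have hXm := E.measurable_of_loss_eq hk1 hX
  have hX1 : ∀ t ω i, |X t ω i| ≤ 1 := fun t ω i => by
    rw [← hX t ω fun _ => i]; exact E.abs_loss_le_one _ _ _ _
  have hlossAt : ∀ ω (a : Fin T → Fin k) t, E.lossAt ω a t = X t ω := fun ω a t => hX _ _ _
  set m2 := ∫ x, ∑ i, x i ^ 2 ∂ν with hm2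
  have hm20 : 0 ≤ m2 := integral_nonneg fun x => Finset.sum_nonneg fun i _ => sq_nonneg _
  set p : ℕ → Fin k → ℝ := fun t i => ∫ ω, E.armProb π ω t i ∂E.μ with hp
  have hpi : ∀ t i, Integrable (fun ω => E.armProb π ω t i) E.μ := fun t i => by
    have := E.integrable_armProb_mul (π := π) (f := fun _ => 1) measurable_const (B := 1)
      (by simp) t i
    simpa using this
  have hp0 : ∀ t i, 0 ≤ p t i := fun t i => integral_nonneg fun ω => Finset.sum_nonneg fun b _ =>
    mul_nonneg (treeProb_nonneg (E.isTree_weights π ω) b) ((E.isTree_weights π ω).nonneg _ _ _)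
  have hp1 : ∀ t, ∑ i, p t i = 1 := fun t => by
    simp only [hp]
    rw [← integral_finsetSum _ fun i _ => hpi t i]
    simp [sum_armProb]
  set N := ∑ t : Fin T, (1 - p t aStar) with hN
  have hN0 : 0 ≤ N := Finset.sum_nonneg fun t _ =>
    sub_nonneg.2 (le_one_of_sum_eq_one (hp0 t) (hp1 t) aStar)
  set g : (Fin k → ℝ) → ℝ := fun x => ∑ i, x i ^ 2 with hg
  have hgm : Measurable g := Finset.measurable_sum _ fun i _ => (measurable_pi_apply i).pow_const 2
  have hgB : ∀ t ω, |g (X t ω)| ≤ k := fun t ω => by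
    rw [abs_of_nonneg (Finset.sum_nonneg fun i _ => sq_nonneg _)]
    have := Finset.sum_le_card_nsmul Finset.univ (fun i => X t ω i ^ 2) 1
      fun i _ => by rw [sq_le_one_iff_abs_le_one]; exact hX1 t ω i
    simpa using this
  have hgi : ∀ t, Integrable (fun ω => g (X t ω)) E.μ := fun t =>
    Integrable.of_bound (hgm.comp (hXm t)).aestronglyMeasurable k
      (Filter.Eventually.of_forall fun ω => hgB t ω)
  have hterm : ∀ t i, Integrable (fun ω => E.armProb π ω t i * g (X t ω)) E.μ := fun t i =>
    E.integrable_armProb_mul (hgm.comp (hXm t)) (hgB t) t i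
  -- The losses do not react to the arms, so the squared norm factors out of the expectation over
  -- the arms.
  have hYeq : ∀ ω, treeExp (E.weights π ω) (fun a : Fin T → Fin k => ∑ t : Fin T,
      (∑ i, E.lossAt ω a t i ^ 2) * (1 - E.weights π ω t (Fin.take t t.isLt.le a) aStar)) =
      ∑ t : Fin T, (g (X t ω) - E.armProb π ω t aStar * g (X t ω)) := fun ω => by
    have hw := E.isTree_weights π ω
    rw [treeExp_sum]
    refine Finset.sum_congr rfl fun t _ => ?_
    simp only [hlossAt]
    rw [treeExp_const_mul, treeExp_take hw t.isLt.le fun b => 1 - E.weights π ω t b aStar]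
    have : treeExp (E.weights π ω) (fun b : Fin t → Fin k => 1 - E.weights π ω t b aStar) =
        1 - E.armProb π ω t aStar := by
      have h1 := treeExp_add (w := E.weights π ω) (fun _ : Fin t → Fin k => 1)
        fun b => -1 * E.weights π ω t b aStar
      rw [treeExp_const hw, treeExp_const_mul] at h1
      have h2 : (fun b : Fin t → Fin k => 1 - E.weights π ω t b aStar) =
          fun b => 1 + -1 * E.weights π ω t b aStar := by funext b; ring
      rw [h2, h1, armProb]; ring
    rw [this]
    ring
  have hYi : Integrable (fun ω => ∑ t : Fin T, (g (X t ω) - E.armProb π ω t aStar * g (X t ω))) E.μ :=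
    integrable_finsetSum _ fun t _ => (hgi t).sub (hterm t aStar)
  have hYint : ∫ ω, ∑ t : Fin T, (g (X t ω) - E.armProb π ω t aStar * g (X t ω)) ∂E.μ = m2 * N := by
    rw [integral_finsetSum]
    swap
    · exact fun t _ => (hgi t).sub (hterm t aStar)
    rw [hN, Finset.mul_sum]
    refine Finset.sum_congr rfl fun t _ => ?_
    rw [integral_sub (hgi t) (hterm t aStar), E.integral_armProb_mul hk1 hX hind hν hgm]
    have : ∫ ω, g (X t ω) ∂E.μ = m2 := by
      rw [hm2, ← hν t, integral_map (hXm t).aemeasurable hgm.aestronglyMeasurable]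
    rw [this]
    simp only [hp]
    ring
  have hreg : ∀ i, E.regretAgainst T π i ≤ 37 * (k * Real.log T) + 133 / 48 * c1 k T *
      √(2 * Real.log T ^ 3 + 8 * (Real.log (k * T) + 2) * (m2 * N)) := fun i => by
    have h := E.regretAgainst_le_of_conditional (Y := fun ω => 2 * Real.log T ^ 3 +
        8 * (Real.log (k * T) + 2) *
          ∑ t : Fin T, (g (X t ω) - E.armProb π ω t aStar * g (X t ω)))
      ((integrable_const _).add (hYi.const_mul _)) (i := i) (π := π)
      (A := 37 * (k * Real.log T)) (B := 133 / 48 * c1 k T) (by positivity)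
      (Filter.Eventually.of_forall fun ω => by
        obtain ⟨S, h0, h1, -, h3⟩ := exists_conditional_bound hk hT hπ E ω
        have h4 := h3 aStar
        rw [hYeq] at h4
        exact ⟨S, h0, h1 i, h4⟩)
    rwa [integral_add (integrable_const _) (hYi.const_mul _), integral_const,
      probReal_univ, one_smul, integral_const_mul, hYint] at h
  -- By independence the regret against `aStar` is exactly the sum of arm probabilities times gaps,
  -- so the self-bounding argument applies with `C = 0`.
  have hlow : gapMin (gap ν aStar) aStar * N ≤ E.regret T π + 0 := by
    rw [add_zero]
    refine le_trans ?_ (E.regretAgainst_le_regret aStar)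
    have hdm : ∀ i, Measurable fun x : Fin k → ℝ => x i - x aStar := fun i =>
      (measurable_pi_apply i).sub (measurable_pi_apply aStar)
    have hdi : ∀ (t : ℕ) i, Integrable
        (fun ω => E.armProb π ω t i * (X t ω i - X t ω aStar)) E.μ := fun t i =>
      E.integrable_armProb_mul ((hdm i).comp (hXm t)) (B := 2) (fun ω => by
        refine (abs_sub _ _).trans ?_
        linarith [hX1 t ω i, hX1 t ω aStar]) t i
    have h1 : E.regretAgainst T π aStar = ∑ t : Fin T, ∑ i, p t i * gap ν aStar i := by
      rw [regretAgainst, expect_eq_integral_treeExp]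
      have h2 : ∀ ω, treeExp (E.weights π ω) (fun a : Fin T → Fin k =>
          ∑ t, (E.lossAt ω a t (a t) - E.lossAt ω a t aStar)) =
          ∑ t : Fin T, ∑ i, E.armProb π ω t i * (X t ω i - X t ω aStar) := fun ω => by
        simp only [hlossAt]
        rw [treeExp_sum]
        refine Finset.sum_congr rfl fun t _ => ?_
        rw [treeExp_eval (E.isTree_weights π ω) t fun _ i => X t ω i - X t ω aStar, treeExp_sum]
        refine Finset.sum_congr rfl fun i _ => ?_
        rw [armProb, mul_comm, ← treeExp_const_mul]
        congr 1
        funext b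
        ring
      simp only [h2]
      rw [integral_finsetSum]
      swap
      · exact fun t _ => integrable_finsetSum _ fun i _ => hdi t i
      refine Finset.sum_congr rfl fun t _ => ?_
      rw [integral_finsetSum _ fun i _ => hdi t i]
      exact Finset.sum_congr rfl fun i _ => E.integral_armProb_mul hk1 hX hind hν (hdm i) t i
    rw [h1, hN, Finset.mul_sum]
    refine Finset.sum_le_sum fun t _ => ?_
    rw [← sum_mul_ite_eq (hp1 t) aStar, Finset.mul_sum]
    refine Finset.sum_le_sum fun i _ => ?_
    split_ifs with h
    · subst h; simp [gap]
    · have : gapMin (gap ν aStar) aStar ≤ gap ν aStar i :=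
        ciInf_le (f := fun a : {a : Fin k // a ≠ aStar} => gap ν aStar a)
          (Set.finite_range _).bddBelow ⟨i, h⟩
      nlinarith [hp0 t i]
  have := le_of_self_bounding (by positivity) hlog hLL (c1_sq_le hk1 hT2) hm20 hN0
    hΔ le_rfl (E.regret_le hk1 hreg) hlow
  simpa using this

end Environment

end SparseBandit

end

theorem theorem2 :
    ∃ K : ℝ, 0 < K ∧ ∀ k T : ℕ, 1 ≤ k → 2 * k ≤ T →
      (∃ π : SparseBandit.Policy k, SparseBandit.IsSPAFTRL T π) ∧
      ∀ π : SparseBandit.Policy k, SparseBandit.IsSPAFTRL T π →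
        -- adversarial regime
        (∀ E : SparseBandit.Environment.{u} k,
          E.regret T π ≤
            4 * √(E.L2 T π * Real.log k * Real.log (1 + T)) + K * (k * Real.log T)) ∧
        -- adversarial regime with a self-bounding constraint
        (∀ (E : SparseBandit.Environment.{u} k) (s : ℕ) (Δ : Fin k → ℝ) (C : ℝ) (aStar : Fin k),
          E.IsSparse T s → E.IsSelfBounding T Δ C → 0 < SparseBandit.gapMin Δ aStar →
          E.regret T π ≤
            K * (s * Real.log T * Real.log (k * T) / SparseBandit.gapMin Δ aStar +
              √(C * s * Real.log T * Real.log (k * T) / SparseBandit.gapMin Δ aStar) +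
              k * Real.log T)) ∧
        -- stochastic regime
        (∀ (E : SparseBandit.Environment.{u} k) (ν : MeasureTheory.Measure (Fin k → ℝ))
            (aStar : Fin k),
          E.IsStochastic ν → 0 < SparseBandit.gapMin (SparseBandit.gap ν aStar) aStar →
          E.regret T π ≤
            K * ((∫ x, ∑ i, x i ^ 2 ∂ν) * Real.log T * Real.log (k * T) /
                SparseBandit.gapMin (SparseBandit.gap ν aStar) aStar +
              (k * Real.log T + Real.log T ^ 2))) := by
  -- The size of the constant comes from short horizons: there the regret is at most `2T < 4 * 10⁸
  -- k`, and `log T ≥ log 2`. With one arm the regret vanishes.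
  refine ⟨600000000, by norm_num, fun k T hk hT => ⟨SparseBandit.exists_isSPAFTRL hk hT,
    fun π hπ => ?_⟩⟩
  have hk' : (1 : ℝ) ≤ k := by exact_mod_cast hk
  have hT' : (1 : ℝ) ≤ T := by exact_mod_cast (by omega : 1 ≤ T)
  have hΛ : 0 ≤ Real.log T := Real.log_nonneg hT'
  have hΛk : Real.log T ≤ Real.log (k * T) := Real.log_le_log (by positivity) (by nlinarith)
  have hLL : 0 ≤ Real.log (k * T) := hΛ.trans hΛk
  have hB : 0 ≤ k * Real.log T := by positivity
  by_cases hcase : k = 1 ∨ T < 200000000 * k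
  · refine ⟨fun E => ?_, fun E s Δ C aStar _ _ hΔ => ?_, fun E ν aStar _ hΔ => ?_⟩
    · have h1 := E.regret_le_of_short (π := π) hk hT hcase
      have h2 := Real.sqrt_nonneg (E.L2 T π * Real.log k * Real.log (1 + T))
      linarith
    · have h1 := E.regret_le_of_short (π := π) hk hT hcase
      have h2 := Real.sqrt_nonneg (C * s * Real.log T * Real.log (k * T) / SparseBandit.gapMin Δ aStar)
      have h3 : 0 ≤ s * Real.log T * Real.log (k * T) / SparseBandit.gapMin Δ aStar := by positivity
      linarith
    · have h1 := E.regret_le_of_short (π := π) hk hT hcase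
      have h2 : 0 ≤ ∫ x, ∑ i, x i ^ 2 ∂ν :=
        MeasureTheory.integral_nonneg fun x => Finset.sum_nonneg fun i _ => sq_nonneg _
      have h3 : 0 ≤ (∫ x, ∑ i, x i ^ 2 ∂ν) * Real.log T * Real.log (k * T) /
        SparseBandit.gapMin (SparseBandit.gap ν aStar) aStar := by positivity
      have h4 := sq_nonneg (Real.log T)
      linarith
  · push Not at hcase
    obtain ⟨hk1, hTk⟩ := hcase
    have hk2 : 2 ≤ k := by omega
    refine ⟨fun E => ?_, fun E s Δ C aStar hs hE hΔ => ?_, fun E ν aStar hE hΔ => ?_⟩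
    · have h1 := E.regret_le_adversarial hk2 hTk hπ
      linarith
    · have h2 := Real.sqrt_nonneg (C * s * Real.log T * Real.log (k * T) / SparseBandit.gapMin Δ aStar)
      have h3 : 0 ≤ s * Real.log T * Real.log (k * T) / SparseBandit.gapMin Δ aStar := by positivity
      -- The remainder `log² T` can be absorbed only for `s ≥ 1`, using that the gap is at most 2.
      -- For `s = 0` all losses vanish and the adversarial bound suffices.
      rcases Nat.eq_zero_or_pos s with rfl | hspos
      · have h1 := E.regret_le_adversarial hk2 hTk hπ
        rw [E.L2_eq_zero_of_isSparse_zero hs] at h1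
        simp only [zero_mul, Real.sqrt_zero, mul_zero, zero_add] at h1
        linarith
      · have h1 := E.regret_le_selfBounding hk2 hTk hπ hs hE hΔ
        have h4 := SparseBandit.Environment.gapMin_le_two hk2 (fun i => (hE.gap_mem i).2) aStar
        have h5 : Real.log T ^ 2 ≤
            2 * (s * Real.log T * Real.log (k * T) / SparseBandit.gapMin Δ aStar) := by
          have hs1 : (1 : ℝ) ≤ s := by exact_mod_cast hspos
          rw [← mul_div_assoc, le_div_iff₀ hΔ]
          have h6 : Real.log T ^ 2 ≤ s * Real.log T * Real.log (k * T) := by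
            calc Real.log T ^ 2 = 1 * Real.log T * Real.log T := by ring
              _ ≤ _ := by gcongr
          nlinarith [sq_nonneg (Real.log T)]
        linarith
    · have h1 := E.regret_le_stochastic hk2 hTk hπ hE hΔ
      have h2 : 0 ≤ ∫ x, ∑ i, x i ^ 2 ∂ν :=
        MeasureTheory.integral_nonneg fun x => Finset.sum_nonneg fun i _ => sq_nonneg _
      have h3 : 0 ≤ (∫ x, ∑ i, x i ^ 2 ∂ν) * Real.log T * Real.log (k * T) /
        SparseBandit.gapMin (SparseBandit.gap ν aStar) aStar := by positivity
      have h4 := sq_nonneg (Real.log T)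
      linarith
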